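/- **Distributed union find.** Let $n$ elements, with identifiers in $\{0,\dots,n-1\}$, be stored on $\ell\ge 1$ servers, where $\ell \mid n$, let $\varepsilon\in(0,1/2)$, and let each server have capacity $(1+\varepsilon)n/\ell$. Initially every element forms a singleton set and every server stores exactly $n/\ell$ elements. A sequence of operations $\mathrm{union}(u,v)$ arrives online; each merges the set of $u$ with the set of $v$. After the last operation all sets have size $n/\ell$. No server may ever exceed its capacity, and after every operation all elements of the same set must be stored on the same server. The moving cost is the number of moves of an element from one server to another (a fixed price per move would only scale all moving costs). An offline solution knows the initial assignment and all operations in advance and obeys the same capacity and collocation constraints after every operation. In a (deterministic) distributed algorithm the servers work in synchronous rounds with a shared clock and all-to-all communication by messages of $b\lceil\lg n\rceil$ bits, where $b$ is a constant. Each server knows $n$, $\ell$, $\varepsilon$ and its own identifier, and initially, of the assignment, only the elements it stores. An operation $\mathrm{union}(u,v)$ reaches only the server(s) storing $u$ and $v$, together with the identifiers of these servers. A server acts only when an operation, a message or an element reaches it; it then changes its local state, sends messages, and moves elements that it stores. All activity caused by an operation ends before the next one arrives. Local computation is free. After every operation the server that stores $x$ can answer $\mathrm{find}(x)$ locally, i.e.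 it knows the set containing $x$. The communication cost is the number of messages sent plus the number of union operations whose two elements are on different servers when the operation arrives. **Theorem.** There are constants $b\in\mathbb N$ and $C$, and for every $c$ a constant $D_c$, such that for all $n$, $\ell$, $\varepsilon$ as above there is a distributed algorithm, with messages of $b\lceil\lg n\rceil$ bits, for the distributed union find problem with the following properties for every initial assignment and every sequence of union operations as above. 1. It is (strictly) $O((\ell\lg n\lg\ell)/\varepsilon)$-competitive: its moving cost is at most $C\,\frac{\ell\lg n\lg\ell}{\varepsilon}$ times the moving cost of every offline solution, in particular of an optimal one. 2. If $\ell\le c\sqrt{\varepsilon n}$, then its communication cost is at most $D_c$ times its moving cost (so for $\ell=O(\sqrt{\varepsilon n})$ the communication cost does not asymptotically exceed the cost of moving elements). -/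

import Mathlib

/-! Distributed union find: `n` elements (with identifiers `Fin n`) are stored on `ℓ` servers
(with identifiers `Fin ℓ`). -/

namespace DistUF

/-! ### The problem -/

/-- After the operations `union(u, v)`, `(u, v) ∈ σ`, the elements `x` and `y` belong to the same
set (initially all sets are singletons). -/
def SameSet {n : ℕ} (σ : List (Fin n × Fin n)) (x y : Fin n) : Prop :=
  Relation.EqvGen (fun a b => (a, b) ∈ σ) x y

/-- When all operations of `σ` have been performed, every set has size `n / ℓ`. -/
def Complete {n : ℕ} (ℓ : ℕ) (σ : List (Fin n × Fin n)) : Prop :=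
  ∀ x, Set.ncard {y | SameSet σ x y} = n / ℓ

/-- The number of elements that the assignment `a` stores on server `j`. -/
def load {n ℓ : ℕ} (a : Fin n → Fin ℓ) (j : Fin ℓ) : ℕ :=
  (Finset.univ.filter (fun x => a x = j)).card

/-- Every server stores exactly `n / ℓ` elements. -/
def PerfectlyBalanced {n ℓ : ℕ} (a : Fin n → Fin ℓ) : Prop :=
  ∀ j, load a j = n / ℓ

/-- No server stores more than `(1 + ε) n / ℓ` elements. -/
def Valid {n ℓ : ℕ} (ε : ℝ) (a : Fin n → Fin ℓ) : Prop :=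
  ∀ j, (load a j : ℝ) ≤ (1 + ε) * ((n : ℝ) / (ℓ : ℝ))

/-- Elements of the same set are stored on the same server. -/
def Collocated {n ℓ : ℕ} (σ : List (Fin n × Fin n)) (a : Fin n → Fin ℓ) : Prop :=
  ∀ x y, SameSet σ x y → a x = a y

/-- The number of elements that have to be moved to get from assignment `a` to assignment `a'`. -/
def dist {n ℓ : ℕ} (a a' : Fin n → Fin ℓ) : ℕ :=
  (Finset.univ.filter (fun x => a' x ≠ a x)).card

/-! ### Offline solutions -/

/-- `s` is an offline solution for the initial assignment `a₀` and the operations `σ` (all of them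
known in advance): `s i` is the assignment after the first `i` operations. -/
structure IsOffline {n ℓ : ℕ} (ε : ℝ) (a₀ : Fin n → Fin ℓ) (σ : List (Fin n × Fin n))
    (s : ℕ → Fin n → Fin ℓ) : Prop where
  zero : s 0 = a₀
  valid : ∀ i ≤ σ.length, Valid ε (s i)
  collocated : ∀ i ≤ σ.length, Collocated (σ.take i) (s i)

/-- The number of element moves of an offline solution for `r` operations. -/
def offlineMoves {n ℓ : ℕ} (s : ℕ → Fin n → Fin ℓ) (r : ℕ) : ℕ :=
  ∑ i ∈ Finset.range r, dist (s i) (s (i + 1))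

/-! ### Distributed algorithms

The servers work in synchronous rounds with all-to-all communication by messages of `w` bits.
A server acts in a round only if something has reached it: a union operation, a message, or an
element. It then changes its local state, sends messages, and moves elements that it stores. Local
computation is free. -/

/-- The operation `union(u, v)`, with the servers that store `u` and `v` at that time. -/
structure Request (n ℓ : ℕ) where
  u : Fin n
  v : Fin n
  serverU : Fin ℓ
  serverV : Fin ℓ

/-- What reaches a server at the start of a round. -/
structure Inbox (n ℓ w : ℕ) where
  /-- a union operation -/
  request : Option (Request n ℓ)
  /-- messages, each with its sender -/
  messages : List (Fin ℓ × BitVec w)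
  /-- elements that other servers have moved to this server -/
  arrived : Finset (Fin n)

/-- Nothing has reached the server. -/
def Inbox.IsEmpty {n ℓ w : ℕ} (I : Inbox n ℓ w) : Prop :=
  I.request = none ∧ I.messages = [] ∧ I.arrived = ∅

/-- What a server does in a round. -/
structure Reaction (State : Type) (n ℓ w : ℕ) where
  /-- its new local state -/
  state : State
  /-- the messages it sends, each with its receiver -/
  send : List (Fin ℓ × BitVec w)
  /-- `move x = some j`: element `x` is to be moved to server `j` (this has an effect only if the
  acting server stores `x`) -/
  move : Fin n → Option (Fin ℓ)

/-- A deterministic distributed online algorithm for `n` elements and `ℓ` servers, with messages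
of `w` bits. -/
structure Algorithm (n ℓ w : ℕ) where
  /-- local states of a server -/
  State : Type
  /-- The initial state of a server, which knows only its identifier and the elements that it
  stores. -/
  start : Fin ℓ → Finset (Fin n) → State
  /-- The action of a server, given its identifier, the shared clock, its state and its inbox. -/
  react : Fin ℓ → ℕ → State → Inbox n ℓ w → Reaction State n ℓ w
  /-- The answer of a server to `find(x)`, for an element `x` that it stores. -/
  find : State → Fin n → Finset (Fin n)
  /-- the number of rounds between two consecutive union operations -/
  rounds : ℕ

/-- A configuration of the whole system. -/
structure Config (State : Type) (n ℓ w : ℕ) where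
  /-- the shared clock: the number of rounds so far -/
  clock : ℕ
  /-- the local states of the servers -/
  state : Fin ℓ → State
  /-- the server on which an element is stored -/
  loc : Fin n → Fin ℓ
  inbox : Fin ℓ → Inbox n ℓ w
  /-- the number of element moves so far -/
  moves : ℕ
  /-- the communication cost so far: the number of messages sent, plus one for each union
  operation whose elements were stored on different servers -/
  comm : ℕ

namespace Algorithm

variable {n ℓ w : ℕ}

/-- The initial configuration for the initial assignment `a₀`. -/
def initial (A : Algorithm n ℓ w) (a₀ : Fin n → Fin ℓ) : Config A.State n ℓ w where
  clock := 0
  state := fun j => A.start j (Finset.univ.filter (fun x => a₀ x = j))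
  loc := a₀
  inbox := fun _ => ⟨none, [], ∅⟩
  moves := 0
  comm := 0

/-- The operation `union(u, v)` reaches the servers that store `u` and `v`. -/
def deliver (A : Algorithm n ℓ w) (c : Config A.State n ℓ w) (q : Fin n × Fin n) :
    Config A.State n ℓ w where
  clock := c.clock
  state := c.state
  loc := c.loc
  inbox := fun j =>
    { request :=
        if j = c.loc q.1 ∨ j = c.loc q.2 then some ⟨q.1, q.2, c.loc q.1, c.loc q.2⟩ else none
      messages := (c.inbox j).messages
      arrived := (c.inbox j).arrived }
  moves := c.moves
  comm := c.comm + if c.loc q.1 = c.loc q.2 then 0 else 1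

open Classical in
/-- The reaction of server `j` in configuration `c`; it stays idle if its inbox is empty. -/
noncomputable def reaction (A : Algorithm n ℓ w) (c : Config A.State n ℓ w) (j : Fin ℓ) :
    Reaction A.State n ℓ w :=
  if (c.inbox j).IsEmpty then ⟨c.state j, [], fun _ => none⟩
  else A.react j c.clock (c.state j) (c.inbox j)

/-- The server on which `x` is stored after the next round. -/
noncomputable def newLoc (A : Algorithm n ℓ w) (c : Config A.State n ℓ w) (x : Fin n) : Fin ℓ :=
  ((A.reaction c (c.loc x)).move x).getD (c.loc x)

/-- One synchronous round. -/
noncomputable def round (A : Algorithm n ℓ w) (c : Config A.State n ℓ w) :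
    Config A.State n ℓ w where
  clock := c.clock + 1
  state := fun j => (A.reaction c j).state
  loc := A.newLoc c
  inbox := fun j =>
    { request := none
      messages := (List.finRange ℓ).flatMap (fun i =>
        ((A.reaction c i).send.filter (fun m => m.1 = j)).map (fun m => (i, m.2)))
      arrived := Finset.univ.filter (fun x => c.loc x ≠ j ∧ A.newLoc c x = j) }
  moves := c.moves + dist c.loc (A.newLoc c)
  comm := c.comm + ∑ j, (A.reaction c j).send.length

/-- The system serves one union operation. -/
noncomputable def serve (A : Algorithm n ℓ w) (c : Config A.State n ℓ w) (q : Fin n × Fin n) :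
    Config A.State n ℓ w :=
  A.round^[A.rounds] (A.deliver c q)

/-- The configuration after the union operations `σ`, one after the other. -/
noncomputable def run (A : Algorithm n ℓ w) (a₀ : Fin n → Fin ℓ) (σ : List (Fin n × Fin n)) :
    Config A.State n ℓ w :=
  σ.foldl A.serve (A.initial a₀)

/-- `A` serves the operations `σ` correctly from the initial assignment `a₀`, with servers of
capacity `(1 + ε) n / ℓ`. -/
structure Solves (A : Algorithm n ℓ w) (ε : ℝ) (a₀ : Fin n → Fin ℓ)
    (σ : List (Fin n × Fin n)) : Prop where
  /-- No server ever exceeds its capacity, not even between two rounds of an operation. -/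
  valid : ∀ (i : ℕ) (hi : i < σ.length), ∀ r ≤ A.rounds,
    Valid ε (A.round^[r] (A.deliver (A.run a₀ (σ.take i)) σ[i])).loc
  /-- After every operation each set is stored on a single server. -/
  collocated : ∀ i ≤ σ.length, Collocated (σ.take i) (A.run a₀ (σ.take i)).loc
  /-- Every operation has been dealt with before the next one comes. -/
  quiet : ∀ i ≤ σ.length, ∀ j, ((A.run a₀ (σ.take i)).inbox j).IsEmpty
  /-- After every operation, the server that stores `x` knows the set that contains `x`. -/
  find : ∀ i ≤ σ.length, ∀ x y,
    y ∈ A.find ((A.run a₀ (σ.take i)).state ((A.run a₀ (σ.take i)).loc x)) x ↔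
      SameSet (σ.take i) x y

end Algorithm

end DistUF

/-! Regard the initial server `a x` as the colour of `x`. Every set finally has size `n / ℓ` and `ε
< 1`, so the last assignment of an offline solution is perfectly balanced
(`Complete.perfectlyBalanced`), and its distance from `a` is a lower bound for the offline cost. The
algorithm is compared with every perfectly balanced `F` that collocates the final sets; it never has
to know `F`.

Early phase. In a remote union the smaller class moves, unless the colour of its server fills more
than two thirds of the union; then the larger class moves. Hence no class is dominated, beyond two
thirds, by a colour foreign to its server (`Anchored`). With `minor` counting the elements of a
class outside its most frequent colour, the current distance from `a` is at most `3 * total minor`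
(`Anchored.dist_le`), and `total minor` is at most `dist a F` (`total_minor_le`). The potential
`minor * log card` grows by at least a sixth of the smaller class in each remote union
(`minor_log_gain_min`), so this phase costs `O(log n) * dist a F` (`EarlyCost.le`).

Late phase. When a move would overfill a server, the assignment after that move is further than `ε n
/ ℓ` from `a`, and therefore `ε n / ℓ < 3 * dist a F`. From now on `n` moves are affordable at a
factor `3 ℓ / ε`. A leader gathers all information and orders all moves: the smaller class moves,
and if it does not fit, the leader rebalances to a balanced collocated assignment closest to a fixed
reference. Smaller classes account for at most `n lg n` moves, and more than `ε n / ℓ` of them,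
counting the one that fails to fit, separate two rebalancings. So there are at most `ℓ lg n / ε`
rebalancings, each costing at most `2 * dist a F` plus the moves since the previous one
(`LateCost.rebalance`). The total is `O(ℓ lg n / ε) * dist a F`; the factor `lg ℓ` of the theorem is
only used as a number that is at least 1 when `ℓ ≥ 2`.

Communication. Early messages number a constant plus one per moved element. The change of phase
needs a report on every element. To pay for it, the leader may take `τ ∘ a` instead of `a` as the
reference, for a permutation `τ` of the servers: this does not alter the distance to the nearest
target, and a fixed-point-free `τ` makes it possible that at least half of the elements move
(`restart_spec`). In the late phase the message to the leader is paid for by the class that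
disappears. The result is `comm ≤ 11 * moves`, whatever the size of `ℓ`.

The operations are analysed on the idealised network `Net`, with sets of typed messages;
`Represents` transfers the conclusions to the real algorithm. Knowledge of the sets survives moves
by `complete_of_transfer`. -/

namespace DistUF

section Classes

open scoped Classical

variable {n ℓ : ℕ}

/-! ### Merging two classes of an equivalence relation -/

/-- The relation `E` after the classes of `u` and `v` have been merged. -/
def join (E : Fin n → Fin n → Prop) (u v x y : Fin n) : Prop :=
  E x y ∨ (E x u ∧ E v y) ∨ (E x v ∧ E u y)

lemma join_comm (E : Fin n → Fin n → Prop) (u v : Fin n) : join E u v = join E v u := by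
  funext x y
  simp only [join, eq_iff_iff]
  tauto

lemma join_equivalence {E : Fin n → Fin n → Prop} (hE : Equivalence E) (u v : Fin n) :
    Equivalence (join E u v) where
  refl x := Or.inl (hE.refl x)
  symm := by
    rintro x y (h | ⟨h, h'⟩ | ⟨h, h'⟩)
    · exact Or.inl (hE.symm h)
    · exact Or.inr (Or.inr ⟨hE.symm h', hE.symm h⟩)
    · exact Or.inr (Or.inl ⟨hE.symm h', hE.symm h⟩)
  trans := by
    have := @hE.trans
    have := @hE.symm
    rintro x y z (h | ⟨h, h'⟩ | ⟨h, h'⟩) (k | ⟨k, k'⟩ | ⟨k, k'⟩) <;> simp only [join] <;> grind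

lemma join_self {E : Fin n → Fin n → Prop} (hE : Equivalence E) {u v : Fin n} (h : E u v) :
    join E u v = E := by
  funext x y
  simp only [join, eq_iff_iff]
  refine ⟨?_, Or.inl⟩
  rintro (h1 | ⟨h1, h2⟩ | ⟨h1, h2⟩)
  · exact h1
  · exact hE.trans h1 (hE.trans h h2)
  · exact hE.trans h1 (hE.trans (hE.symm h) h2)

lemma sameSet_equivalence (σ : List (Fin n × Fin n)) : Equivalence (SameSet σ) :=
  Relation.EqvGen.is_equivalence _

lemma SameSet.append {σ : List (Fin n × Fin n)} {x y : Fin n} (h : SameSet σ x y)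
    (τ : List (Fin n × Fin n)) : SameSet (σ ++ τ) x y :=
  Relation.EqvGen.mono (fun _ _ hab => List.mem_append_left τ hab) _ _ h

lemma sameSet_append_singleton (σ : List (Fin n × Fin n)) (u v : Fin n) :
    SameSet (σ ++ [(u, v)]) = join (SameSet σ) u v := by
  funext x y
  rw [eq_iff_iff]
  constructor
  · intro h
    refine (join_equivalence (sameSet_equivalence σ) u v).eqvGen_iff.1
      (Relation.EqvGen.mono ?_ _ _ h)
    intro a b hab
    rcases List.mem_append.1 hab with h | h
    · exact Or.inl (Relation.EqvGen.rel _ _ h)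
    · simp only [List.mem_singleton, Prod.mk.injEq] at h
      obtain ⟨rfl, rfl⟩ := h
      exact Or.inr (Or.inl ⟨(sameSet_equivalence σ).refl _, (sameSet_equivalence σ).refl _⟩)
  · have huv : SameSet (σ ++ [(u, v)]) u v := Relation.EqvGen.rel _ _ (by simp)
    have heq := sameSet_equivalence (σ ++ [(u, v)])
    rintro (h | ⟨h, h'⟩ | ⟨h, h'⟩)
    · exact h.append _
    · exact heq.trans (h.append _) (heq.trans huv (h'.append _))
    · exact heq.trans (h.append _) (heq.trans (heq.symm huv) (h'.append _))

/-- The class of `x`. -/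
noncomputable def cls (E : Fin n → Fin n → Prop) (x : Fin n) : Finset (Fin n) :=
  Finset.univ.filter (E x)

/-- The classes of `E`. -/
noncomputable def classes (E : Fin n → Fin n → Prop) : Finset (Finset (Fin n)) :=
  Finset.univ.image (cls E)

@[simp] lemma mem_cls {E : Fin n → Fin n → Prop} {x y : Fin n} : y ∈ cls E x ↔ E x y := by
  simp [cls]

lemma cls_eq_iff {E : Fin n → Fin n → Prop} (hE : Equivalence E) {x y : Fin n} :
    cls E x = cls E y ↔ E x y := by
  constructor
  · intro h
    have : y ∈ cls E x := by rw [h]; simpa using hE.refl y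
    simpa using this
  · intro h
    ext z
    simp only [mem_cls]
    exact ⟨hE.trans (hE.symm h), hE.trans h⟩

lemma self_mem_cls {E : Fin n → Fin n → Prop} (hE : Equivalence E) (x : Fin n) : x ∈ cls E x := by
  simpa using hE.refl x

lemma card_cls_pos {E : Fin n → Fin n → Prop} (hE : Equivalence E) (x : Fin n) :
    0 < (cls E x).card := Finset.card_pos.2 ⟨x, self_mem_cls hE x⟩

lemma disjoint_cls {E : Fin n → Fin n → Prop} (hE : Equivalence E) {u v : Fin n} (h : ¬ E u v) :
    Disjoint (cls E u) (cls E v) := by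
  rw [Finset.disjoint_left]
  intro x hx hx'
  simp only [mem_cls] at hx hx'
  exact h (hE.trans hx (hE.symm hx'))

lemma cls_join_left {E : Fin n → Fin n → Prop} (hE : Equivalence E) {u v x : Fin n}
    (hx : E x u ∨ E x v) : cls (join E u v) x = cls E u ∪ cls E v := by
  have := @hE.trans
  have := @hE.symm
  have := hE.refl u
  have := hE.refl v
  ext y
  simp only [mem_cls, join, Finset.mem_union]
  grind

lemma cls_join_of_not {E : Fin n → Fin n → Prop} {u v x : Fin n}
    (hu : ¬ E x u) (hv : ¬ E x v) : cls (join E u v) x = cls E x := by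
  ext y
  simp [join, hu, hv]

lemma classes_join {E : Fin n → Fin n → Prop} (hE : Equivalence E) (u v : Fin n) :
    classes (join E u v) =
      insert (cls E u ∪ cls E v) (((classes E).erase (cls E u)).erase (cls E v)) := by
  ext C
  simp only [classes, Finset.mem_image, Finset.mem_univ, true_and, Finset.mem_insert,
    Finset.mem_erase]
  constructor
  · rintro ⟨x, rfl⟩
    by_cases hx : E x u ∨ E x v
    · exact Or.inl (cls_join_left hE hx)
    · push Not at hx
      rw [cls_join_of_not hx.1 hx.2]
      refine Or.inr ⟨?_, ?_, x, rfl⟩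
      · rw [Ne, cls_eq_iff hE]; exact hx.2
      · rw [Ne, cls_eq_iff hE]; exact hx.1
  · rintro (rfl | ⟨h1, h2, x, rfl⟩)
    · exact ⟨u, cls_join_left hE (Or.inl (hE.refl u))⟩
    · rw [Ne, cls_eq_iff hE] at h1 h2
      exact ⟨x, cls_join_of_not h2 h1⟩

/-- The sum of `g` over all classes. -/
noncomputable def total (E : Fin n → Fin n → Prop) (g : Finset (Fin n) → ℝ) : ℝ :=
  ∑ C ∈ classes E, g C

/-- Every potential is a sum over classes, and a union trades two summands for one. All changes of
potentials, and the count of classes (`g = 1`), come from this identity. -/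
lemma total_join {E : Fin n → Fin n → Prop} (hE : Equivalence E) {u v : Fin n} (h : ¬ E u v)
    (g : Finset (Fin n) → ℝ) :
    total (join E u v) g + g (cls E u) + g (cls E v) = total E g + g (cls E u ∪ cls E v) := by
  have hne : cls E u ≠ cls E v := by rwa [Ne, cls_eq_iff hE]
  have hu : cls E u ∈ classes E := Finset.mem_image_of_mem _ (Finset.mem_univ _)
  have hv : cls E v ∈ (classes E).erase (cls E u) :=
    Finset.mem_erase.2 ⟨hne.symm, Finset.mem_image_of_mem _ (Finset.mem_univ _)⟩
  have hn : cls E u ∪ cls E v ∉ ((classes E).erase (cls E u)).erase (cls E v) := by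
    intro hm
    simp only [Finset.mem_erase, classes, Finset.mem_image, Finset.mem_univ, true_and] at hm
    obtain ⟨_, h2, x, hx⟩ := hm
    have hux : u ∈ cls E x := by rw [hx]; exact Finset.mem_union_left _ (self_mem_cls hE u)
    rw [mem_cls, ← cls_eq_iff hE] at hux
    exact h2 (hx ▸ hux)
  unfold total
  rw [classes_join hE, Finset.sum_insert hn]
  have e1 := Finset.sum_erase_add _ g hu
  have e2 := Finset.sum_erase_add _ g hv
  linarith

lemma sum_classes {E : Fin n → Fin n → Prop} (hE : Equivalence E) (h : Fin n → ℝ) :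
    ∑ C ∈ classes E, ∑ x ∈ C, h x = ∑ x, h x := by
  rw [← Finset.sum_fiberwise_of_maps_to (s := Finset.univ) (t := classes E) (g := cls E)
    (fun x _ => Finset.mem_image_of_mem _ (Finset.mem_univ _))]
  refine Finset.sum_congr rfl fun C hC => ?_
  obtain ⟨z, -, rfl⟩ := Finset.mem_image.1 hC
  refine Finset.sum_congr ?_ fun _ _ => rfl
  ext x
  simp only [mem_cls, Finset.mem_filter, Finset.mem_univ, true_and, cls_eq_iff hE]
  exact ⟨hE.symm, hE.symm⟩

lemma card_classes_le (E : Fin n → Fin n → Prop) : (classes E).card ≤ n := by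
  simpa [classes] using Finset.card_image_le (s := Finset.univ) (f := cls E)

lemma card_classes_join {E : Fin n → Fin n → Prop} (hE : Equivalence E) {u v : Fin n}
    (h : ¬ E u v) : (classes (join E u v)).card + 1 = (classes E).card := by
  have := total_join hE h (fun _ => 1)
  simp only [total, Finset.sum_const, nsmul_eq_mul, mul_one] at this
  exact_mod_cast (by linarith : ((classes (join E u v)).card : ℝ) + 1 = (classes E).card)

end Classes

/-! ### Distances and loads -/

section Dist

variable {n ℓ : ℕ}

lemma dist_self (a : Fin n → Fin ℓ) : dist a a = 0 := by simp [dist]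

lemma dist_comm (a b : Fin n → Fin ℓ) : dist a b = dist b a := by simp [dist, ne_comm]

lemma dist_triangle (a b c : Fin n → Fin ℓ) : dist a c ≤ dist a b + dist b c := by
  unfold dist
  refine le_trans (Finset.card_le_card ?_) (Finset.card_union_le _ _)
  intro x
  simp only [Finset.mem_filter, Finset.mem_univ, true_and, Finset.mem_union]
  intro h
  by_contra! h'
  exact h (h'.2.trans h'.1)

lemma dist_le (a b : Fin n → Fin ℓ) : dist a b ≤ n := by
  simpa [dist] using Finset.card_filter_le (Finset.univ : Finset (Fin n)) (fun x => b x ≠ a x)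

lemma dist_perm (τ : Equiv.Perm (Fin ℓ)) (a b : Fin n → Fin ℓ) : dist (τ ∘ a) (τ ∘ b) = dist a b := by
  simp [dist]

lemma dist_eq_zero {a b : Fin n → Fin ℓ} (h : dist a b = 0) : b = a := by
  funext x
  by_contra hx
  have : x ∈ Finset.univ.filter (fun x => b x ≠ a x) := by simpa using hx
  rw [Finset.card_eq_zero.1 h] at this
  simp at this

lemma load_le (a b : Fin n → Fin ℓ) (j : Fin ℓ) : load b j ≤ load a j + dist a b := by
  unfold load dist
  refine le_trans (Finset.card_le_card ?_) (Finset.card_union_le _ _)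
  intro x
  simp only [Finset.mem_filter, Finset.mem_univ, true_and, Finset.mem_union]
  intro h
  by_cases h' : b x = a x
  · exact Or.inl (h' ▸ h)
  · exact Or.inr h'

lemma load_perm (τ : Equiv.Perm (Fin ℓ)) (a : Fin n → Fin ℓ) (j : Fin ℓ) :
    load (τ ∘ a) j = load a (τ.symm j) := by
  simp [load, Equiv.eq_symm_apply]

lemma PerfectlyBalanced.perm {a : Fin n → Fin ℓ} (h : PerfectlyBalanced a)
    (τ : Equiv.Perm (Fin ℓ)) : PerfectlyBalanced (τ ∘ a) := fun j => by
  rw [load_perm]; exact h _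

lemma PerfectlyBalanced.valid {a : Fin n → Fin ℓ} (h : PerfectlyBalanced a) {ε : ℝ} (hε : 0 < ε)
    (hd : ℓ ∣ n) : Valid ε a := by
  intro j
  rw [h j, Nat.cast_div_charZero hd]
  have : (0 : ℝ) ≤ (n : ℝ) / ℓ := by positivity
  nlinarith

lemma sum_load (a : Fin n → Fin ℓ) : ∑ j, load a j = n := by
  have := Finset.card_eq_sum_card_fiberwise (s := (Finset.univ : Finset (Fin n)))
    (t := (Finset.univ : Finset (Fin ℓ))) (f := a) (by simp)
  simpa [load] using this.symm

/-- An overfull assignment is far from every perfectly balanced one. -/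
lemma PerfectlyBalanced.lt_dist {a b : Fin n → Fin ℓ} (h : PerfectlyBalanced a) {ε : ℝ}
    (hd : ℓ ∣ n) (hb : ¬ Valid ε b) : ε * (n / ℓ) < dist a b := by
  simp only [Valid, not_forall, not_le] at hb
  obtain ⟨j, hj⟩ := hb
  have h1 : (load b j : ℝ) ≤ load a j + dist a b := by exact_mod_cast load_le a b j
  rw [h j, Nat.cast_div_charZero hd] at h1
  linarith

/-- The class of `u` is moved to server `j`. -/
noncomputable def moveTo (E : Fin n → Fin n → Prop) (loc : Fin n → Fin ℓ) (u : Fin n)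
    (j : Fin ℓ) : Fin n → Fin ℓ :=
  open scoped Classical in fun x => if E u x then j else loc x

/-- The number of elements of `C` with colour `c`. -/
def count (a : Fin n → Fin ℓ) (C : Finset (Fin n)) (c : Fin ℓ) : ℕ :=
  (C.filter (fun x => a x = c)).card

lemma count_le (a : Fin n → Fin ℓ) (C : Finset (Fin n)) (c : Fin ℓ) : count a C c ≤ C.card :=
  Finset.card_filter_le _ _

lemma count_union (a : Fin n → Fin ℓ) {A B : Finset (Fin n)} (h : Disjoint A B) (c : Fin ℓ) :
    count a (A ∪ B) c = count a A c + count a B c := by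
  unfold count
  rw [Finset.filter_union, Finset.card_union_of_disjoint]
  exact Finset.disjoint_filter_filter h

lemma count_add_count_le (a : Fin n → Fin ℓ) (C : Finset (Fin n)) {c d : Fin ℓ} (h : c ≠ d) :
    count a C c + count a C d ≤ C.card := by
  unfold count
  rw [← Finset.card_union_of_disjoint]
  · refine Finset.card_le_card fun x hx => ?_
    simp only [Finset.mem_union, Finset.mem_filter] at hx
    tauto
  · rw [Finset.disjoint_left]
    intro x hx hx'
    simp only [Finset.mem_filter] at hx hx'
    exact h (hx.2.symm.trans hx'.2)

lemma dist_eq_sum (a b : Fin n → Fin ℓ) : (dist a b : ℝ) = ∑ x, if b x ≠ a x then (1 : ℝ) else 0 := by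
  rw [dist, Finset.card_filter]; push_cast; rfl

lemma dist_move {loc loc' : Fin n → Fin ℓ} {X : Finset (Fin n)} {s t : Fin ℓ} (hst : s ≠ t)
    (hs : ∀ x ∈ X, loc x = s) (ht : ∀ x ∈ X, loc' x = t) (hX : ∀ x ∉ X, loc' x = loc x) :
    dist loc loc' = X.card := by
  unfold dist
  congr 1
  ext x
  simp only [Finset.mem_filter, Finset.mem_univ, true_and]
  by_cases hx : x ∈ X
  · simp [hx, hs x hx, ht x hx, hst.symm]
  · simp [hx, hX x hx]

/-- On server `r`, exactly the elements of `X` without colour `r` are displaced; outside `X` nothing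
changes. The additive form avoids truncated subtraction. -/
lemma dist_move_add (a : Fin n → Fin ℓ) {loc loc' : Fin n → Fin ℓ} {X : Finset (Fin n)}
    {s t : Fin ℓ} (hs : ∀ x ∈ X, loc x = s) (ht : ∀ x ∈ X, loc' x = t)
    (hX : ∀ x ∉ X, loc' x = loc x) :
    dist a loc' + count a X t = dist a loc + count a X s := by
  have key : ∀ (b : Fin n → Fin ℓ) (r : Fin ℓ), (∀ x ∈ X, b x = r) →
      dist a b + count a X r = (Finset.univ.filter (fun x => x ∉ X ∧ b x ≠ a x)).card + X.card := by
    intro b r hb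
    have h1 : dist a b = (Finset.univ.filter (fun x => x ∉ X ∧ b x ≠ a x)).card
        + (X.filter (fun x => ¬ a x = r)).card := by
      unfold dist
      rw [← Finset.card_union_of_disjoint]
      · congr 1
        ext x
        simp only [Finset.mem_filter, Finset.mem_univ, true_and, Finset.mem_union]
        by_cases hx : x ∈ X
        · simp [hx, hb x hx, eq_comm]
        · simp [hx]
      · rw [Finset.disjoint_left]
        intro x hx hx'
        simp only [Finset.mem_filter] at hx hx'
        exact hx.2.1 hx'.1
    have h2 : count a X r + (X.filter (fun x => ¬ a x = r)).card = X.card :=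
      Finset.card_filter_add_card_filter_not (s := X) (fun x => a x = r)
    omega
  rw [key loc' t ht, key loc s hs]
  congr 2
  ext x
  simp only [Finset.mem_filter, Finset.mem_univ, true_and]
  by_cases hx : x ∈ X
  · simp [hx]
  · simp [hx, hX x hx]

end Dist

end DistUF


namespace DistUF

/-! ### The potential of the early phase -/

section Early

variable {n ℓ : ℕ}

/-- The number of elements of `C` outside the most frequent colour. -/
noncomputable def minor (a : Fin n → Fin ℓ) (C : Finset (Fin n)) : ℝ :=
  C.card - (Finset.univ.sup (count a C) : ℕ)

lemma minor_le (a : Fin n → Fin ℓ) (C : Finset (Fin n)) (c : Fin ℓ) :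
    minor a C ≤ C.card - count a C c := by
  have : (count a C c : ℝ) ≤ (Finset.univ.sup (count a C) : ℕ) := by
    exact_mod_cast Finset.le_sup (f := count a C) (Finset.mem_univ c)
  unfold minor
  linarith

lemma minor_nonneg (a : Fin n → Fin ℓ) (C : Finset (Fin n)) : 0 ≤ minor a C := by
  have : ((Finset.univ.sup (count a C) : ℕ) : ℝ) ≤ C.card := by
    exact_mod_cast Finset.sup_le fun c _ => count_le a C c
  unfold minor
  linarith

lemma exists_minor_eq (j : Fin ℓ) (a : Fin n → Fin ℓ) (C : Finset (Fin n)) :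
    ∃ c, minor a C = C.card - count a C c := by
  obtain ⟨c, -, hc⟩ := Finset.exists_mem_eq_sup Finset.univ ⟨j, Finset.mem_univ j⟩ (count a C)
  exact ⟨c, by rw [minor, hc]⟩

lemma minor_union (j : Fin ℓ) (a : Fin n → Fin ℓ) {A B : Finset (Fin n)} (h : Disjoint A B) :
    ∃ c, minor a (A ∪ B) = (A.card - count a A c) + (B.card - count a B c) := by
  obtain ⟨c, hc⟩ := exists_minor_eq j a (A ∪ B)
  refine ⟨c, ?_⟩
  rw [hc, count_union a h, Finset.card_union_of_disjoint h]
  push_cast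
  ring

/-- The best colour of the union is a candidate in both parts, so `total minor` never decreases
under unions. -/
lemma minor_add_le (j : Fin ℓ) (a : Fin n → Fin ℓ) {A B : Finset (Fin n)} (h : Disjoint A B) :
    minor a A + minor a B ≤ minor a (A ∪ B) := by
  obtain ⟨c, hc⟩ := minor_union j a h
  rw [hc]
  exact add_le_add (minor_le a A c) (minor_le a B c)

/-- The smaller size at least doubles, a gain of `log 2 > 1 / 2`. The larger one gains at least `1 -
b / (a + b) = a / (a + b)`, which is at least `a / (2 * b)`. -/
lemma log_add_sub_log_le {a b : ℝ} (ha : 0 < a) (hab : a ≤ b) :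
    Real.log a ≤ Real.log (a + b) - 1 / 2 ∧ Real.log b ≤ Real.log (a + b) - a / (2 * b) := by
  have hb : 0 < b := ha.trans_le hab
  constructor
  · have h1 : Real.log (2 * a) ≤ Real.log (a + b) := Real.log_le_log (by linarith) (by linarith)
    rw [Real.log_mul (by norm_num) ha.ne'] at h1
    have := Real.log_two_gt_d9
    linarith
  · have h1 : Real.log (b / (a + b)) ≤ b / (a + b) - 1 := Real.log_le_sub_one_of_pos (by positivity)
    rw [Real.log_div hb.ne' (by positivity)] at h1
    have h2 : a / (2 * b) ≤ 1 - b / (a + b) := by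
      rw [one_sub_div (by positivity), add_sub_cancel_right]
      exact div_le_div_of_nonneg_left ha.le (by positivity) (by linarith)
    linarith

/-- The increase of `minor * log card` when `A` and `B` are merged, where `c` is the most frequent
colour of the union. -/
lemma minor_log_gain {mA mB α β a b : ℝ} (hA : 0 ≤ mA) (hB : 0 ≤ mB) (hα : mA ≤ α) (hβ : mB ≤ β)
    (ha : 1 ≤ a) (hab : a ≤ b) :
    α / 2 + β * (a / (2 * b)) ≤
      (α + β) * Real.log (a + b) - mA * Real.log a - mB * Real.log b := by
  obtain ⟨h1, h2⟩ := log_add_sub_log_le (by linarith) hab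
  have la : 0 ≤ Real.log a := Real.log_nonneg ha
  have lb : 0 ≤ Real.log b := Real.log_nonneg (ha.trans hab)
  have e1 : mA * Real.log a ≤ α * (Real.log (a + b) - 1 / 2) :=
    (mul_le_mul_of_nonneg_right hα la).trans (mul_le_mul_of_nonneg_left h1 (hA.trans hα))
  have e2 : mB * Real.log b ≤ β * (Real.log (a + b) - a / (2 * b)) :=
    (mul_le_mul_of_nonneg_right hβ lb).trans (mul_le_mul_of_nonneg_left h2 (hB.trans hβ))
  linarith

lemma minor_log_gain_of_le (j : Fin ℓ) (a : Fin n → Fin ℓ) {A B : Finset (Fin n)}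
    (h : Disjoint A B) (hA : 0 < A.card) (hAB : A.card ≤ B.card) :
    0 ≤ minor a (A ∪ B) * Real.log (A ∪ B).card - minor a A * Real.log A.card
        - minor a B * Real.log B.card ∧
    ∀ s t, s ≠ t → (∀ c, c ≠ s → 3 * count a A c ≤ 2 * A.card) →
      (∀ c, c ≠ t → 3 * count a B c ≤ 2 * B.card) →
      (A.card : ℝ) / 6 ≤ minor a (A ∪ B) * Real.log (A ∪ B).card - minor a A * Real.log A.card
        - minor a B * Real.log B.card := by
  obtain ⟨c, hc⟩ := minor_union j a h
  have hA' : (1 : ℝ) ≤ A.card := by exact_mod_cast hA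
  have hAB' : (A.card : ℝ) ≤ B.card := by exact_mod_cast hAB
  have key := minor_log_gain (minor_nonneg a A) (minor_nonneg a B) (minor_le a A c)
    (minor_le a B c) hA' hAB'
  rw [hc, Finset.card_union_of_disjoint h]
  push_cast
  have hα := (minor_nonneg a A).trans (minor_le a A c)
  have hβ := (minor_nonneg a B).trans (minor_le a B c)
  have hr : 0 ≤ (A.card : ℝ) / (2 * B.card) := by positivity
  refine ⟨le_trans (by positivity) key, fun s t hst hs ht => le_trans ?_ key⟩
  -- The dominant colour `c` of the union cannot belong to both servers. If `c = s`, at least a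
  -- third of `B` has another colour, with weight `a / (2 * b)` per element; otherwise at least a
  -- third of `A` has, with weight `1 / 2`. Either way the gain is at least `A.card / 6`.
  by_cases hcs : c = s
  · have h3 : (3 * count a B c : ℝ) ≤ 2 * B.card := by exact_mod_cast ht c (hcs ▸ hst)
    have h4 : (B.card : ℝ) / 3 * (A.card / (2 * B.card)) = A.card / 6 := by
      have : (B.card : ℝ) ≠ 0 := by linarith
      field_simp
      norm_num
    have h5 : (B.card : ℝ) / 3 * (A.card / (2 * B.card)) ≤
        (B.card - count a B c) * (A.card / (2 * B.card)) :=
      mul_le_mul_of_nonneg_right (by linarith) hr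
    linarith
  · have h3 : (3 * count a A c : ℝ) ≤ 2 * A.card := by exact_mod_cast hs c hcs
    have := mul_nonneg hβ hr
    linarith

/-- The first part serves local unions, which need only monotonicity. The second pays for remote
ones: with anchored classes on different servers the gain is proportional to the smaller class. -/
lemma minor_log_gain_min (j : Fin ℓ) (a : Fin n → Fin ℓ) {A B : Finset (Fin n)}
    (h : Disjoint A B) (hA : 0 < A.card) (hB : 0 < B.card) :
    0 ≤ minor a (A ∪ B) * Real.log (A ∪ B).card - minor a A * Real.log A.card
        - minor a B * Real.log B.card ∧
    ∀ s t, s ≠ t → (∀ c, c ≠ s → 3 * count a A c ≤ 2 * A.card) →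
      (∀ c, c ≠ t → 3 * count a B c ≤ 2 * B.card) →
      ((min A.card B.card : ℕ) : ℝ) / 6 ≤ minor a (A ∪ B) * Real.log (A ∪ B).card
        - minor a A * Real.log A.card - minor a B * Real.log B.card := by
  rcases le_total A.card B.card with hl | hl
  · rw [min_eq_left hl]
    exact minor_log_gain_of_le j a h hA hl
  · rw [min_eq_right hl, Finset.union_comm]
    obtain ⟨h1, h2⟩ := minor_log_gain_of_le j a h.symm hB hl
    refine ⟨by linarith, fun s t hst hs ht => ?_⟩
    have := h2 t s hst.symm ht hs
    linarith

/-- No class contains more than two thirds of a colour different from the server storing it. -/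
def Anchored (a loc : Fin n → Fin ℓ) (E : Fin n → Fin n → Prop) : Prop :=
  ∀ x c, c ≠ loc x → 3 * count a (cls E x) c ≤ 2 * (cls E x).card

/-- The bound on the number of element moves in the early phase. -/
def EarlyCost (a loc : Fin n → Fin ℓ) (E : Fin n → Fin n → Prop) (moves : ℕ) : Prop :=
  (moves : ℝ) + 3 * dist a loc ≤
    3 * total E (minor a) + 24 * total E (fun C => minor a C * Real.log C.card)

lemma earlyCost_zero (a : Fin n → Fin ℓ) (E : Fin n → Fin n → Prop) : EarlyCost a a E 0 := by
  have h1 : 0 ≤ total E (minor a) := Finset.sum_nonneg fun C _ => minor_nonneg a C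
  have h2 : 0 ≤ total E (fun C => minor a C * Real.log C.card) :=
    Finset.sum_nonneg fun C _ => mul_nonneg (minor_nonneg a C) (Real.log_natCast_nonneg _)
  simp only [EarlyCost, dist_self, Nat.cast_zero]
  linarith

lemma anchored_of_subset_fiber {a : Fin n → Fin ℓ} {E : Fin n → Fin n → Prop}
    (h : ∀ x y, E x y → a x = a y) : Anchored a a E := by
  intro x c hc
  have : count a (cls E x) c = 0 := by
    rw [count, Finset.card_eq_zero, Finset.filter_eq_empty_iff]
    intro y hy hyc
    exact hc (hyc.symm.trans (h x y (mem_cls.1 hy)).symm)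
  omega

variable {E : Fin n → Fin n → Prop} {a loc loc' : Fin n → Fin ℓ} {u v : Fin n}

/-- A local union, in the early phase. -/
lemma EarlyCost.join_local {m : ℕ} (hE : Equivalence E) (h : EarlyCost a loc E m) (huv : ¬ E u v) :
    EarlyCost a loc (join E u v) m := by
  have h1 := total_join hE huv (minor a)
  have h2 := total_join hE huv (fun C => minor a C * Real.log C.card)
  have h3 := minor_add_le (a u) a (disjoint_cls hE huv)
  have h4 := (minor_log_gain_min (a u) a (disjoint_cls hE huv) (card_cls_pos hE u)
    (card_cls_pos hE v)).1
  unfold EarlyCost at *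
  linarith

/-- Both parts share a server, and the two-thirds bound for a foreign colour is additive. -/
lemma Anchored.join_local (hE : Equivalence E) (h : Anchored a loc E) (huv : ¬ E u v)
    (hl : ∀ x y, E x y → loc x = loc y) (hloc : loc u = loc v) : Anchored a loc (join E u v) := by
  intro x c hc
  by_cases hx : E x u ∨ E x v
  · have hxu : loc x = loc u := by
      rcases hx with hx | hx
      · exact hl _ _ hx
      · exact (hl _ _ hx).trans hloc.symm
    rw [cls_join_left hE hx, count_union a (disjoint_cls hE huv),
      Finset.card_union_of_disjoint (disjoint_cls hE huv)]
    have h1 := h u c (hxu ▸ hc)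
    have h2 := h v c (hloc ▸ hxu ▸ hc)
    omega
  · push Not at hx
    rw [cls_join_of_not hx.1 hx.2]
    exact h x c hc

lemma moveTo_of_rel {j : Fin ℓ} {x : Fin n} (h : E u x) : moveTo E loc u j x = j := by
  simp [moveTo, h]

lemma moveTo_of_not {j : Fin ℓ} {x : Fin n} (h : ¬ E u x) : moveTo E loc u j x = loc x := by
  simp [moveTo, h]

/-- `moveTo` sends the whole merged class to `loc v`, where the class of `v` already is; only the
class of `u` really moves. -/
lemma moveTo_join_of_not_mem (hl : ∀ x y, E x y → loc x = loc y)
    {x : Fin n} (hx : x ∉ cls E u) : moveTo (join E u v) loc u (loc v) x = loc x := by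
  by_cases h : join E u v u x
  · rw [moveTo_of_rel h]
    rw [mem_cls] at hx
    rcases h with h | ⟨_, h⟩ | ⟨_, h⟩
    · exact absurd h hx
    · exact hl _ _ h
    · exact absurd h hx
  · exact moveTo_of_not h

lemma moveTo_join_of_mem {x : Fin n} {j : Fin ℓ} (hx : x ∈ cls E u) :
    moveTo (join E u v) loc u j x = j :=
  moveTo_of_rel (Or.inl (mem_cls.1 hx))

lemma dist_moveTo (hl : ∀ x y, E x y → loc x = loc y)
    (hloc : loc u ≠ loc v) : dist loc (moveTo (join E u v) loc u (loc v)) = (cls E u).card :=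
  dist_move hloc (fun x hx => (hl _ _ (mem_cls.1 hx)).symm) (fun _ hx => moveTo_join_of_mem hx)
    (fun _ hx => moveTo_join_of_not_mem hl hx)

/-- When two classes of sizes `x` and `y` on different servers are merged in the early phase, the
first one moves; `s` and `t` are the numbers of elements in the union with the colour of its old
and its new server. -/
def MoveRule (x y s t : ℕ) : Prop :=
  (x ≤ y ∧ 3 * s ≤ 2 * (x + y)) ∨ (y ≤ x ∧ 2 * (x + y) < 3 * t)

/-- A colour of neither server is bounded in each part. For the colour of the abandoned server, the
first case of `MoveRule` is the required bound; in the second, the new server's colour fills more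
than two thirds of the union and leaves less than a third. -/
lemma Anchored.moveTo (hE : Equivalence E) (h : Anchored a loc E) (huv : ¬ E u v)
    (hl : ∀ x y, E x y → loc x = loc y)
    (hr : MoveRule (cls E u).card (cls E v).card
      (count a (cls E u) (loc u) + count a (cls E v) (loc u))
      (count a (cls E u) (loc v) + count a (cls E v) (loc v))) :
    Anchored a (moveTo (join E u v) loc u (loc v)) (join E u v) := by
  intro x c hc
  by_cases hx : E x u ∨ E x v
  · have hxv : DistUF.moveTo (join E u v) loc u (loc v) x = loc v := by
      by_cases hx' : E u x
      · exact moveTo_join_of_mem (mem_cls.2 hx')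
      · rw [moveTo_join_of_not_mem hl (by simpa using hx')]
        rcases hx with hx | hx
        · exact absurd (hE.symm hx) hx'
        · exact hl _ _ hx
    rw [hxv] at hc
    rw [cls_join_left hE hx, count_union a (disjoint_cls hE huv),
      Finset.card_union_of_disjoint (disjoint_cls hE huv)]
    have h2 := h v c hc
    have h3 := count_add_count_le a (cls E u) hc
    have h4 := count_add_count_le a (cls E v) hc
    by_cases hcu : c = loc u
    · subst hcu
      unfold MoveRule at hr
      omega
    · have h1 := h u c hcu
      omega
  · push Not at hx
    rw [cls_join_of_not hx.1 hx.2]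
    rw [moveTo_join_of_not_mem hl (fun h => hx.1 (hE.symm (mem_cls.1 h)))] at hc
    exact h x c hc

/-- Moves plus three times the distance from `a` increase by at most four times the smaller class,
and the potential term increases by at least `24 / 6 = 4` times it. -/
lemma EarlyCost.moveTo {m : ℕ} (hE : Equivalence E) (h : EarlyCost a loc E m)
    (hanch : Anchored a loc E) (huv : ¬ E u v)
    (hl : ∀ x y, E x y → loc x = loc y) (hloc : loc u ≠ loc v)
    (hr : MoveRule (cls E u).card (cls E v).card
      (count a (cls E u) (loc u) + count a (cls E v) (loc u))
      (count a (cls E u) (loc v) + count a (cls E v) (loc v))) :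
    EarlyCost a (moveTo (join E u v) loc u (loc v)) (join E u v)
      (m + dist loc (moveTo (join E u v) loc u (loc v))) := by
  have h1 := total_join hE huv (minor a)
  have h2 := total_join hE huv (fun C => minor a C * Real.log C.card)
  have h3 := minor_add_le (a u) a (disjoint_cls hE huv)
  have h4 := (minor_log_gain_min (a u) a (disjoint_cls hE huv) (card_cls_pos hE u)
    (card_cls_pos hE v)).2 (loc u) (loc v) hloc (hanch u) (hanch v)
  have h5 := dist_move_add a (s := loc u) (t := loc v) (X := cls E u) (loc := loc)
    (loc' := DistUF.moveTo (join E u v) loc u (loc v)) (fun x hx => (hl _ _ (mem_cls.1 hx)).symm)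
    (fun _ hx => moveTo_join_of_mem hx) (fun _ hx => moveTo_join_of_not_mem hl hx)
  rw [dist_moveTo hl hloc]
  have h6 := count_add_count_le a (cls E u) hloc
  have h7 := count_add_count_le a (cls E v) hloc
  -- If the smaller class moves, it costs `x` moves and at most `x` of distance. If the larger class
  -- (size `x`) moves to the smaller (size `y`), more than `2 * (x + y) / 3 - y` of its elements
  -- come home, and the drop in distance leaves at most `2 * y` to pay.
  have h8 : (cls E u).card + 3 * dist a (DistUF.moveTo (join E u v) loc u (loc v)) ≤
      3 * dist a loc + 4 * min (cls E u).card (cls E v).card := by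
    have := count_le a (cls E u) (loc u)
    unfold MoveRule at hr
    omega
  have h9 : ((cls E u).card : ℝ) + 3 * dist a (DistUF.moveTo (join E u v) loc u (loc v)) ≤
      3 * dist a loc + 4 * (min (cls E u).card (cls E v).card : ℕ) := by exact_mod_cast h8
  unfold EarlyCost at *
  push_cast at h4 h9 ⊢
  linarith

/-- If the dominant colour is that of the server, the displaced elements of a class are exactly its
minor ones. Otherwise that colour fills at most two thirds, so `minor` is at least a third of the
class, of which at most everything is displaced. -/
lemma Anchored.dist_le (hE : Equivalence E) (h : Anchored a loc E)
    (hl : ∀ x y, E x y → loc x = loc y) : (dist a loc : ℝ) ≤ 3 * total E (minor a) := by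
  rw [dist_eq_sum, ← sum_classes hE, total, Finset.mul_sum]
  refine Finset.sum_le_sum fun C hC => ?_
  obtain ⟨x, -, rfl⟩ := Finset.mem_image.1 hC
  have h1 : (∑ y ∈ cls E x, if loc y ≠ a y then (1 : ℝ) else 0) =
      (cls E x).card - count a (cls E x) (loc x) := by
    rw [Finset.sum_congr rfl (g := fun y => if ¬ a y = loc x then (1 : ℝ) else 0)]
    · rw [← Finset.sum_filter, Finset.sum_const, nsmul_eq_mul, mul_one, eq_sub_iff_add_eq, count,
        add_comm]
      exact_mod_cast Finset.card_filter_add_card_filter_not (s := cls E x) (fun y => a y = loc x)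
    · intro y hy
      rw [hl x y (mem_cls.1 hy)]
      simp [eq_comm]
  rw [h1]
  obtain ⟨c, hc⟩ := exists_minor_eq (loc x) a (cls E x)
  rw [hc]
  have h2 : (count a (cls E x) (loc x) : ℝ) ≤ (cls E x).card := by
    exact_mod_cast count_le a (cls E x) (loc x)
  by_cases hcx : c = loc x
  · rw [hcx]; linarith
  · have h3 : (3 * count a (cls E x) c : ℝ) ≤ 2 * (cls E x).card := by exact_mod_cast h x c hcx
    have h4 : (0 : ℝ) ≤ count a (cls E x) (loc x) := by positivity
    linarith

/-- Every collocated assignment is at least this far from the initial one. -/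
lemma total_minor_le (hE : Equivalence E) {F : Fin n → Fin ℓ} (hF : ∀ x y, E x y → F x = F y) :
    total E (minor a) ≤ dist a F := by
  rw [dist_eq_sum, ← sum_classes hE, total]
  refine Finset.sum_le_sum fun C hC => ?_
  obtain ⟨x, -, rfl⟩ := Finset.mem_image.1 hC
  refine (minor_le a (cls E x) (F x)).trans (le_of_eq ?_)
  rw [Finset.sum_congr rfl (g := fun y => if ¬ a y = F x then (1 : ℝ) else 0)]
  · rw [← Finset.sum_filter, Finset.sum_const, nsmul_eq_mul, mul_one, sub_eq_iff_eq_add, count,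
      add_comm]
    exact_mod_cast (Finset.card_filter_add_card_filter_not (s := cls E x)
      (fun y => a y = F x)).symm
  · intro y hy
    rw [hF x y (mem_cls.1 hy)]
    simp [eq_comm]

lemma total_minor_log_le (hE : Equivalence E) :
    total E (fun C => minor a C * Real.log C.card) ≤ total E (minor a) * Real.log n := by
  rw [total, total, Finset.sum_mul]
  refine Finset.sum_le_sum fun C hC => mul_le_mul_of_nonneg_left ?_ (minor_nonneg a C)
  obtain ⟨x, -, rfl⟩ := Finset.mem_image.1 hC
  refine Real.log_le_log (by exact_mod_cast card_cls_pos hE x) ?_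
  exact_mod_cast (Finset.card_le_univ (cls E x)).trans (by simp)

/-- The cost of the early phase, relative to a collocated assignment. -/
lemma EarlyCost.le {m : ℕ} (hE : Equivalence E) (h : EarlyCost a loc E m) {F : Fin n → Fin ℓ}
    (hF : ∀ x y, E x y → F x = F y) :
    (m : ℝ) ≤ (3 + 24 * Real.log n) * dist a F := by
  have h1 := total_minor_le (a := a) hE hF
  have h2 := total_minor_log_le (a := a) hE
  have h3 : total E (minor a) * Real.log n ≤ dist a F * Real.log n :=
    mul_le_mul_of_nonneg_right h1 (Real.log_natCast_nonneg n)
  have h4 : (0 : ℝ) ≤ dist a loc := by positivity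
  unfold EarlyCost at h
  linarith

end Early

/-! ### The potential of the late phase -/

section Late

variable {n ℓ : ℕ}

/-- The bound on the number of element moves in the late phase: `s` bounds the number of moves
since the last rebalancing, which led to `P`, and `S` all moves of smaller classes. -/
def LateCost (K O δ : ℝ) (base loc : Fin n → Fin ℓ) (E : Fin n → Fin n → Prop) (moves : ℕ) : Prop :=
  ∃ (S s : ℝ) (P : Fin n → Fin ℓ), PerfectlyBalanced P ∧ dist P loc ≤ s ∧ s ≤ S ∧
    S ≤ total E (fun C => C.card * Real.logb 2 C.card) ∧ (dist base P : ℝ) ≤ O ∧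
    (moves : ℝ) ≤ K + 2 * S - s + 2 * O * ((S - s) / δ)

variable {E : Fin n → Fin n → Prop} {base loc loc' : Fin n → Fin ℓ} {u v : Fin n} {K O δ : ℝ}
  {m : ℕ}

/-- The smaller-half argument: each element of the smaller class sees the size of its class at least
double. -/
lemma total_card_log_join (hE : Equivalence E) (huv : ¬ E u v) :
    total E (fun C => C.card * Real.logb 2 C.card) + (min (cls E u).card (cls E v).card : ℕ) ≤
      total (join E u v) (fun C => C.card * Real.logb 2 C.card) := by
  have h := total_join hE huv (fun C => C.card * Real.logb 2 C.card)
  have key : ∀ a b : ℝ, 1 ≤ a → a ≤ b →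
      a + a * Real.logb 2 a + b * Real.logb 2 b ≤ (a + b) * Real.logb 2 (a + b) := by
    intro a b ha hab
    have h1 : Real.logb 2 (2 * a) ≤ Real.logb 2 (a + b) :=
      Real.logb_le_logb_of_le (by norm_num) (by linarith) (by linarith)
    rw [Real.logb_mul (by norm_num) (by linarith), Real.logb_self_eq_one (by norm_num)] at h1
    have h2 : Real.logb 2 b ≤ Real.logb 2 (a + b) :=
      Real.logb_le_logb_of_le (by norm_num) (by linarith) (by linarith)
    have e1 := mul_le_mul_of_nonneg_left h1 (by linarith : 0 ≤ a)
    have e2 := mul_le_mul_of_nonneg_left h2 (by linarith : 0 ≤ b)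
    linarith
  simp only [Finset.card_union_of_disjoint (disjoint_cls hE huv)] at h
  push_cast at h ⊢
  have hu : (1 : ℝ) ≤ (cls E u).card := by exact_mod_cast card_cls_pos hE u
  have hv : (1 : ℝ) ≤ (cls E v).card := by exact_mod_cast card_cls_pos hE v
  rcases le_total ((cls E u).card : ℝ) (cls E v).card with hl | hl
  · rw [min_eq_left hl]
    have := key _ _ hu hl
    linarith
  · rw [min_eq_right hl]
    have := key _ _ hv hl
    rw [add_comm ((cls E v).card : ℝ) (cls E u).card] at this
    linarith

lemma total_card_log_le (hE : Equivalence E) :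
    total E (fun C => C.card * Real.logb 2 C.card) ≤ n * Real.logb 2 n := by
  have h1 : ∑ C ∈ classes E, ∑ _x ∈ C, (1 : ℝ) = n := by
    rw [sum_classes hE]; simp
  rw [total]
  calc ∑ C ∈ classes E, (C.card : ℝ) * Real.logb 2 C.card
      ≤ ∑ C ∈ classes E, (∑ _x ∈ C, (1 : ℝ)) * Real.logb 2 n := by
        refine Finset.sum_le_sum fun C hC => ?_
        obtain ⟨x, -, rfl⟩ := Finset.mem_image.1 hC
        rw [Finset.sum_const, nsmul_eq_mul, mul_one]
        refine mul_le_mul_of_nonneg_left ?_ (by positivity)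
        refine Real.logb_le_logb_of_le (by norm_num) (by exact_mod_cast card_cls_pos hE x) ?_
        exact_mod_cast (Finset.card_le_univ (cls E x)).trans (by simp)
    _ = n * Real.logb 2 n := by rw [← Finset.sum_mul, h1]

lemma LateCost.join_local (hE : Equivalence E) (h : LateCost K O δ base loc E m) (huv : ¬ E u v) :
    LateCost K O δ base loc (join E u v) m := by
  obtain ⟨S, s, P, h1, h2, h3, h4, h5, h6⟩ := h
  have := total_card_log_join hE huv
  have h7 : (0 : ℝ) ≤ (min (cls E u).card (cls E v).card : ℕ) := by positivity
  exact ⟨S, s, P, h1, h2, h3, by linarith, h5, h6⟩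

/-- The smaller class moves. -/
lemma LateCost.move (hE : Equivalence E) (h : LateCost K O δ base loc E m) (huv : ¬ E u v)
    (hd : dist loc loc' = min (cls E u).card (cls E v).card) :
    LateCost K O δ base loc' (join E u v) (m + dist loc loc') := by
  obtain ⟨S, s, P, h1, h2, h3, h4, h5, h6⟩ := h
  have h7 := total_card_log_join hE huv
  rw [← hd] at h7
  -- `S - s` is unchanged, and `2 * S - s` grows by exactly the moves made.
  refine ⟨S + dist loc loc', s + dist loc loc', P, h1, ?_, by linarith, by linarith, h5, ?_⟩
  · have : (dist P loc' : ℝ) ≤ dist P loc + dist loc loc' := by exact_mod_cast dist_triangle _ _ _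
    linarith
  · rw [add_sub_add_right_eq_sub]
    push_cast
    linarith

/-- The move of the smaller class would exceed the capacity of a server. -/
lemma LateCost.rebalance (hE : Equivalence E) (h : LateCost K O δ base loc E m) (huv : ¬ E u v)
    (hd : dist loc loc' = min (cls E u).card (cls E v).card) {ε : ℝ} (hdvd : ℓ ∣ n)
    (hδ : 0 < δ) (hδε : δ = ε * (n / ℓ)) (hv : ¬ Valid ε loc') {P' : Fin n → Fin ℓ}
    (hP' : PerfectlyBalanced P') (hb : (dist base P' : ℝ) ≤ O) :
    LateCost K O δ base P' (join E u v) (m + dist loc P') := by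
  obtain ⟨S, s, P, h1, h2, h3, h4, h5, h6⟩ := h
  have h7 := total_card_log_join hE huv
  rw [← hd] at h7
  have h8 := h1.lt_dist hdvd hv
  have h9 : (dist P loc' : ℝ) ≤ dist P loc + dist loc loc' := by exact_mod_cast dist_triangle _ _ _
  have hO : 0 ≤ O := le_trans (by positivity) h5
  have hs : (0 : ℝ) ≤ s := le_trans (by positivity) h2
  have ha : (0 : ℝ) ≤ dist loc loc' := by positivity
  -- The failed move to `loc'` is charged to `S` although it is not carried out. Resetting `s` to 0
  -- releases the `s` needed to undo the moves since the last rebalancing.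
  refine ⟨S + dist loc loc', 0, P', hP', by simp [dist_self], by linarith, by linarith, hb, ?_⟩
  have h10 : (dist loc P' : ℝ) ≤ dist P loc + (dist base P + dist base P') := by
    have e1 := dist_triangle loc P P'
    have e2 := dist_triangle P base P'
    rw [dist_comm loc P] at e1
    rw [dist_comm P base] at e2
    exact_mod_cast (by omega : dist loc P' ≤ dist P loc + (dist base P + dist base P'))
  -- `P` is balanced and `loc'` overfull, so `δ < s + dist loc loc'`: the quotient rises by at least
  -- 1 and pays the `2 * O` for passing from `P` through `base` to `P'`.
  have h11 : (S - s) / δ + 1 ≤ (S + dist loc loc' - 0) / δ := by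
    rw [div_add_one hδ.ne']
    exact div_le_div_of_nonneg_right (by linarith) hδ.le
  have h12 := mul_le_mul_of_nonneg_left h11 (by linarith : 0 ≤ 2 * O)
  push_cast
  linarith

end Late

end DistUF


namespace DistUF

section Protocol

open scoped Classical

variable {n ℓ w : ℕ}

/-! ### The decisions of the protocol -/

/-- What a server tells about a class with elements that it stores. -/
structure Tally (n : ℕ) where
  /-- the number of elements of the class -/
  size : Fin (n + 1)
  /-- the number of elements of the class that were stored on this server in the beginning -/
  own : Fin (n + 1)
  /-- the number of elements of the class that were stored on the other server in the beginning -/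
  other : Fin (n + 1)
  /-- the load of the server -/
  load : Fin (n + 1)

/-- The tally of the class `C` on server `i`, which stores the elements of `S`, for server `k`. -/
def tally (col : Fin n → Fin ℓ) (S C : Finset (Fin n)) (i k : Fin ℓ) : Tally n where
  size := ⟨C.card, Nat.lt_succ_of_le (card_finset_fin_le C)⟩
  own := ⟨count col C i, Nat.lt_succ_of_le ((count_le col C i).trans (card_finset_fin_le C))⟩
  other := ⟨count col C k, Nat.lt_succ_of_le ((count_le col C k).trans (card_finset_fin_le C))⟩
  load := ⟨S.card, Nat.lt_succ_of_le (card_finset_fin_le S)⟩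

/-- The first of two classes with the given tallies is the one to be moved. -/
def FirstMoves (s t : Tally n) : Prop :=
  MoveRule s.size t.size (s.own + t.other) (s.other + t.own)

/-- The move respects the capacity of the servers. -/
def Fits (ℓ : ℕ) (ε : ℝ) (s t : Tally n) : Prop :=
  if FirstMoves s t then ((t.load : ℕ) + (s.size : ℕ) : ℝ) ≤ (1 + ε) * ((n : ℝ) / (ℓ : ℝ))
  else ((s.load : ℕ) + (t.size : ℕ) : ℝ) ≤ (1 + ε) * ((n : ℝ) / (ℓ : ℝ))

/-- `a` is perfectly balanced, collocated, and as close to `base` as possible. -/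
structure IsClosest (base : Fin n → Fin ℓ) (E : Fin n → Fin n → Prop) (a : Fin n → Fin ℓ) :
    Prop where
  balanced : PerfectlyBalanced a
  collocated : ∀ x y, E x y → a x = a y
  dist_le : ∀ a', PerfectlyBalanced a' → (∀ x y, E x y → a' x = a' y) → dist base a ≤ dist base a'

/-- A perfectly balanced collocated assignment closest to `base`. -/
noncomputable def closest (base : Fin n → Fin ℓ) (E : Fin n → Fin n → Prop) : Fin n → Fin ℓ :=
  @Classical.epsilon _ ⟨base⟩ (IsClosest base E)

/-- The new assignment in the late phase: the smaller of the classes of `u` and `v` (which have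
been merged in `E`) is moved, or else there is a rebalancing. -/
noncomputable def lateNext (ε : ℝ) (base : Fin n → Fin ℓ) (E : Fin n → Fin n → Prop)
    (loc : Fin n → Fin ℓ) (u v : Fin n) : Fin n → Fin ℓ :=
  if loc u = loc v then loc
  else
    -- `E` already contains the union; the two old classes are told apart by the servers storing
    -- them.
    let A := Finset.univ.filter (fun x => E u x ∧ loc x = loc u)
    let B := Finset.univ.filter (fun x => E u x ∧ loc x = loc v)
    let loc' := if A.card ≤ B.card then moveTo E loc u (loc v) else moveTo E loc u (loc u)
    if Valid ε loc' then loc' else closest base E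

/-- The reference assignment and the new assignment `p` at the beginning of the late phase, in
which at least half of the elements are moved. -/
def IsRestart (a : Fin n → Fin ℓ) (E : Fin n → Fin n → Prop) (loc : Fin n → Fin ℓ)
    (p : (Fin n → Fin ℓ) × (Fin n → Fin ℓ)) : Prop :=
  (∃ τ : Equiv.Perm (Fin ℓ), p.1 = τ ∘ a) ∧ IsClosest p.1 E p.2 ∧ n ≤ 2 * dist loc p.2

/-- Moving at least half of the elements is deliberate: these moves pay for the alarm, for the
reports on all elements, and in advance for later messages to the leader. -/
noncomputable def restart (a : Fin n → Fin ℓ) (E : Fin n → Fin n → Prop) (loc : Fin n → Fin ℓ) :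
    (Fin n → Fin ℓ) × (Fin n → Fin ℓ) :=
  @Classical.epsilon _ ⟨(a, a)⟩ (IsRestart a E loc)

/-- A representative of the class of `x`. -/
noncomputable def rep (E : Fin n → Fin n → Prop) (x : Fin n) : Fin n :=
  @Classical.epsilon _ ⟨x⟩ (E x)

/-! ### The protocol -/

/-- The messages. -/
inductive Msg (n ℓ : ℕ)
  /-- the tally of a class in the current operation -/
  | num (t : Tally n)
  /-- `x` belongs to the set of `r`, it was on server `c` in the beginning, and comes to you -/
  | info (x r : Fin n) (c : Fin ℓ)
  /-- `x` belongs to the set of `r`, it was on server `c` in the beginning, and I store it -/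
  | report (x r : Fin n) (c : Fin ℓ)
  /-- the late phase begins with the operation `union(u, v)` -/
  | alarm (u v : Fin n)
  /-- the operation is `union(u, v)` -/
  | op (u v : Fin n)
  /-- move `x` to server `k` -/
  | cmd (x : Fin n) (k : Fin ℓ)

/-- The knowledge of a server. -/
structure Know (n ℓ : ℕ) where
  /-- pairs of elements of the same set -/
  rel : Fin n → Fin n → Prop
  /-- the initial servers of elements -/
  col : Fin n → Fin ℓ
  /-- the late phase has begun -/
  late : Prop
  /-- the present servers of elements (for the leader in the late phase) -/
  loc : Fin n → Fin ℓ
  /-- the reference assignment (for the leader in the late phase) -/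
  base : Fin n → Fin ℓ
  /-- the last operation that has reached the server -/
  req : Option (Request n ℓ)

/-- What the server knows about the sets. -/
def Know.gen (K : Know n ℓ) : Fin n → Fin n → Prop := Relation.EqvGen K.rel

/-- The messages `M` say that `x` and `y` belong to the same set. -/
def TellsRel (M : Set (Fin ℓ × Msg n ℓ)) (x y : Fin n) : Prop :=
  ∃ i, (∃ c, (i, Msg.info x y c) ∈ M) ∨ (∃ c, (i, Msg.report x y c) ∈ M) ∨
    (i, Msg.alarm x y) ∈ M ∨ (i, Msg.op x y) ∈ M

/-- The messages `M` say that `x` was on server `c` in the beginning. -/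
def TellsCol (M : Set (Fin ℓ × Msg n ℓ)) (x : Fin n) (c : Fin ℓ) : Prop :=
  ∃ i r, (i, Msg.info x r c) ∈ M ∨ (i, Msg.report x r c) ∈ M

/-- The messages `M` say that `x` is on server `i`. -/
def TellsLoc (M : Set (Fin ℓ × Msg n ℓ)) (x : Fin n) (i : Fin ℓ) : Prop :=
  ∃ r c, (i, Msg.report x r c) ∈ M

/-- The knowledge of a server after a request `q` and messages `M` have reached it. -/
noncomputable def Know.learn (K : Know n ℓ) (q : Option (Request n ℓ))
    (M : Set (Fin ℓ × Msg n ℓ)) : Know n ℓ where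
  rel := fun x y => K.rel x y ∨ (∃ r, q = some r ∧ r.u = x ∧ r.v = y) ∨ TellsRel M x y
  col := fun x => if h : ∃ c, TellsCol M x c then h.choose else K.col x
  late := K.late ∨ ∃ i u v, (i, Msg.alarm u v) ∈ M
  loc := fun x => if h : ∃ i, TellsLoc M x i then h.choose else K.loc x
  base := K.base
  req := q.or K.req

/-- What a server does: its new knowledge, the messages it sends, and the elements it moves. -/
structure Action (n ℓ : ℕ) where
  know : Know n ℓ
  send : Finset (Fin ℓ × Msg n ℓ)
  move : Fin n → Option (Fin ℓ)

/-- The messages by which the leader announces a new assignment. -/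
noncomputable def commands (old new : Fin n → Fin ℓ) (r : Fin n → Fin n) (col : Fin n → Fin ℓ) :
    Finset (Fin ℓ × Msg n ℓ) :=
  (Finset.univ.filter (fun x => new x ≠ old x)).image (fun x => (old x, Msg.cmd x (new x))) ∪
    (Finset.univ.filter (fun x => new x ≠ old x)).image
      (fun x => (new x, Msg.info x (r x) (col x)))

/-- The elements of the current operation that are stored in `S`. -/
noncomputable def Know.part (K : Know n ℓ) (S : Finset (Fin n)) (r : Request n ℓ) :
    Finset (Fin n) :=
  S.filter (K.gen r.u)

/-- The other server of the request. -/
def Request.partner (r : Request n ℓ) (j : Fin ℓ) : Fin ℓ :=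
  if j = r.serverU then r.serverV else r.serverU

/-- The tally that server `j` sends. -/
noncomputable def Know.tally (K : Know n ℓ) (S : Finset (Fin n)) (r : Request n ℓ) (j : Fin ℓ) :
    Tally n :=
  DistUF.tally K.col S (K.part S r) j (r.partner j)

/-- The messages that server `j` sends upon a request, where `K'` is its new knowledge. -/
noncomputable def onRequest (lead j : Fin ℓ) (K K' : Know n ℓ) (S : Finset (Fin n))
    (r : Request n ℓ) : Finset (Fin ℓ × Msg n ℓ) :=
  if K.late then
    if j = r.serverU ∧ ¬ K.gen r.u r.v then {(lead, Msg.op r.u r.v)} else ∅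
  else
    if r.serverU ≠ r.serverV then {(r.partner j, Msg.num (K'.tally S r j))} else ∅

/-- What server `j` does when it has received the tally `t` in the operation `r`. -/
noncomputable def onTally (ε : ℝ) (j : Fin ℓ) (K : Know n ℓ) (S : Finset (Fin n))
    (r : Request n ℓ) (t : Tally n) : Action n ℓ :=
  let tU := if j = r.serverU then K.tally S r j else t
  let tV := if j = r.serverU then t else K.tally S r j
  if Fits ℓ ε tU tV then
    if j = r.serverU ↔ FirstMoves tU tV then
      ⟨K, (K.part S r).image (fun x => (r.partner j, Msg.info x r.u (K.col x))),
        fun x => if x ∈ K.part S r then some (r.partner j) else none⟩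
    else ⟨K, ∅, fun _ => none⟩
  else if j = r.serverU then
    ⟨K, Finset.univ.image (fun k => (k, Msg.alarm r.u r.v)), fun _ => none⟩
  else ⟨K, ∅, fun _ => none⟩

/-- What the leader does upon an operation in the late phase. -/
noncomputable def onOp (ε : ℝ) (K : Know n ℓ) (u v : Fin n) : Action n ℓ :=
  ⟨{ K with loc := lateNext ε K.base K.gen K.loc u v },
    commands K.loc (lateNext ε K.base K.gen K.loc u v) (rep K.gen) K.col, fun _ => none⟩

/-- What the leader does when it has received all reports. -/
noncomputable def onReports (K : Know n ℓ) : Action n ℓ :=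
  ⟨{ K with loc := (restart K.col K.gen K.loc).2, base := (restart K.col K.gen K.loc).1 },
    commands K.loc (restart K.col K.gen K.loc).2 (rep K.gen) K.col, fun _ => none⟩

/-- The action of server `j`, with knowledge `K` and stored elements `S`, upon the request `q` and
the messages `M`. -/
noncomputable def act (ε : ℝ) (lead j : Fin ℓ) (K : Know n ℓ) (S : Finset (Fin n))
    (q : Option (Request n ℓ)) (M : Set (Fin ℓ × Msg n ℓ)) : Action n ℓ :=
  match q with
  | some r => ⟨K.learn q M, onRequest lead j K (K.learn q M) S r, fun _ => none⟩
  | none =>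
    if h : ∃ p : Tally n × Request n ℓ, K.req = some p.2 ∧ ∃ i, (i, Msg.num p.1) ∈ M then
      onTally ε j (K.learn q M) S h.choose.2 h.choose.1
    else if ∃ i u v, (i, Msg.alarm u v) ∈ M then
      ⟨K.learn q M, S.image (fun x =>
        (lead, Msg.report x (rep (K.learn q M).gen x) ((K.learn q M).col x))), fun _ => none⟩
    else if h : ∃ p : Fin n × Fin n, ∃ i, (i, Msg.op p.1 p.2) ∈ M then
      onOp ε (K.learn q M) h.choose.1 h.choose.2
    else if ∃ i x r c, (i, Msg.report x r c) ∈ M then onReports (K.learn q M)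
    else ⟨K.learn q M, ∅, fun x =>
      if h : ∃ k, ∃ i, (i, Msg.cmd x k) ∈ M then some h.choose else none⟩

lemma Know.learn_none_empty (K : Know n ℓ) : K.learn none ∅ = K := by
  cases K
  simp [Know.learn, TellsRel, TellsCol, TellsLoc]

/-- The model freezes a server whose inbox is empty. As the protocol does nothing then anyway, `Net`
may let all servers act in every round. -/
lemma act_idle (ε : ℝ) (lead j : Fin ℓ) (K : Know n ℓ) (S : Finset (Fin n)) :
    act ε lead j K S none ∅ = ⟨K, ∅, fun _ => none⟩ := by
  simp [act, Know.learn_none_empty]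

/-- The distributed algorithm, for an encoding of the messages. -/
noncomputable def protocol (ε : ℝ) (lead : Fin ℓ) (enc : Msg n ℓ → BitVec w)
    (dec : BitVec w → Msg n ℓ) : Algorithm n ℓ w where
  State := Know n ℓ × Finset (Fin n)
  start := fun j S => (⟨fun _ _ => False, fun _ => j, False, fun _ => j, fun _ => j, none⟩, S)
  react := fun j _ s I =>
    let S := s.2 ∪ I.arrived
    let o := act ε lead j s.1 S I.request {p | ∃ q ∈ I.messages, p = (q.1, dec q.2)}
    ⟨(o.know, S.filter (fun x => ∀ k, o.move x = some k → k = j)),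
      o.send.toList.map (fun p => (p.1, enc p.2)), o.move⟩
  find := fun s x => Finset.univ.filter (s.1.gen x)
  -- The longest exchange takes five rounds, reacting to the request, the tallies, the alarm, the
  -- reports and the commands; in the sixth the servers take in the elements that have just arrived.
  rounds := 6

/-! ### The network, without the encoding of messages -/

/-- A configuration of the network. -/
structure Net (n ℓ : ℕ) where
  know : Fin ℓ → Know n ℓ
  loc : Fin n → Fin ℓ
  req : Fin ℓ → Option (Request n ℓ)
  msgs : Fin ℓ → Set (Fin ℓ × Msg n ℓ)
  moves : ℕ
  comm : ℕ

/-- The elements stored on server `j`. -/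
def Net.stored (g : Net n ℓ) (j : Fin ℓ) : Finset (Fin n) :=
  Finset.univ.filter (fun x => g.loc x = j)

@[simp] lemma Net.mem_stored {g : Net n ℓ} {j : Fin ℓ} {x : Fin n} :
    x ∈ g.stored j ↔ g.loc x = j := by
  simp [Net.stored]

noncomputable def Net.out (ε : ℝ) (lead : Fin ℓ) (g : Net n ℓ) (j : Fin ℓ) : Action n ℓ :=
  act ε lead j (g.know j) (g.stored j) (g.req j) (g.msgs j)

noncomputable def Net.next (ε : ℝ) (lead : Fin ℓ) (g : Net n ℓ) : Net n ℓ where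
  know := fun j => (g.out ε lead j).know
  loc := fun x => ((g.out ε lead (g.loc x)).move x).getD (g.loc x)
  req := fun _ => none
  msgs := fun j => {p | (j, p.2) ∈ (g.out ε lead p.1).send}
  moves := g.moves + dist g.loc (fun x => ((g.out ε lead (g.loc x)).move x).getD (g.loc x))
  comm := g.comm + ∑ j, (g.out ε lead j).send.card

noncomputable def Net.deliver (g : Net n ℓ) (q : Fin n × Fin n) : Net n ℓ where
  know := g.know
  loc := g.loc
  req := fun j =>
    if j = g.loc q.1 ∨ j = g.loc q.2 then some ⟨q.1, q.2, g.loc q.1, g.loc q.2⟩ else none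
  msgs := g.msgs
  moves := g.moves
  comm := g.comm + if g.loc q.1 = g.loc q.2 then 0 else 1

/-- Nothing is under way. -/
def Net.Quiet (g : Net n ℓ) : Prop := (∀ j, g.req j = none) ∧ ∀ j, g.msgs j = ∅

/-- `g` represents the configuration `c`. -/
structure Represents {ε : ℝ} {lead : Fin ℓ} {enc : Msg n ℓ → BitVec w} {dec : BitVec w → Msg n ℓ}
    (c : Config (protocol ε lead enc dec).State n ℓ w) (g : Net n ℓ) : Prop where
  know : ∀ j, (c.state j).1 = g.know j
  stored : ∀ j, (c.state j).2 ∪ (c.inbox j).arrived = g.stored j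
  loc : c.loc = g.loc
  req : ∀ j, (c.inbox j).request = g.req j
  msgs : ∀ j, {p | ∃ q ∈ (c.inbox j).messages, p = (q.1, dec q.2)} = g.msgs j
  moves : c.moves = g.moves
  comm : c.comm = g.comm

variable {ε : ℝ} {lead : Fin ℓ} {enc : Msg n ℓ → BitVec w} {dec : BitVec w → Msg n ℓ}
  {c : Config (protocol ε lead enc dec).State n ℓ w} {g : Net n ℓ}

lemma Represents.reaction (h : Represents c g) (j : Fin ℓ) :
    (protocol ε lead enc dec).reaction c j =
      ⟨((g.out ε lead j).know,
        (g.stored j).filter (fun x => ∀ k, (g.out ε lead j).move x = some k → k = j)),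
      (g.out ε lead j).send.toList.map (fun p => (p.1, enc p.2)), (g.out ε lead j).move⟩ := by
  by_cases hI : (c.inbox j).IsEmpty
  · obtain ⟨h1, h2, h3⟩ := hI
    have hM : g.msgs j = ∅ := by rw [← h.msgs j, h2]; simp
    have hS : (c.state j).2 = g.stored j := by rw [← h.stored j, h3, Finset.union_empty]
    have hout : g.out ε lead j = ⟨g.know j, ∅, fun _ => none⟩ := by
      rw [Net.out, hM, ← h.req j, h1, act_idle]
    rw [Algorithm.reaction, if_pos ⟨h1, h2, h3⟩, hout]
    simp only [← h.know j, ← hS]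
    simp
    rfl
  · rw [Algorithm.reaction, if_neg hI]
    simp only [Net.out, ← h.know, ← h.stored, ← h.req, ← h.msgs]
    rfl

lemma Represents.newLoc (h : Represents c g) (x : Fin n) :
    (protocol ε lead enc dec).newLoc c x = (g.next ε lead).loc x := by
  rw [Algorithm.newLoc, h.reaction, h.loc]
  rfl

lemma Represents.round (h : Represents c g) (hdec : ∀ m, dec (enc m) = m) :
    Represents ((protocol ε lead enc dec).round c) (g.next ε lead) where
  know j := by simp only [Algorithm.round, h.reaction]; rfl
  stored j := by
    simp only [Algorithm.round, h.reaction, h.newLoc]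
    ext x
    simp only [Finset.mem_union, Finset.mem_filter, Finset.mem_univ, true_and, Net.mem_stored,
      Net.next, h.loc]
    by_cases hx : g.loc x = j
    · subst hx
      simp only [true_and, ne_eq, not_true_eq_false, false_and, or_false]
      cases (g.out ε lead (g.loc x)).move x <;> simp
    · simp [hx]
  loc := by funext x; exact h.newLoc x
  req j := rfl
  msgs j := by
    ext ⟨i, m⟩
    simp only [Algorithm.round, h.reaction, Net.next, Set.mem_ofPred_eq, List.mem_flatMap,
      List.mem_finRange, true_and, List.mem_map, List.mem_filter, Finset.mem_toList,
      decide_eq_true_eq]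
    constructor
    · rintro ⟨q, ⟨i', m', ⟨⟨p, hp, rfl⟩, hj⟩, rfl⟩, hq⟩
      simp only [hdec, Prod.mk.injEq] at hq hj
      obtain ⟨rfl, rfl⟩ := hq
      rw [← hj]
      exact hp
    · intro hm
      exact ⟨(i, enc m), ⟨i, (j, enc m), ⟨⟨(j, m), hm, rfl⟩, rfl⟩, rfl⟩, by simp [hdec]⟩
  moves := by
    simp only [Algorithm.round, Net.next, h.moves]
    rw [funext h.newLoc, h.loc]
    rfl
  comm := by
    simp only [Algorithm.round, Net.next, h.comm, h.reaction, List.length_map,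
      Finset.length_toList]

lemma Represents.deliver (h : Represents c g) (q : Fin n × Fin n) :
    Represents ((protocol ε lead enc dec).deliver c q) (g.deliver q) where
  know := h.know
  stored j := by
    simp only [Algorithm.deliver]
    rw [h.stored]; rfl
  loc := h.loc
  req j := by simp only [Algorithm.deliver, Net.deliver, h.loc]
  msgs := h.msgs
  moves := h.moves
  comm := by simp only [Algorithm.deliver, Net.deliver, h.loc, h.comm]

lemma Net.Quiet.out (h : g.Quiet) (j : Fin ℓ) :
    g.out ε lead j = ⟨g.know j, ∅, fun _ => none⟩ := by
  rw [Net.out, h.1, h.2, act_idle]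

lemma Net.Quiet.next (h : g.Quiet) : g.next ε lead = g := by
  have h1 := h.1
  have h2 := h.2
  cases g
  simp only [Net.next, h.out, Option.getD_none, Finset.card_empty, Finset.sum_const_zero, add_zero,
    Finset.notMem_empty, Set.ofPred_false, dist_self, Net.mk.injEq, true_and]
  exact ⟨funext fun j => (h1 j).symm, funext fun j => (h2 j).symm, trivial⟩

/-- `Represents` counts arrived elements as stored, so a configuration with a quiet network may
still have arrivals in its inboxes. One more round clears them. -/
lemma Represents.quiet (h : Represents c g) (hg : g.Quiet) (j : Fin ℓ) :
    (((protocol ε lead enc dec).round c).inbox j).IsEmpty := by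
  refine ⟨rfl, ?_, ?_⟩
  · simp [Algorithm.round, h.reaction, hg.out]
  · simp only [Algorithm.round, h.newLoc, hg.next, h.loc, Finset.filter_eq_empty_iff]
    simp

/-- In the next `k` rounds all assignments are valid, and in the end the network is quiet and
satisfies `Q`. -/
def Net.Leads (ε : ℝ) (lead : Fin ℓ) (Q : Net n ℓ → Prop) : ℕ → Net n ℓ → Prop
  | 0, g => Valid ε g.loc ∧ g.Quiet ∧ Q g
  | k + 1, g => Valid ε g.loc ∧ Net.Leads ε lead Q k (g.next ε lead)

lemma Net.Leads.of_quiet {Q : Net n ℓ → Prop} (hv : Valid ε g.loc) (hg : g.Quiet) (hQ : Q g)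
    (k : ℕ) : Net.Leads ε lead Q k g := by
  induction k with
  | zero => exact ⟨hv, hg, hQ⟩
  | succ k ih => exact ⟨hv, by rwa [hg.next]⟩

lemma Net.Leads.spec {Q : Net n ℓ → Prop} (hdec : ∀ m, dec (enc m) = m) {k : ℕ}
    (hc : Represents c g) (h : Net.Leads ε lead Q k g) :
    (∀ r ≤ k, Valid ε ((protocol ε lead enc dec).round^[r] c).loc) ∧
      ∃ g', Represents ((protocol ε lead enc dec).round^[k] c) g' ∧ g'.Quiet ∧ Q g' ∧
        Valid ε g'.loc := by
  induction k generalizing c g with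
  | zero =>
    refine ⟨fun r hr => ?_, g, hc, h.2.1, h.2.2, h.1⟩
    obtain rfl := Nat.le_zero.1 hr
    simpa [hc.loc] using h.1
  | succ k ih =>
    obtain ⟨h1, h2⟩ := ih (hc.round hdec) h.2
    refine ⟨fun r hr => ?_, ?_⟩
    · cases r with
      | zero => simpa [hc.loc] using h.1
      | succ r => simpa using h1 r (by omega)
    · simpa using h2

end Protocol

end DistUF


namespace DistUF

/-! ### Closest balanced assignments, renaming of servers, feasibility of moves, and one step of the
late phase -/

section Choices

open scoped Classical

variable {n ℓ : ℕ} {E : Fin n → Fin n → Prop} {loc base a : Fin n → Fin ℓ} {u v : Fin n} {ε : ℝ}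

lemma exists_isClosest {F : Fin n → Fin ℓ} (hF : PerfectlyBalanced F)
    (hF' : ∀ x y, E x y → F x = F y) (base : Fin n → Fin ℓ) : ∃ p, IsClosest base E p := by
  obtain ⟨p, hp, hmin⟩ := Set.exists_min_image
    {p : Fin n → Fin ℓ | PerfectlyBalanced p ∧ ∀ x y, E x y → p x = p y} (fun p => dist base p)
    (Set.toFinite _) ⟨F, hF, hF'⟩
  exact ⟨p, hp.1, hp.2, fun a' h1 h2 => hmin a' ⟨h1, h2⟩⟩

lemma closest_spec {F : Fin n → Fin ℓ} (hF : PerfectlyBalanced F)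
    (hF' : ∀ x y, E x y → F x = F y) (base : Fin n → Fin ℓ) :
    IsClosest base E (closest base E) :=
  Classical.epsilon_spec (exists_isClosest hF hF' base)

lemma IsClosest.perm {p : Fin n → Fin ℓ} (h : IsClosest base E p) (τ : Equiv.Perm (Fin ℓ)) :
    IsClosest (τ ∘ base) E (τ ∘ p) where
  balanced := h.balanced.perm τ
  collocated x y hxy := congrArg τ (h.collocated x y hxy)
  dist_le a' h1 h2 := by
    have h3 := h.dist_le (τ.symm ∘ a') (h1.perm _) (fun x y hxy => congrArg τ.symm (h2 x y hxy))
    have h4 : dist base (τ.symm ∘ a') = dist (τ ∘ base) a' := by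
      rw [← dist_perm τ base, ← Function.comp_assoc, Equiv.self_comp_symm, Function.id_comp]
    rw [dist_perm]
    exact h3.trans_eq h4

/-- Since `τ` has no fixed point, no element is at home in both `p` and `τ ∘ p`. -/
lemma le_dist_add_dist {τ : Equiv.Perm (Fin ℓ)} (hτ : ∀ j, τ j ≠ j) (loc p : Fin n → Fin ℓ) :
    n ≤ dist loc p + dist loc (τ ∘ p) := by
  unfold dist
  calc n = (Finset.univ : Finset (Fin n)).card := by simp
    _ ≤ _ := (Finset.card_le_card fun x _ => ?_).trans (Finset.card_union_le _ _)
  simp only [Finset.mem_union, Finset.mem_filter, Finset.mem_univ, true_and, Function.comp_apply]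
  by_contra! h
  exact hτ (p x) (h.2.trans h.1.symm)

lemma exists_perm_ne {i j : Fin ℓ} (h : i ≠ j) : ∃ τ : Equiv.Perm (Fin ℓ), ∀ k, τ k ≠ k := by
  obtain ⟨m, rfl⟩ : ∃ m, ℓ = m + 2 := by
    rcases ℓ with _ | _ | m
    · exact i.elim0
    · exact absurd (Fin.ext (by omega)) h
    · exact ⟨m, rfl⟩
  refine ⟨finRotate (m + 2), fun k hk => ?_⟩
  have := support_finRotate (n := m)
  have hk' : k ∈ (finRotate (m + 2)).support := by rw [this]; exact Finset.mem_univ _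
  exact (Equiv.Perm.mem_support.1 hk') hk

/-- Either a closest assignment `p` for `a` already moves half of the elements, or `τ ∘ p` does,
which is closest to `τ ∘ a` by symmetry. Two distinct servers are needed for a fixed-point-free `τ`.
-/
lemma restart_spec {F : Fin n → Fin ℓ} (hF : PerfectlyBalanced F)
    (hF' : ∀ x y, E x y → F x = F y) {i j : Fin ℓ} (hij : i ≠ j) (a loc : Fin n → Fin ℓ) :
    IsRestart a E loc (restart a E loc) := by
  refine Classical.epsilon_spec (p := IsRestart a E loc) ?_
  obtain ⟨p, hp⟩ := exists_isClosest hF hF' a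
  obtain ⟨τ, hτ⟩ := exists_perm_ne hij
  have := le_dist_add_dist hτ loc p
  by_cases h : n ≤ 2 * dist loc p
  · exact ⟨(a, p), ⟨1, rfl⟩, hp, h⟩
  · exact ⟨(τ ∘ a, τ ∘ p), ⟨τ, rfl⟩, hp.perm τ, by simp only; omega⟩

/-- The competitor is `τ ∘ F`, at the same distance from `τ ∘ a` as `F` from `a`: renaming the
reference costs nothing. -/
lemma IsClosest.dist_le_of_perm {p F : Fin n → Fin ℓ} {τ : Equiv.Perm (Fin ℓ)}
    (h : IsClosest (τ ∘ a) E p) (hF : PerfectlyBalanced F) (hF' : ∀ x y, E x y → F x = F y) :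
    dist (τ ∘ a) p ≤ dist a F := by
  rw [← dist_perm τ a F]
  exact h.dist_le _ (hF.perm τ) (fun x y hxy => congrArg τ (hF' x y hxy))

lemma moveTo_collocated (hE : Equivalence E) (hl : ∀ x y, E x y → loc x = loc y) (j : Fin ℓ) :
    ∀ x y, join E u v x y → moveTo (join E u v) loc u j x = moveTo (join E u v) loc u j y := by
  intro x y hxy
  have hJ := join_equivalence hE u v
  by_cases h : join E u v u x
  · rw [moveTo_of_rel h, moveTo_of_rel (hJ.trans h hxy)]
  · rw [moveTo_of_not h, moveTo_of_not (fun h' => h (hJ.trans h' (hJ.symm hxy)))]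
    rcases hxy with hxy | ⟨hxy, -⟩ | ⟨hxy, -⟩
    · exact hl x y hxy
    · exact absurd (Or.inl (hE.symm hxy)) h
    · exact absurd (Or.inr (Or.inl ⟨hE.refl u, hE.symm hxy⟩)) h

lemma moveTo_swap (hE : Equivalence E) (j : Fin ℓ) :
    moveTo (join E u v) loc u j = moveTo (join E v u) loc v j := by
  have hJ := join_equivalence hE u v
  have huv : join E u v u v := Or.inr (Or.inl ⟨hE.refl u, hE.refl v⟩)
  rw [join_comm E v u]
  funext x
  have : join E u v u x ↔ join E u v v x := ⟨hJ.trans (hJ.symm huv), hJ.trans huv⟩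
  simp [moveTo, this]

/-- Only the receiving server gains load, so the tallies of the two servers suffice to decide
feasibility. -/
lemma valid_moveTo_iff (hl : ∀ x y, E x y → loc x = loc y) (hloc : loc u ≠ loc v)
    (hv : Valid ε loc) :
    Valid ε (moveTo (join E u v) loc u (loc v)) ↔
      ((load loc (loc v) : ℕ) + ((cls E u).card : ℕ) : ℝ) ≤ (1 + ε) * ((n : ℝ) / (ℓ : ℝ)) := by
  have h1 : load (moveTo (join E u v) loc u (loc v)) (loc v) =
      load loc (loc v) + (cls E u).card := by
    unfold load
    rw [← Finset.card_union_of_disjoint]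
    · congr 1
      ext x
      simp only [Finset.mem_union, Finset.mem_filter, Finset.mem_univ, true_and]
      by_cases hx : x ∈ cls E u
      · simp [moveTo_join_of_mem hx, mem_cls.1 hx]
      · rw [moveTo_join_of_not_mem hl hx]
        simp [hx]
    · rw [Finset.disjoint_left]
      intro x hx hx'
      simp only [Finset.mem_filter, Finset.mem_univ, true_and] at hx
      exact hloc ((hl _ _ (mem_cls.1 hx')).trans hx)
  constructor
  · intro h
    have := h (loc v)
    rw [h1] at this
    exact_mod_cast this
  · intro h j
    by_cases hj : j = loc v
    · rw [hj, h1]; exact_mod_cast h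
    · refine le_trans ?_ (hv j)
      have : load (moveTo (join E u v) loc u (loc v)) j ≤ load loc j := by
        refine Finset.card_le_card fun x => ?_
        simp only [Finset.mem_filter, Finset.mem_univ, true_and]
        by_cases hx : x ∈ cls E u
        · rw [moveTo_join_of_mem hx]
          exact fun h => absurd h.symm hj
        · rw [moveTo_join_of_not_mem hl hx]
          exact id
      exact_mod_cast this

/-- A server that knows only the merged class can still recover the old class it stores. -/
lemma filter_join_left (hl : ∀ x y, E x y → loc x = loc y)
    (hloc : loc u ≠ loc v) {x : Fin n} (hx : join E u v u x) : loc x = loc u ↔ E u x := by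
  constructor
  · intro h
    rcases hx with hx | ⟨-, hx⟩ | ⟨-, hx⟩
    · exact hx
    · exact absurd (h.symm.trans (hl _ _ hx).symm) hloc
    · exact hx
  · exact fun h => (hl _ _ h).symm

lemma filter_join_right (hE : Equivalence E) (hl : ∀ x y, E x y → loc x = loc y)
    (hloc : loc u ≠ loc v) {x : Fin n} (hx : join E u v u x) : loc x = loc v ↔ E v x := by
  have huv : join E v u v u := Or.inr (Or.inl ⟨hE.refl v, hE.refl u⟩)
  rw [join_comm] at hx
  exact filter_join_left hl hloc.symm ((join_equivalence hE v u).trans huv hx)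

/-- The properties of a step of the late phase. -/
structure LateStep (ε : ℝ) (base loc : Fin n → Fin ℓ) (E E' : Fin n → Fin n → Prop)
    (new : Fin n → Fin ℓ) : Prop where
  valid : Valid ε new
  collocated : ∀ x y, E' x y → new x = new y
  cost : ∀ (K O δ : ℝ) (m : ℕ), 0 < δ → δ = ε * (n / ℓ) → LateCost K O δ base loc E m →
    (∀ p, IsClosest base E' p → (dist base p : ℝ) ≤ O) →
    LateCost K O δ base new E' (m + dist loc new)

lemma lateStep_lateNext (hE : Equivalence E) (hl : ∀ x y, E x y → loc x = loc y)
    (huv : ¬ E u v) (hv : Valid ε loc) (hd : ℓ ∣ n) (hε : 0 < ε) {F : Fin n → Fin ℓ}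
    (hF : PerfectlyBalanced F) (hF' : ∀ x y, join E u v x y → F x = F y) :
    LateStep ε base loc E (join E u v) (lateNext ε base (join E u v) loc u v) := by
  by_cases hloc : loc u = loc v
  · rw [lateNext, if_pos hloc]
    refine ⟨hv, ?_, ?_⟩
    · rintro x y (h | ⟨h, h'⟩ | ⟨h, h'⟩)
      · exact hl _ _ h
      · exact (hl _ _ h).trans (hloc.trans (hl _ _ h'))
      · exact (hl _ _ h).trans (hloc.symm.trans (hl _ _ h'))
    · intro K O δ m _ _ h _
      simpa [dist_self] using h.join_local hE huv
  have hA : Finset.univ.filter (fun x => join E u v u x ∧ loc x = loc u) = cls E u := by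
    ext x
    simp only [Finset.mem_filter, Finset.mem_univ, true_and, mem_cls]
    exact ⟨fun h => (filter_join_left hl hloc h.1).1 h.2,
      fun h => ⟨Or.inl h, (hl _ _ h).symm⟩⟩
  have hB : Finset.univ.filter (fun x => join E u v u x ∧ loc x = loc v) = cls E v := by
    ext x
    simp only [Finset.mem_filter, Finset.mem_univ, true_and, mem_cls]
    exact ⟨fun h => (filter_join_right hE hl hloc h.1).1 h.2,
      fun h => ⟨Or.inr (Or.inl ⟨hE.refl u, h⟩), (hl _ _ h).symm⟩⟩
  rw [lateNext, if_neg hloc, hA, hB]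
  simp only
  set loc' := if (cls E u).card ≤ (cls E v).card then moveTo (join E u v) loc u (loc v)
    else moveTo (join E u v) loc u (loc u) with hloc'
  have hdist : dist loc loc' = min (cls E u).card (cls E v).card := by
    rw [hloc']
    split_ifs with h
    · rw [dist_moveTo hl hloc, min_eq_left h]
    · rw [moveTo_swap hE, dist_moveTo hl (Ne.symm hloc), min_eq_right (by omega)]
  by_cases hv' : Valid ε loc'
  · rw [if_pos hv']
    refine ⟨hv', ?_, fun K O δ m _ _ h _ => h.move hE huv hdist⟩
    rw [hloc']
    split_ifs with h <;> exact moveTo_collocated hE hl _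
  · rw [if_neg hv']
    have hc := closest_spec hF hF' base
    exact ⟨hc.balanced.valid hε hd, hc.collocated, fun K O δ m hδ hδε h hO =>
      h.rebalance hE huv hdist hd hδ hδε hv' hc.balanced (hO _ hc)⟩

/-! ### Transfer of knowledge -/

/-- After elements have been moved, the servers still know the sets of their elements. -/
lemma complete_of_transfer {loc' : Fin n → Fin ℓ} {R : Fin ℓ → Fin n → Fin n → Prop}
    (hR : ∀ j, Equivalence (R j)) (hl : ∀ x y, E x y → loc x = loc y)
    (hl' : ∀ x y, join E u v x y → loc' x = loc' y)
    (hold : ∀ x y, E x y → R (loc x) x y) (hu : R (loc u) u v) (hv : R (loc v) u v)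
    (hE : Equivalence E) {r : Fin n → Fin n} (hr : ∀ x y, join E u v x y → r x = r y)
    (hmoved : ∀ x, loc' x ≠ loc x → R (loc' x) x (r x)) :
    ∀ x y, join E u v x y → R (loc' x) x y := by
  -- Two moved elements of one set are linked through the common representative sent along with
  -- them.
  have mm : ∀ x y, join E u v x y → loc' x ≠ loc x → loc' y ≠ loc y → R (loc' x) x y := by
    intro x y hxy hx hy
    have h1 := hmoved x hx
    have h2 := hmoved y hy
    rw [hr x y hxy] at h1
    rw [← hl' x y hxy] at h2
    exact (hR _).trans h1 ((hR _).symm h2)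
  -- `w` is one of `u` and `v`, and `z` is the other one
  have wz : ∀ w z, join E u v w z → R (loc z) w z → ∀ x y, E x w → E z y → loc' y = loc y →
      R (loc' x) x y := by
    intro w z hwz hz x y hxw hzy hy
    have hxy' : join E u v x w := Or.inl hxw
    have hzy' : join E u v z y := Or.inl hzy
    have hJ := join_equivalence hE u v
    have hx'y : loc' x = loc z := by
      rw [hl' x y (hJ.trans hxy' (hJ.trans hwz hzy')), hy, hl z y hzy]
    have hzy2 : R (loc' x) z y := by rw [hx'y]; exact hold z y hzy
    have hwz2 : R (loc' x) w z := by rw [hx'y]; exact hz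
    -- Elements of one old class move together or stay together: if `x` stays, old knowledge
    -- suffices; if it moves, so does `w`.
    have hxw2 : R (loc' x) x w := by
      by_cases hx : loc' x = loc x
      · rw [hx]; exact hold x w hxw
      · refine mm x w hxy' hx ?_
        rw [← hl' x w hxy', ← hl x w hxw]
        exact hx
    exact (hR _).trans hxw2 ((hR _).trans hwz2 hzy2)
  have hJ := join_equivalence hE u v
  have huv : join E u v u v := Or.inr (Or.inl ⟨hE.refl u, hE.refl v⟩)
  have key : ∀ x y, join E u v x y → loc' y = loc y → R (loc' x) x y := by
    intro x y hxy hy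
    rcases hxy with h | ⟨h, h'⟩ | ⟨h, h'⟩
    · have e : loc' x = loc x := by rw [hl' x y (Or.inl h), hy, hl x y h]
      rw [e]
      exact hold x y h
    · exact wz u v huv hv x y h h' hy
    · exact wz v u (hJ.symm huv) ((hR _).symm hu) x y h h' hy
  intro x y hxy
  by_cases hy : loc' y = loc y
  · exact key x y hxy hy
  · by_cases hx : loc' x = loc x
    · have := key y x (hJ.symm hxy) hx
      rw [← hl' x y hxy] at this
      exact (hR _).symm this
    · exact mm x y hxy hx hy

end Choices

end DistUF


namespace DistUF

section Rounds

open scoped Classical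

variable {n ℓ : ℕ} {ε : ℝ} {lead : Fin ℓ}

/-! ### Knowledge -/

lemma Know.gen_equivalence (K : Know n ℓ) : Equivalence K.gen := Relation.EqvGen.is_equivalence _

lemma Know.gen_of_rel {K : Know n ℓ} {x y : Fin n} (h : K.rel x y) : K.gen x y :=
  Relation.EqvGen.rel _ _ h

lemma Know.gen_sound {K : Know n ℓ} {E : Fin n → Fin n → Prop} (hE : Equivalence E)
    (h : ∀ x y, K.rel x y → E x y) {x y : Fin n} (hxy : K.gen x y) : E x y :=
  hE.eqvGen_iff.1 (Relation.EqvGen.mono h _ _ hxy)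

lemma Know.gen_learn {K : Know n ℓ} {x y : Fin n} (h : K.gen x y) (q : Option (Request n ℓ))
    (M : Set (Fin ℓ × Msg n ℓ)) : (K.learn q M).gen x y :=
  Relation.EqvGen.mono (fun _ _ h => Or.inl h) _ _ h

lemma Know.learn_col {K : Know n ℓ} {M : Set (Fin ℓ × Msg n ℓ)} {q : Option (Request n ℓ)}
    {x : Fin n} {c : Fin ℓ} (h : ∀ c', TellsCol M x c' → c' = c)
    (h' : K.col x = c ∨ ∃ c', TellsCol M x c') : (K.learn q M).col x = c := by
  by_cases hx : ∃ c', TellsCol M x c'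
  · simp only [Know.learn, dif_pos hx]
    exact h _ hx.choose_spec
  · simp only [Know.learn, dif_neg hx]
    exact h'.resolve_right hx

lemma Know.learn_loc {K : Know n ℓ} {M : Set (Fin ℓ × Msg n ℓ)} {q : Option (Request n ℓ)}
    {x : Fin n} {j : Fin ℓ} (h : ∀ i, TellsLoc M x i → i = j)
    (h' : K.loc x = j ∨ ∃ i, TellsLoc M x i) : (K.learn q M).loc x = j := by
  by_cases hx : ∃ i, TellsLoc M x i
  · simp only [Know.learn, dif_pos hx]
    exact h _ hx.choose_spec
  · simp only [Know.learn, dif_neg hx]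
    exact h'.resolve_right hx

/-- What the servers know during the operation `union(u, v)`, where `loc` is the assignment before
the operation. -/
structure Net.Mid (E : Fin n → Fin n → Prop) (loc : Fin n → Fin ℓ) (u v : Fin n) (g : Net n ℓ) :
    Prop where
  req : ∀ j, g.req j = none
  sound : ∀ j x y, (g.know j).rel x y → join E u v x y
  complete : ∀ x y, E x y → (g.know (loc x)).gen x y
  union : ∀ j, j = loc u ∨ j = loc v → (g.know j).gen u v

/-- What the servers know between two operations. -/
structure Net.Knows (E : Fin n → Fin n → Prop) (g : Net n ℓ) : Prop where
  sound : ∀ j x y, (g.know j).rel x y → E x y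
  complete : ∀ x y, E x y → (g.know (g.loc x)).gen x y
  collocated : ∀ x y, E x y → g.loc x = g.loc y

variable {g : Net n ℓ} {E : Fin n → Fin n → Prop} {u v : Fin n} {loc new : Fin n → Fin ℓ}

/-! ### The first round of an operation -/

/-- The request for `union(u, v)`. -/
def Net.request (g : Net n ℓ) (u v : Fin n) : Request n ℓ := ⟨u, v, g.loc u, g.loc v⟩

lemma Net.deliver_out (hg : g.Quiet) (u v : Fin n) (j : Fin ℓ) :
    (g.deliver (u, v)).out ε lead j = ⟨(g.know j).learn ((g.deliver (u, v)).req j) ∅,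
      if j = g.loc u ∨ j = g.loc v then
        onRequest lead j (g.know j) ((g.know j).learn (some (g.request u v)) ∅) (g.stored j)
          (g.request u v)
      else ∅, fun _ => none⟩ := by
  have hM : (g.deliver (u, v)).msgs j = ∅ := hg.2 j
  by_cases h : j = g.loc u ∨ j = g.loc v
  · have hr : (g.deliver (u, v)).req j = some (g.request u v) := if_pos h
    rw [Net.out, hM, hr, if_pos h]
    rfl
  · have hr : (g.deliver (u, v)).req j = none := if_neg h
    rw [Net.out, hM, hr, if_neg h, act_idle, Know.learn_none_empty]
    rfl

/-- The network after the first round of an operation. -/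
noncomputable def Net.first (ε : ℝ) (lead : Fin ℓ) (g : Net n ℓ) (u v : Fin n) : Net n ℓ :=
  (g.deliver (u, v)).next ε lead

lemma Net.first_loc (hg : g.Quiet) (u v : Fin n) : (g.first ε lead u v).loc = g.loc := by
  funext x
  simp only [Net.first, Net.next, Net.deliver_out hg]
  rfl

lemma Net.first_know (hg : g.Quiet) (u v : Fin n) (j : Fin ℓ) :
    (g.first ε lead u v).know j = (g.know j).learn ((g.deliver (u, v)).req j) ∅ := by
  simp only [Net.first, Net.next, Net.deliver_out hg]

lemma Net.first_moves (hg : g.Quiet) (u v : Fin n) : (g.first ε lead u v).moves = g.moves := by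
  have h := Net.first_loc (ε := ε) (lead := lead) hg u v
  have : (g.first ε lead u v).moves = g.moves + dist g.loc (g.first ε lead u v).loc := rfl
  rw [this, h, dist_self, add_zero]

lemma Net.first_comm (hg : g.Quiet) (u v : Fin n) : (g.first ε lead u v).comm =
    (g.comm + if g.loc u = g.loc v then 0 else 1) +
      ∑ j, (if j = g.loc u ∨ j = g.loc v then
        onRequest lead j (g.know j) ((g.know j).learn (some (g.request u v)) ∅) (g.stored j)
          (g.request u v) else ∅).card := by
  simp only [Net.first, Net.next, Net.deliver_out hg]
  rfl

lemma Net.mem_first_msgs (hg : g.Quiet) (u v : Fin n) (j : Fin ℓ) (p : Fin ℓ × Msg n ℓ) :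
    p ∈ (g.first ε lead u v).msgs j ↔ (p.1 = g.loc u ∨ p.1 = g.loc v) ∧
      (j, p.2) ∈ onRequest lead p.1 (g.know p.1)
        ((g.know p.1).learn (some (g.request u v)) ∅) (g.stored p.1) (g.request u v) := by
  simp only [Net.first, Net.next, Net.deliver_out hg, Set.mem_ofPred_eq]
  split_ifs with h <;> simp [h]

lemma Net.first_mid (hg : g.Quiet) (hE : Equivalence E) (hk : g.Knows E) (u v : Fin n) :
    (g.first ε lead u v).Mid E g.loc u v where
  req _ := rfl
  sound j x y h := by
    rw [Net.first_know hg] at h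
    rcases h with h | ⟨r, h, rfl, rfl⟩ | h
    · exact Or.inl (hk.sound j x y h)
    · have : r = g.request u v := by
        simp only [Net.deliver] at h
        split_ifs at h
        exact (Option.some.inj h).symm
      subst this
      exact Or.inr (Or.inl ⟨hE.refl _, hE.refl _⟩)
    · simp [TellsRel] at h
  complete x y h := by
    rw [Net.first_know hg]
    exact Know.gen_learn (hk.complete x y h) _ _
  union j hj := by
    rw [Net.first_know hg]
    refine Know.gen_of_rel (Or.inr (Or.inl ⟨g.request u v, ?_, rfl, rfl⟩))
    exact if_pos hj

lemma Net.first_late (hg : g.Quiet) (u v : Fin n) (j : Fin ℓ) :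
    ((g.first ε lead u v).know j).late ↔ (g.know j).late := by
  rw [Net.first_know hg]
  simp [Know.learn]

lemma Net.first_col (hg : g.Quiet) (u v : Fin n) (j : Fin ℓ) :
    ((g.first ε lead u v).know j).col = (g.know j).col := by
  rw [Net.first_know hg]
  simp [Know.learn, TellsCol]

lemma Net.first_know_loc (hg : g.Quiet) (u v : Fin n) (j : Fin ℓ) :
    ((g.first ε lead u v).know j).loc = (g.know j).loc := by
  rw [Net.first_know hg]
  simp [Know.learn, TellsLoc]

lemma Net.first_base (hg : g.Quiet) (u v : Fin n) (j : Fin ℓ) :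
    ((g.first ε lead u v).know j).base = (g.know j).base := by
  rw [Net.first_know hg]
  rfl

lemma Net.first_req (hg : g.Quiet) {u v : Fin n} {j : Fin ℓ} (hj : j = g.loc u ∨ j = g.loc v) :
    ((g.first ε lead u v).know j).req = some (g.request u v) := by
  have : (g.deliver (u, v)).req j = some (g.request u v) := if_pos hj
  rw [Net.first_know hg, this]
  rfl

/-! ### The last round of an operation -/

/-- These messages are the last ones in an operation. -/
def Msg.IsLast : Msg n ℓ → Prop
  | .info _ _ _ => True
  | .cmd _ _ => True
  | _ => False

lemma Net.last_out {j : Fin ℓ} (hr : g.req j = none) (h : ∀ p ∈ g.msgs j, p.2.IsLast) :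
    g.out ε lead j = ⟨(g.know j).learn none (g.msgs j), ∅, fun x =>
      if h : ∃ k, ∃ i, (i, Msg.cmd x k) ∈ g.msgs j then some h.choose else none⟩ := by
  have h1 : ¬ ∃ p : Tally n × Request n ℓ, (g.know j).req = some p.2 ∧
      ∃ i, (i, Msg.num p.1) ∈ g.msgs j := by
    rintro ⟨p, -, i, hp⟩
    exact h _ hp
  have h2 : ¬ ∃ i u v, (i, Msg.alarm u v) ∈ g.msgs j := by
    rintro ⟨i, u, v, hp⟩
    exact h _ hp
  have h3 : ¬ ∃ p : Fin n × Fin n, ∃ i, (i, Msg.op p.1 p.2) ∈ g.msgs j := by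
    rintro ⟨p, i, hp⟩
    exact h _ hp
  have h4 : ¬ ∃ i x r c, (i, Msg.report x r c) ∈ g.msgs j := by
    rintro ⟨i, x, r, c, hp⟩
    exact h _ hp
  rw [Net.out, hr]
  simp only [act]
  rw [dif_neg h1, if_neg h2, dif_neg h3, if_neg h4]

lemma Net.last_know {j : Fin ℓ} (hr : g.req j = none) (h : ∀ p ∈ g.msgs j, p.2.IsLast) :
    (g.next ε lead).know j = (g.know j).learn none (g.msgs j) := by
  simp only [Net.next, Net.last_out hr h]

lemma Net.last_quiet (hr : ∀ j, g.req j = none) (h : ∀ j, ∀ p ∈ g.msgs j, p.2.IsLast) :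
    (g.next ε lead).Quiet := by
  refine ⟨fun _ => rfl, fun j => ?_⟩
  simp [Net.next, fun i => Net.last_out (ε := ε) (lead := lead) (hr i) (h i)]

lemma Net.last_comm (hr : ∀ j, g.req j = none) (h : ∀ j, ∀ p ∈ g.msgs j, p.2.IsLast) :
    (g.next ε lead).comm = g.comm := by
  simp [Net.next, fun i => Net.last_out (ε := ε) (lead := lead) (hr i) (h i)]

lemma Net.last_late {j : Fin ℓ} (hr : g.req j = none) (h : ∀ p ∈ g.msgs j, p.2.IsLast) :
    ((g.next ε lead).know j).late ↔ (g.know j).late := by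
  rw [Net.last_know hr h]
  simp only [Know.learn, or_iff_left_iff_imp]
  rintro ⟨i, u, v, hp⟩
  exact (h _ hp).elim

lemma Net.last_know_loc {j : Fin ℓ} (hr : g.req j = none) (h : ∀ p ∈ g.msgs j, p.2.IsLast) :
    ((g.next ε lead).know j).loc = (g.know j).loc := by
  rw [Net.last_know hr h]
  funext x
  refine Know.learn_loc (fun i hi => ?_) (Or.inl rfl)
  obtain ⟨r, c, hp⟩ := hi
  exact (h _ hp).elim

/-- After the last round, the servers know the new sets. -/
lemma Net.Mid.knows (hE : Equivalence E) (hm : g.Mid E loc u v)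
    (h : ∀ j, ∀ p ∈ g.msgs j, p.2.IsLast) (hnew : (g.next ε lead).loc = new)
    (hl : ∀ x y, E x y → loc x = loc y) (hl' : ∀ x y, join E u v x y → new x = new y)
    {r : Fin n → Fin n} (hr : ∀ x y, join E u v x y → r x = r y)
    (hs : ∀ j i x y c, (i, Msg.info x y c) ∈ g.msgs j → join E u v x y)
    (hmoved : ∀ x, new x ≠ loc x → ∃ i c, (i, Msg.info x (r x) c) ∈ g.msgs (new x)) :
    (g.next ε lead).Knows (join E u v) where
  sound j x y hxy := by
    rw [Net.last_know (hm.req j) (h j)] at hxy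
    rcases hxy with hxy | ⟨r, hr', -⟩ | ⟨i, ⟨c, hp⟩ | ⟨c, hp⟩ | hp | hp⟩
    · exact hm.sound j x y hxy
    · exact absurd hr' (by simp)
    · exact hs j i x y c hp
    · exact (h j _ hp).elim
    · exact (h j _ hp).elim
    · exact (h j _ hp).elim
  complete := by
    rw [hnew]
    refine complete_of_transfer (loc := loc) (R := fun j => ((g.next ε lead).know j).gen)
      (fun j => Know.gen_equivalence _) hl hl' ?_ ?_ ?_ hE hr ?_
    · intro x y hxy
      rw [Net.last_know (hm.req _) (h _)]
      exact Know.gen_learn (hm.complete x y hxy) _ _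
    · rw [Net.last_know (hm.req _) (h _)]
      exact Know.gen_learn (hm.union _ (Or.inl rfl)) _ _
    · rw [Net.last_know (hm.req _) (h _)]
      exact Know.gen_learn (hm.union _ (Or.inr rfl)) _ _
    · intro x hx
      obtain ⟨i, c, hp⟩ := hmoved x hx
      rw [Net.last_know (hm.req _) (h _)]
      exact Know.gen_of_rel (Or.inr (Or.inr ⟨i, Or.inl ⟨c, hp⟩⟩))
  collocated := by rw [hnew]; exact hl'

/-! ### The announcement of a new assignment by the leader -/

lemma mem_commands {old new : Fin n → Fin ℓ} {r : Fin n → Fin n} {col : Fin n → Fin ℓ}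
    {j : Fin ℓ} {m : Msg n ℓ} : (j, m) ∈ commands old new r col ↔
      (∃ x, new x ≠ old x ∧ old x = j ∧ Msg.cmd x (new x) = m) ∨
      ∃ x, new x ≠ old x ∧ new x = j ∧ Msg.info x (r x) (col x) = m := by
  simp [commands]

lemma card_commands_le (old new : Fin n → Fin ℓ) (r : Fin n → Fin n) (col : Fin n → Fin ℓ) :
    (commands old new r col).card ≤ 2 * dist old new := by
  refine (Finset.card_union_le _ _).trans ?_
  rw [two_mul]
  exact add_le_add Finset.card_image_le Finset.card_image_le

/-- The leader `lead` has announced the assignment `new`. -/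
structure Net.Announced (lead : Fin ℓ) (E : Fin n → Fin n → Prop) (new : Fin n → Fin ℓ)
    (u v : Fin n) (g : Net n ℓ) : Prop where
  mid : g.Mid E g.loc u v
  msgs : ∃ col, ∀ j, g.msgs j =
    {p | p.1 = lead ∧ (j, p.2) ∈ commands g.loc new (rep (join E u v)) col}

lemma join_rep (E : Fin n → Fin n → Prop) (hE : Equivalence E) (x : Fin n) : E x (rep E x) :=
  Classical.epsilon_spec (p := E x) ⟨x, hE.refl x⟩

lemma rep_eq {E : Fin n → Fin n → Prop} (hE : Equivalence E) {x y : Fin n} (h : E x y) :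
    rep E x = rep E y := by
  have : E x = E y := by
    funext z
    rw [eq_iff_iff]
    exact ⟨hE.trans (hE.symm h), hE.trans h⟩
  unfold rep
  rw [this]

lemma Net.Announced.isLast (h : g.Announced lead E new u v) :
    ∀ j, ∀ p ∈ g.msgs j, p.2.IsLast := by
  obtain ⟨col, hM⟩ := h.msgs
  intro j ⟨i, m⟩ hp
  rw [hM] at hp
  rcases mem_commands.1 hp.2 with ⟨x, -, -, h⟩ | ⟨x, -, -, h⟩
  · simp only at h ⊢
    rw [← h]; trivial
  · simp only at h ⊢
    rw [← h]; trivial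

/-- All commands are executed in the same round, so there is no intermediate assignment whose
validity would be in question. -/
lemma Net.Announced.next_loc (h : g.Announced lead E new u v) : (g.next ε lead).loc = new := by
  have hl := h.isLast
  obtain ⟨col, hM⟩ := h.msgs
  funext x
  simp only [Net.next, Net.last_out (ε := ε) (lead := lead) (h.mid.req _) (hl _)]
  by_cases hx : ∃ k, ∃ i, (i, Msg.cmd x k) ∈ g.msgs (g.loc x)
  · have key : ∀ k i, (i, Msg.cmd x k) ∈ g.msgs (g.loc x) → k = new x := by
      intro k i hi
      rw [hM] at hi
      rcases mem_commands.1 hi.2 with ⟨y, -, -, h⟩ | ⟨y, -, -, h⟩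
      · simp only [Msg.cmd.injEq] at h
        rw [← h.2, h.1]
      · cases h
    rw [dif_pos hx, Option.getD_some]
    exact key _ _ hx.choose_spec.choose_spec
  · rw [dif_neg hx, Option.getD_none]
    by_contra hne
    refine hx ⟨new x, lead, ?_⟩
    rw [hM]
    exact ⟨rfl, mem_commands.2 (Or.inl ⟨x, fun h => hne h.symm, rfl, rfl⟩)⟩

lemma Net.Announced.knows (h : g.Announced lead E new u v) (hE : Equivalence E)
    (hl : ∀ x y, E x y → g.loc x = g.loc y) (hl' : ∀ x y, join E u v x y → new x = new y) :
    (g.next ε lead).Knows (join E u v) := by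
  have hJ := join_equivalence hE u v
  obtain ⟨col, hM⟩ := h.msgs
  refine h.mid.knows hE h.isLast h.next_loc hl hl' (r := rep (join E u v))
    (fun x y hxy => rep_eq hJ hxy) ?_ ?_
  · intro j i x y c hp
    rw [hM] at hp
    rcases mem_commands.1 hp.2 with ⟨z, -, -, h⟩ | ⟨z, -, -, h⟩
    · cases h
    · simp only [Msg.info.injEq] at h
      rw [← h.1, ← h.2.1]
      exact join_rep _ hJ z
  · intro x hx
    refine ⟨lead, col x, ?_⟩
    rw [hM]
    exact ⟨rfl, mem_commands.2 (Or.inr ⟨x, hx, rfl, rfl⟩)⟩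

lemma Net.Announced.next_moves (h : g.Announced lead E new u v) :
    (g.next ε lead).moves = g.moves + dist g.loc new := by
  rw [← h.next_loc (ε := ε)]
  rfl

end Rounds

end DistUF


namespace DistUF

section Late

open scoped Classical

variable {n ℓ : ℕ} {ε : ℝ} {lead : Fin ℓ} {g : Net n ℓ} {E : Fin n → Fin n → Prop} {u v : Fin n}
  {a new : Fin n → Fin ℓ} {T : Set (Fin n → Fin ℓ)}

/-! ### The invariant -/

/-- The invariant in the early phase, for the initial assignment `a`. -/
structure Net.EarlyPhase (a : Fin n → Fin ℓ) (E : Fin n → Fin n → Prop) (g : Net n ℓ) : Prop where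
  late : ∀ j, ¬ (g.know j).late
  col : ∀ x, (g.know (g.loc x)).col x = a x
  anchored : Anchored a g.loc E
  cost : EarlyCost a g.loc E g.moves
  comm : g.comm ≤ 4 * g.moves

/-- The invariant in the late phase, for the initial assignment `a` and the possible final
assignments `T`. -/
structure Net.LatePhase (ε : ℝ) (lead : Fin ℓ) (a : Fin n → Fin ℓ) (T : Set (Fin n → Fin ℓ))
    (E : Fin n → Fin n → Prop) (g : Net n ℓ) : Prop where
  late : ∀ j, (g.know j).late
  gen : ∀ x y, E x y → (g.know lead).gen x y
  loc : (g.know lead).loc = g.loc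
  base : ∃ τ : Equiv.Perm (Fin ℓ), (g.know lead).base = τ ∘ a
  cost : ∀ F ∈ T, ε * (n / ℓ) < 3 * dist a F ∧
    LateCost ((3 + 24 * Real.log n) * dist a F + n) (dist a F) (ε * (n / ℓ)) (g.know lead).base
      g.loc E g.moves
  comm : g.comm + (classes E).card ≤ 11 * g.moves

/-- The invariant between two operations. -/
structure Net.Inv (ε : ℝ) (lead : Fin ℓ) (a : Fin n → Fin ℓ) (T : Set (Fin n → Fin ℓ))
    (E : Fin n → Fin n → Prop) (g : Net n ℓ) : Prop where
  knows : g.Knows E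
  phase : g.EarlyPhase a E ∨ g.LatePhase ε lead a T E

/-! ### Operations in the late phase -/

lemma Net.Announced.leads (h : g.Announced lead E new u v) (hE : Equivalence E)
    (hl : ∀ x y, E x y → g.loc x = g.loc y) (hl' : ∀ x y, join E u v x y → new x = new y)
    (hlate : ∀ j, (g.know j).late) (hgen : ∀ x y, join E u v x y → (g.know lead).gen x y)
    (hloc : (g.know lead).loc = new)
    (hbase : ∃ τ : Equiv.Perm (Fin ℓ), (g.know lead).base = τ ∘ a)
    (hcost : ∀ F ∈ T, ε * (n / ℓ) < 3 * dist a F ∧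
      LateCost ((3 + 24 * Real.log n) * dist a F + n) (dist a F) (ε * (n / ℓ)) (g.know lead).base
        new (join E u v) (g.moves + dist g.loc new))
    (hcomm : g.comm + (classes (join E u v)).card ≤ 11 * (g.moves + dist g.loc new))
    (hv : Valid ε g.loc) (hv' : Valid ε new) (k : ℕ) :
    Net.Leads ε lead (Net.Inv ε lead a T (join E u v)) (k + 1) g := by
  have hr := h.mid.req
  have hL := h.isLast
  have hkn := h.knows (ε := ε) hE hl hl'
  refine ⟨hv, Net.Leads.of_quiet (by rwa [h.next_loc]) (Net.last_quiet hr hL) ⟨hkn, Or.inr ?_⟩ k⟩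
  constructor
  · exact fun j => (Net.last_late (hr j) (hL j)).2 (hlate j)
  · intro x y hxy
    rw [Net.last_know (hr _) (hL _)]
    exact Know.gen_learn (hgen x y hxy) _ _
  · rw [Net.last_know_loc (hr _) (hL _), h.next_loc, hloc]
  · rw [Net.last_know (hr _) (hL _)]
    exact hbase
  · intro F hF
    rw [Net.last_know (hr _) (hL _), h.next_loc, h.next_moves]
    exact hcost F hF
  · rw [Net.last_comm hr hL, h.next_moves]
    exact hcomm

/-- The leader computes a new assignment. -/
lemma Net.Mid.announced {K' : Know n ℓ} {col : Fin n → Fin ℓ} (hm : g.Mid E g.loc u v)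
    (hM : ∀ j, j ≠ lead → g.msgs j = ∅)
    (hout : g.out ε lead lead =
      ⟨K', commands g.loc new (rep (join E u v)) col, fun _ => none⟩)
    (hs : ∀ x y, K'.rel x y → join E u v x y)
    (hK : ∀ x y, (g.know lead).gen x y → K'.gen x y) :
    (g.next ε lead).Announced lead E new u v ∧ (g.next ε lead).loc = g.loc ∧
      (g.next ε lead).moves = g.moves ∧ (g.next ε lead).comm ≤ g.comm + 2 * dist g.loc new ∧
      (g.next ε lead).know lead = K' ∧ ∀ j, j ≠ lead → (g.next ε lead).know j = g.know j := by
  have hidle : ∀ j, j ≠ lead → g.out ε lead j = ⟨g.know j, ∅, fun _ => none⟩ := by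
    intro j hj
    rw [Net.out, hM j hj, hm.req, act_idle]
  have hloc : (g.next ε lead).loc = g.loc := by
    funext x
    by_cases hx : g.loc x = lead
    · simp only [Net.next, hx, hout, Option.getD_none]
    · simp only [Net.next, hidle _ hx, Option.getD_none]
  have hlead : (g.next ε lead).know lead = K' := by simp only [Net.next, hout]
  have hother : ∀ j, j ≠ lead → (g.next ε lead).know j = g.know j := by
    intro j hj
    simp only [Net.next, hidle j hj]
  have hmono : ∀ j x y, (g.know j).gen x y → ((g.next ε lead).know j).gen x y := by
    intro j x y h
    by_cases hj : j = lead
    · subst hj; rw [hlead]; exact hK x y h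
    · rw [hother j hj]; exact h
  refine ⟨⟨?_, col, fun j => ?_⟩, hloc, ?_, ?_, hlead, hother⟩
  · rw [hloc]
    refine ⟨fun _ => rfl, fun j x y h => ?_, fun x y h => hmono _ _ _ (hm.complete x y h),
      fun j hj => hmono _ _ _ (hm.union j hj)⟩
    by_cases hj : j = lead
    · subst hj; rw [hlead] at h; exact hs x y h
    · rw [hother j hj] at h; exact hm.sound j x y h
  · rw [hloc]
    ext ⟨i, m⟩
    simp only [Net.next, Set.mem_ofPred_eq]
    by_cases hi : i = lead
    · subst hi; simp [hout]
    · simp [hidle i hi, hi]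
  · have : (g.next ε lead).moves = g.moves + dist g.loc (g.next ε lead).loc := rfl
    rw [this, hloc, dist_self, add_zero]
  · have : (g.next ε lead).comm = g.comm + ∑ j, (g.out ε lead j).send.card := rfl
    rw [this, Finset.sum_eq_single lead (fun j _ hj => by simp [hidle j hj]) (by simp), hout]
    exact Nat.add_le_add_left (card_commands_le _ _ _ _) _

/-- An operation without any message. -/
lemma Net.first_knows (hg : g.Quiet) (hE : Equivalence E) (hk : g.Knows E)
    (hloc : g.loc u = g.loc v) (hq : (g.first ε lead u v).Quiet) :
    (g.first ε lead u v).Knows (join E u v) := by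
  have hm := Net.first_mid (ε := ε) (lead := lead) hg hE hk u v
  have hM := hq.2
  have := hm.knows (ε := ε) (lead := lead) (new := g.loc) (r := rep (join E u v)) hE
    (fun j p hp => by rw [hM] at hp; exact hp.elim)
    (by rw [hq.next, Net.first_loc hg]) hk.collocated ?_
    (fun x y hxy => rep_eq (join_equivalence hE u v) hxy)
    (fun j i x y c hp => by rw [hM] at hp; exact hp.elim) (fun x hx => absurd rfl hx)
  · rwa [hq.next] at this
  · rintro x y (h | ⟨h, h'⟩ | ⟨h, h'⟩)
    · exact hk.collocated _ _ h
    · exact (hk.collocated _ _ h).trans (hloc.trans (hk.collocated _ _ h'))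
    · exact (hk.collocated _ _ h).trans (hloc.symm.trans (hk.collocated _ _ h'))

/-- The number of unions inside an existing set is unbounded, so these must be free: the server
storing both elements recognises the case and stays silent. -/
lemma Net.LatePhase.of_rel (h : g.LatePhase ε lead a T E) (hg : g.Quiet) (hE : Equivalence E)
    (hk : g.Knows E) (hv : Valid ε g.loc) (huv : E u v) (k : ℕ) :
    Net.Leads ε lead (Net.Inv ε lead a T (join E u v)) k (g.first ε lead u v) := by
  have hloc := hk.collocated u v huv
  have hsend : ∀ j, j = g.loc u ∨ j = g.loc v →
      onRequest lead j (g.know j) ((g.know j).learn (some (g.request u v)) ∅) (g.stored j)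
        (g.request u v) = ∅ := by
    intro j _
    rw [onRequest, if_pos (h.late j), if_neg]
    rintro ⟨hj, hn⟩
    exact hn (hj ▸ hk.complete u v huv)
  have hq : (g.first ε lead u v).Quiet := by
    refine ⟨fun _ => rfl, fun j => ?_⟩
    ext p
    rw [Net.mem_first_msgs hg]
    simp only [Set.mem_empty_iff_false, iff_false, not_and]
    intro hp
    rw [hsend _ hp]
    exact Finset.notMem_empty _
  refine Net.Leads.of_quiet (by rwa [Net.first_loc hg]) hq
    ⟨Net.first_knows hg hE hk hloc hq, Or.inr ?_⟩ k
  rw [join_self hE huv]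
  constructor
  · exact fun j => (Net.first_late hg u v j).2 (h.late j)
  · intro x y hxy
    rw [Net.first_know hg]
    exact Know.gen_learn (h.gen x y hxy) _ _
  · rw [Net.first_know_loc hg, Net.first_loc hg, h.loc]
  · rw [Net.first_base hg]; exact h.base
  · intro F hF
    rw [Net.first_base hg, Net.first_loc hg, Net.first_moves hg]
    exact h.cost F hF
  · rw [Net.first_comm hg, Net.first_moves hg, if_pos hloc, Finset.sum_eq_zero]
    · exact h.comm
    · intro j _
      split_ifs with hj
      · rw [hsend j hj]; rfl
      · rfl

lemma Net.LatePhase.of_not_rel (h : g.LatePhase ε lead a T E) (hg : g.Quiet)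
    (hE : Equivalence E) (hk : g.Knows E) (hv : Valid ε g.loc) (hd : ℓ ∣ n) (hε : 0 < ε)
    (hT : ∀ F ∈ T, PerfectlyBalanced F ∧ ∀ x y, join E u v x y → F x = F y) (hne : T.Nonempty)
    (huv : ¬ E u v) (k : ℕ) :
    Net.Leads ε lead (Net.Inv ε lead a T (join E u v)) (k + 2) (g.first ε lead u v) := by
  have hJ := join_equivalence hE u v
  set g₁ := g.first ε lead u v with hg₁
  have hm : g₁.Mid E g.loc u v := Net.first_mid hg hE hk u v
  have hloc₁ : g₁.loc = g.loc := Net.first_loc hg u v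
  have hgen : (g.know (g.loc u)).gen u v → E u v :=
    fun h => Know.gen_sound hE (hk.sound _) h
  have hsend : ∀ j, onRequest lead j (g.know j) ((g.know j).learn (some (g.request u v)) ∅)
      (g.stored j) (g.request u v) = if j = g.loc u then {(lead, Msg.op u v)} else ∅ := by
    intro j
    rw [onRequest, if_pos (h.late j)]
    by_cases hj : j = g.loc u
    · rw [if_pos hj, if_pos]
      · rfl
      · exact ⟨hj, fun h => huv (hgen (hj ▸ h))⟩
    · rw [if_neg hj, if_neg]
      exact fun h => hj h.1
  have hM : ∀ j p, p ∈ g₁.msgs j ↔ j = lead ∧ p = (g.loc u, Msg.op u v) := by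
    rintro j ⟨i, m⟩
    rw [hg₁, Net.mem_first_msgs hg, hsend]
    by_cases hi : i = g.loc u
    · simp [hi]
    · simp [hi]
  have hMo : ∀ j, j ≠ lead → g₁.msgs j = ∅ := by
    intro j hj
    ext p
    rw [hM]
    simp [hj]
  have hMl : g₁.msgs lead = {(g.loc u, Msg.op u v)} := by
    ext p
    rw [hM]
    simp
  set K := (g₁.know lead).learn none (g₁.msgs lead) with hK
  have hKs : ∀ x y, K.rel x y → join E u v x y := by
    rintro x y (hxy | ⟨r, hr, -⟩ | ⟨i, ⟨c, hp⟩ | ⟨c, hp⟩ | hp | hp⟩)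
    · exact hm.sound lead x y hxy
    · exact absurd hr (by simp)
    · rw [hMl] at hp; simp at hp
    · rw [hMl] at hp; simp at hp
    · rw [hMl] at hp; simp at hp
    · rw [hMl] at hp
      simp only [Set.mem_singleton_iff, Prod.mk.injEq, Msg.op.injEq] at hp
      rw [hp.2.1, hp.2.2]
      exact Or.inr (Or.inl ⟨hE.refl _, hE.refl _⟩)
  have hKuv : K.gen u v :=
    Know.gen_of_rel (Or.inr (Or.inr ⟨g.loc u, Or.inr (Or.inr (Or.inr (by rw [hMl]; rfl)))⟩))
  have hKold : ∀ x y, E x y → K.gen x y := by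
    intro x y hxy
    have : (g₁.know lead).gen x y := by
      rw [hg₁, Net.first_know hg]
      exact Know.gen_learn (h.gen x y hxy) _ _
    exact Know.gen_learn this _ _
  have hKgen : K.gen = join E u v := by
    have e := K.gen_equivalence
    funext x y
    rw [eq_iff_iff]
    refine ⟨fun h => Know.gen_sound hJ hKs h, ?_⟩
    rintro (h | ⟨h, h'⟩ | ⟨h, h'⟩)
    · exact hKold x y h
    · exact e.trans (hKold _ _ h) (e.trans hKuv (hKold _ _ h'))
    · exact e.trans (hKold _ _ h) (e.trans (e.symm hKuv) (hKold _ _ h'))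
  have hKloc : K.loc = g.loc := by
    rw [← h.loc, ← Net.first_know_loc (ε := ε) (lead := lead) hg u v lead]
    funext x
    refine Know.learn_loc (fun i hi => ?_) (Or.inl rfl)
    obtain ⟨r, c, hp⟩ := hi
    rw [hMl] at hp
    simp at hp
  have hKbase : K.base = (g.know lead).base := Net.first_base hg u v lead
  set new := lateNext ε (g.know lead).base (join E u v) g.loc u v with hnew
  have hout : g₁.out ε lead lead = ⟨{ K with loc := new },
      commands g₁.loc new (rep (join E u v)) K.col, fun _ => none⟩ := by
    have h1 : ¬ ∃ p : Tally n × Request n ℓ, (g₁.know lead).req = some p.2 ∧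
        ∃ i, (i, Msg.num p.1) ∈ g₁.msgs lead := by
      rintro ⟨p, -, i, hp⟩; rw [hMl] at hp; simp at hp
    have h2 : ¬ ∃ i u v, (i, Msg.alarm u v) ∈ g₁.msgs lead := by
      rintro ⟨i, x, y, hp⟩; rw [hMl] at hp; simp at hp
    have h3 : ∃ p : Fin n × Fin n, ∃ i, (i, Msg.op p.1 p.2) ∈ g₁.msgs lead :=
      ⟨(u, v), g.loc u, by rw [hMl]; rfl⟩
    have h4 : h3.choose = (u, v) := by
      obtain ⟨i, hp⟩ := h3.choose_spec
      have hp' := (hM _ _).1 hp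
      simp only [Prod.mk.injEq, Msg.op.injEq] at hp'
      exact Prod.ext hp'.2.2.1 hp'.2.2.2
    rw [Net.out, hm.req]
    simp only [act]
    rw [dif_neg h1, if_neg h2, dif_pos h3, h4, onOp, ← hK, hKgen, hKloc, hKbase, ← hnew, hloc₁]
  have hm' : g₁.Mid E g₁.loc u v := by rw [hloc₁]; exact hm
  obtain ⟨hA, hloc₂, hmov, hcomm, hkl, hko⟩ := hm'.announced hMo hout hKs
    (fun x y hxy => Know.gen_learn hxy _ _)
  obtain ⟨F₀, hF₀⟩ := hne
  obtain ⟨hb, hc⟩ := hT F₀ hF₀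
  have hstep : LateStep ε (g.know lead).base g.loc E (join E u v) new :=
    lateStep_lateNext hE hk.collocated huv hv hd hε hb hc
  refine ⟨by rwa [hloc₁], hA.leads hE ?_ hstep.collocated ?_ ?_ ?_ ?_ ?_ ?_ ?_ hstep.valid k⟩
  · rw [hloc₂, hloc₁]; exact hk.collocated
  · intro j
    by_cases hj : j = lead
    · rw [hj, hkl]
      exact Or.inl ((Net.first_late hg u v lead).2 (h.late lead))
    · rw [hko j hj]
      exact (Net.first_late hg u v j).2 (h.late j)
  · intro x y hxy
    rw [hkl]
    have : K.gen x y := by rw [hKgen]; exact hxy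
    exact this
  · rw [hkl]
  · rw [hkl]
    exact hKbase ▸ h.base
  · intro F hF
    obtain ⟨h1, h2⟩ := h.cost F hF
    refine ⟨h1, ?_⟩
    have hpos : 0 < ε * ((n : ℝ) / ℓ) := by
      have hn : 0 < n := u.pos
      have hℓ : 0 < ℓ := lead.pos
      positivity
    rw [hkl, hmov, hloc₂, hloc₁, Net.first_moves hg]
    simp only
    rw [hKbase]
    refine hstep.cost _ _ _ _ hpos rfl h2 fun p hp => ?_
    obtain ⟨τ, hτ⟩ := h.base
    rw [hτ] at hp ⊢
    exact_mod_cast hp.dist_le_of_perm (hT F hF).1 (hT F hF).2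
  -- Even a local union sends one message to the leader; the vanishing class pays for it.
  · have h1 := card_classes_join hE huv
    have h2 := h.comm
    have h3 : g₁.comm ≤ (g.comm + if g.loc u = g.loc v then 0 else 1) + 1 := by
      rw [hg₁, Net.first_comm hg]
      refine Nat.add_le_add_left ?_ _
      calc _ ≤ ∑ j, (if j = g.loc u then 1 else 0) := by
            refine Finset.sum_le_sum fun j _ => ?_
            rw [hsend]
            by_cases hj : j = g.loc u
            · simp [hj]
            · simp [hj]
        _ = 1 := by simp
    rw [hmov, hloc₂, hloc₁, Net.first_moves hg]
    rw [hloc₁] at hcomm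
    by_cases hloc : g.loc u = g.loc v
    · have h4 : new = g.loc := by rw [hnew, lateNext, if_pos hloc]
      rw [if_pos hloc] at h3
      rw [h4, dist_self] at hcomm ⊢
      omega
    -- A remote union forces at least one move, which covers the extra unit for the operation; the
    -- commands cost two messages per moved element.
    · have h4 : dist g.loc new ≠ 0 := by
        intro h0
        have := dist_eq_zero h0
        refine hloc ?_
        rw [← this]
        exact hstep.collocated u v (Or.inr (Or.inl ⟨hE.refl u, hE.refl v⟩))
      rw [if_neg hloc] at h3
      omega
  · rwa [hloc₂, hloc₁]

end Late

end DistUF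


namespace DistUF

section Early

open scoped Classical

variable {n ℓ : ℕ} {ε : ℝ} {lead : Fin ℓ} {g : Net n ℓ} {E : Fin n → Fin n → Prop} {u v : Fin n}
  {a new : Fin n → Fin ℓ} {T : Set (Fin n → Fin ℓ)}

/-! ### Operations in the early phase -/

lemma Net.EarlyPhase.of_local (h : g.EarlyPhase a E) (hg : g.Quiet) (hE : Equivalence E)
    (hk : g.Knows E) (hv : Valid ε g.loc) (hloc : g.loc u = g.loc v) (k : ℕ) :
    Net.Leads ε lead (Net.Inv ε lead a T (join E u v)) k (g.first ε lead u v) := by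
  have hsend : ∀ j, onRequest lead j (g.know j) ((g.know j).learn (some (g.request u v)) ∅)
      (g.stored j) (g.request u v) = ∅ := by
    intro j
    rw [onRequest, if_neg (h.late j), if_neg]
    exact fun h => h hloc
  have hq : (g.first ε lead u v).Quiet := by
    refine ⟨fun _ => rfl, fun j => ?_⟩
    ext p
    rw [Net.mem_first_msgs hg, hsend]
    simp
  refine Net.Leads.of_quiet (by rwa [Net.first_loc hg]) hq
    ⟨Net.first_knows hg hE hk hloc hq, Or.inl ?_⟩ k
  constructor
  · exact fun j => fun hj => h.late j ((Net.first_late hg u v j).1 hj)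
  · intro x
    rw [Net.first_loc hg, Net.first_col hg]
    exact h.col x
  · rw [Net.first_loc hg]
    by_cases huv : E u v
    · rw [join_self hE huv]; exact h.anchored
    · exact h.anchored.join_local hE huv hk.collocated hloc
  · rw [Net.first_loc hg, Net.first_moves hg]
    by_cases huv : E u v
    · rw [join_self hE huv]; exact h.cost
    · exact h.cost.join_local hE huv
  · rw [Net.first_comm hg, Net.first_moves hg, if_pos hloc, Finset.sum_eq_zero]
    · exact h.comm
    · intro j _
      rw [hsend]
      split_ifs <;> rfl

/-- The class of `w` is moved to the server of `z`, where `{w, z} = {u, v}`. -/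
lemma Net.Mid.leads_of_move (hm : g.Mid E g.loc u v) (hE : Equivalence E)
    (hl : ∀ x y, E x y → g.loc x = g.loc y) {w z : Fin n}
    (hwz : join E w z = join E u v) (huw : join E u v w u) (hloc : g.loc w ≠ g.loc z)
    (hout : g.out ε lead (g.loc w) = ⟨g.know (g.loc w), (cls E w).image
      (fun x => (g.loc z, Msg.info x u ((g.know (g.loc w)).col x))),
      fun x => if x ∈ cls E w then some (g.loc z) else none⟩)
    (hidle : ∀ j, j ≠ g.loc w → g.out ε lead j = ⟨g.know j, ∅, fun _ => none⟩)
    (hlate : ∀ j, ¬ (g.know j).late) (hcol : ∀ x, (g.know (g.loc x)).col x = a x)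
    (hanch : Anchored a g.loc E) (hcost : EarlyCost a g.loc E g.moves)
    (hcomm : g.comm ≤ 4 * g.moves + 3) (hv : Valid ε g.loc) (hwz' : ¬ E w z)
    (hv' : Valid ε (moveTo (join E w z) g.loc w (g.loc z)))
    (hr : MoveRule (cls E w).card (cls E z).card
      (count a (cls E w) (g.loc w) + count a (cls E z) (g.loc w))
      (count a (cls E w) (g.loc z) + count a (cls E z) (g.loc z))) (k : ℕ) :
    Net.Leads ε lead (Net.Inv ε lead a T (join E u v)) (k + 2) g := by
  set new := moveTo (join E w z) g.loc w (g.loc z) with hnew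
  set g₁ := g.next ε lead with hg₁
  have hJ := join_equivalence hE u v
  have hloc₁ : g₁.loc = new := by
    funext x
    rw [hg₁, hnew]
    by_cases hxw : g.loc x = g.loc w
    · simp only [Net.next, hxw, hout]
      by_cases hx : x ∈ cls E w
      · rw [if_pos hx, moveTo_join_of_mem hx]; rfl
      · rw [if_neg hx, moveTo_join_of_not_mem hl hx]; exact hxw.symm
    · simp only [Net.next, hidle _ hxw, Option.getD_none]
      rw [moveTo_join_of_not_mem hl]
      exact fun hx => hxw (hl _ _ (mem_cls.1 hx)).symm
  have hknow : ∀ j, g₁.know j = g.know j := by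
    intro j
    rw [hg₁]
    by_cases hj : j = g.loc w
    · subst hj; simp only [Net.next, hout]
    · simp only [Net.next, hidle j hj]
  have hmov : g₁.moves = g.moves + dist g.loc new := by
    rw [← hloc₁]; rfl
  have hcomm₁ : g₁.comm ≤ g.comm + dist g.loc new := by
    have : g₁.comm = g.comm + ∑ j, (g.out ε lead j).send.card := rfl
    rw [this, Finset.sum_eq_single (g.loc w) (fun j _ hj => by simp [hidle j hj]) (by simp), hout,
      hnew, dist_moveTo hl hloc]
    exact Nat.add_le_add_left Finset.card_image_le _
  have hM : ∀ j i m, (i, m) ∈ g₁.msgs j ↔ i = g.loc w ∧ j = g.loc z ∧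
      ∃ x ∈ cls E w, Msg.info x u (a x) = m := by
    intro j i m
    simp only [hg₁, Net.next, Set.mem_ofPred_eq]
    by_cases hi : i = g.loc w
    · subst hi
      simp only [hout, Finset.mem_image, Prod.mk.injEq, true_and]
      constructor
      · rintro ⟨x, hx, h1, h2⟩
        have hx' := hl _ _ (mem_cls.1 hx)
        rw [hx', hcol] at h2
        exact ⟨h1.symm, x, hx, h2⟩
      · rintro ⟨h1, x, hx, h2⟩
        refine ⟨x, hx, h1.symm, ?_⟩
        rw [hl _ _ (mem_cls.1 hx), hcol]
        exact h2
    · simp [hidle i hi, hi]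
  have hm₁ : g₁.Mid E g.loc u v :=
    ⟨fun _ => rfl, fun j => by rw [hknow]; exact hm.sound j,
      fun x y h => by rw [hknow]; exact hm.complete x y h,
      fun j h => by rw [hknow]; exact hm.union j h⟩
  have hL : ∀ j, ∀ p ∈ g₁.msgs j, p.2.IsLast := by
    rintro j ⟨i, m⟩ hp
    obtain ⟨-, -, x, -, rfl⟩ := (hM _ _ _).1 hp
    trivial
  have hloc₂ : (g₁.next ε lead).loc = new := by
    rw [← hloc₁]
    funext x
    simp only [Net.next, Net.last_out (ε := ε) (lead := lead) (hm₁.req _) (hL _)]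
    rw [dif_neg, Option.getD_none]
    rintro ⟨k, i, hp⟩
    obtain ⟨-, -, x, -, h⟩ := (hM _ _ _).1 hp
    cases h
  have hmov₂ : (g₁.next ε lead).moves = g.moves + dist g.loc new := by
    have : (g₁.next ε lead).moves = g₁.moves + dist g₁.loc (g₁.next ε lead).loc := rfl
    rw [this, hloc₂, hloc₁, dist_self, hmov, add_zero]
  have hnewmoved : ∀ x, new x ≠ g.loc x → x ∈ cls E w ∧ new x = g.loc z := by
    intro x hx
    have hx' : x ∈ cls E w := by
      by_contra hx'
      exact hx (moveTo_join_of_not_mem hl hx')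
    exact ⟨hx', moveTo_join_of_mem hx'⟩
  have hkn := hm₁.knows (ε := ε) (lead := lead) hE hL hloc₂ hl
    (by rw [← hwz]; exact moveTo_collocated hE hl _) (r := fun _ => u) (fun _ _ _ => rfl)
    (by
      intro j i x y c hp
      obtain ⟨-, -, x', hx', h⟩ := (hM _ _ _).1 hp
      simp only [Msg.info.injEq] at h
      rw [← h.1, ← h.2.1]
      exact hJ.trans (hJ.symm (Or.inl (mem_cls.1 hx'))) huw)
    (by
      intro x hx
      obtain ⟨h1, h2⟩ := hnewmoved x hx
      exact ⟨g.loc w, a x, (hM _ _ _).2 ⟨rfl, h2, x, h1, rfl⟩⟩)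
  refine ⟨hv, hloc₁ ▸ hv', Net.Leads.of_quiet (hloc₂ ▸ hv') (Net.last_quiet hm₁.req hL)
    ⟨hkn, Or.inl ?_⟩ k⟩
  constructor
  · intro j hj
    rw [Net.last_late (hm₁.req j) (hL j), hknow] at hj
    exact hlate j hj
  · intro x
    rw [hloc₂, Net.last_know (hm₁.req _) (hL _), hknow]
    refine Know.learn_col ?_ ?_
    · rintro c ⟨i, r, hp | hp⟩
      · obtain ⟨-, -, x', -, h⟩ := (hM _ _ _).1 hp
        simp only [Msg.info.injEq] at h
        rw [← h.2.2, h.1]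
      · exact (hL _ _ hp).elim
    · by_cases hx : new x = g.loc x
      · rw [hx]; exact Or.inl (hcol x)
      · obtain ⟨h1, h2⟩ := hnewmoved x hx
        exact Or.inr ⟨a x, g.loc w, u, Or.inl ((hM _ _ _).2 ⟨rfl, h2, x, h1, rfl⟩)⟩
  · rw [hloc₂, hnew, ← hwz]
    exact hanch.moveTo hE hwz' hl hr
  · rw [hloc₂, hmov₂, hnew, ← hwz]
    exact hcost.moveTo hE hanch hwz' hl hloc hr
  -- The remote operation and the two tallies cost 3, charged to one moved element; with one `info`
  -- per moved element this gives the factor 4.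
  · have h1 : 1 ≤ dist g.loc new := by
      rw [hnew, dist_moveTo hl hloc]
      exact card_cls_pos hE w
    rw [Net.last_comm hm₁.req hL, hmov₂]
    omega

/-- The late phase begins. -/
lemma Net.Mid.leads_of_alarm (hm : g.Mid E g.loc u v) (hE : Equivalence E)
    (hl : ∀ x y, E x y → g.loc x = g.loc y) (hloc : g.loc u ≠ g.loc v)
    (hout : g.out ε lead (g.loc u) = ⟨g.know (g.loc u),
      Finset.univ.image (fun k => (k, Msg.alarm u v)), fun _ => none⟩)
    (hidle : ∀ j, j ≠ g.loc u → g.out ε lead j = ⟨g.know j, ∅, fun _ => none⟩)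
    (hcol : ∀ x, (g.know (g.loc x)).col x = a x) (hcost : EarlyCost a g.loc E g.moves)
    (hcomm : g.comm ≤ 4 * g.moves + 3) (hv : Valid ε g.loc) (hd : ℓ ∣ n) (hε : 0 < ε)
    (hT : ∀ F ∈ T, PerfectlyBalanced F ∧ ∀ x y, join E u v x y → F x = F y) (hne : T.Nonempty)
    (hfar : ∀ F ∈ T, ε * (n / ℓ) < 3 * dist a F) (k : ℕ) :
    Net.Leads ε lead (Net.Inv ε lead a T (join E u v)) (k + 4) g := by
  have hJ := join_equivalence hE u v
  have hn : 0 < n := u.pos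
  -- the alarm arrives
  set g₁ := g.next ε lead with hg₁
  have hknow₁ : ∀ j, g₁.know j = g.know j := by
    intro j
    rw [hg₁]
    by_cases hj : j = g.loc u
    · subst hj; simp only [Net.next, hout]
    · simp only [Net.next, hidle j hj]
  have hmove : ∀ j, (g.out ε lead j).move = fun _ => none := by
    intro j
    by_cases hj : j = g.loc u
    · subst hj; rw [hout]
    · rw [hidle j hj]
  have hloc₁ : g₁.loc = g.loc := by
    funext x
    simp only [hg₁, Net.next, hmove, Option.getD_none]
  have hmov₁ : g₁.moves = g.moves := by
    have : g₁.moves = g.moves + dist g.loc g₁.loc := rfl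
    rw [this, hloc₁, dist_self, add_zero]
  have hcomm₁ : g₁.comm ≤ g.comm + ℓ := by
    have : g₁.comm = g.comm + ∑ j, (g.out ε lead j).send.card := rfl
    rw [this, Finset.sum_eq_single (g.loc u) (fun j _ hj => by simp [hidle j hj]) (by simp), hout]
    exact Nat.add_le_add_left (Finset.card_image_le.trans (by simp)) _
  have hM₁ : ∀ j, g₁.msgs j = {(g.loc u, Msg.alarm u v)} := by
    intro j
    ext ⟨i, m⟩
    simp only [hg₁, Net.next, Set.mem_ofPred_eq, Set.mem_singleton_iff, Prod.mk.injEq]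
    by_cases hi : i = g.loc u
    · subst hi
      simp [hout, eq_comm]
    · simp [hidle i hi, hi]
  -- the servers report
  set K₂ : Fin ℓ → Know n ℓ := fun j => (g.know j).learn none {(g.loc u, Msg.alarm u v)} with hK₂
  have hout₁ : ∀ j, g₁.out ε lead j = ⟨K₂ j, (g.stored j).image (fun x =>
      (lead, Msg.report x (rep (K₂ j).gen x) ((K₂ j).col x))), fun _ => none⟩ := by
    intro j
    have h1 : ¬ ∃ p : Tally n × Request n ℓ, (g₁.know j).req = some p.2 ∧
        ∃ i, (i, Msg.num p.1) ∈ g₁.msgs j := by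
      rintro ⟨p, -, i, hp⟩; rw [hM₁] at hp; simp at hp
    have h2 : ∃ i u v, (i, Msg.alarm u v) ∈ g₁.msgs j :=
      ⟨g.loc u, u, v, by rw [hM₁]; rfl⟩
    have h3 : g₁.stored j = g.stored j := by
      ext x; simp [hloc₁]
    have h4 : g₁.req j = none := rfl
    rw [Net.out, h4]
    simp only [act]
    rw [dif_neg h1, if_pos h2, hM₁, hknow₁, h3]
  set g₂ := g₁.next ε lead with hg₂
  have hknow₂ : ∀ j, g₂.know j = K₂ j := by
    intro j
    simp only [hg₂, Net.next, hout₁]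
  have hloc₂ : g₂.loc = g.loc := by
    funext x
    simp only [hg₂, Net.next, hout₁, Option.getD_none, hloc₁]
  have hmov₂ : g₂.moves = g.moves := by
    have : g₂.moves = g₁.moves + dist g₁.loc g₂.loc := rfl
    rw [this, hloc₁, hloc₂, dist_self, hmov₁, add_zero]
  have hcomm₂ : g₂.comm ≤ g.comm + ℓ + n := by
    have : g₂.comm = g₁.comm + ∑ j, (g₁.out ε lead j).send.card := rfl
    rw [this]
    refine Nat.add_le_add hcomm₁ ?_
    calc _ ≤ ∑ j, (g.stored j).card := by
          refine Finset.sum_le_sum fun j _ => ?_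
          rw [hout₁]
          exact Finset.card_image_le
      _ = n := sum_load g.loc
  have hK₂s : ∀ j x y, (K₂ j).rel x y → join E u v x y := by
    rintro j x y (hxy | ⟨r, hr, -⟩ | ⟨i, ⟨c, hp⟩ | ⟨c, hp⟩ | hp | hp⟩)
    · exact hm.sound j x y hxy
    · exact absurd hr (by simp)
    · simp at hp
    · simp at hp
    · simp only [Set.mem_singleton_iff, Prod.mk.injEq, Msg.alarm.injEq] at hp
      rw [hp.2.1, hp.2.2]
      exact Or.inr (Or.inl ⟨hE.refl _, hE.refl _⟩)
    · simp at hp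
  have hK₂uv : ∀ j, (K₂ j).gen u v := fun j =>
    Know.gen_of_rel (Or.inr (Or.inr ⟨g.loc u, Or.inr (Or.inr (Or.inl rfl))⟩))
  have hK₂old : ∀ x y, E x y → (K₂ (g.loc x)).gen x y := fun x y h =>
    Know.gen_learn (hm.complete x y h) _ _
  have hK₂late : ∀ j, (K₂ j).late := fun j => Or.inr ⟨g.loc u, u, v, rfl⟩
  have hK₂col : ∀ x, (K₂ (g.loc x)).col x = a x := by
    intro x
    refine Know.learn_col ?_ (Or.inl (hcol x))
    rintro c ⟨i, r, hp | hp⟩ <;> simp at hp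
  have hM₂ : ∀ j i m, (i, m) ∈ g₂.msgs j ↔ j = lead ∧
      ∃ x, g.loc x = i ∧ Msg.report x (rep (K₂ i).gen x) (a x) = m := by
    intro j i m
    simp only [hg₂, Net.next, Set.mem_ofPred_eq, hout₁, Finset.mem_image, Prod.mk.injEq,
      Net.mem_stored]
    constructor
    · rintro ⟨x, rfl, h1, h2⟩
      rw [hK₂col] at h2
      exact ⟨h1.symm, x, rfl, h2⟩
    · rintro ⟨h1, x, rfl, h2⟩
      exact ⟨x, rfl, h1.symm, by rw [hK₂col]; exact h2⟩
  -- the leader collects the reports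
  have hm₂ : g₂.Mid E g₂.loc u v := by
    rw [hloc₂]
    exact ⟨fun _ => rfl, fun j => by rw [hknow₂]; exact hK₂s j,
      fun x y h => by rw [hknow₂]; exact hK₂old x y h, fun j _ => by rw [hknow₂]; exact hK₂uv j⟩
  have hMo : ∀ j, j ≠ lead → g₂.msgs j = ∅ := by
    intro j hj
    ext ⟨i, m⟩
    rw [hM₂]
    simp [hj]
  set K := (g₂.know lead).learn none (g₂.msgs lead) with hK
  have hKs : ∀ x y, K.rel x y → join E u v x y := by
    rintro x y (hxy | ⟨r, hr, -⟩ | ⟨i, ⟨c, hp⟩ | ⟨c, hp⟩ | hp | hp⟩)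
    · exact hm₂.sound lead x y hxy
    · exact absurd hr (by simp)
    · obtain ⟨-, x', -, h⟩ := (hM₂ _ _ _).1 hp; cases h
    · obtain ⟨-, x', -, h⟩ := (hM₂ _ _ _).1 hp
      simp only [Msg.report.injEq] at h
      rw [← h.1, ← h.2.1]
      exact Know.gen_sound hJ (hK₂s i) (join_rep _ (Know.gen_equivalence _) x')
    · obtain ⟨-, x', -, h⟩ := (hM₂ _ _ _).1 hp; cases h
    · obtain ⟨-, x', -, h⟩ := (hM₂ _ _ _).1 hp; cases h
  have hKmono : ∀ x y, (g₂.know lead).gen x y → K.gen x y := fun x y h => Know.gen_learn h _ _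
  have hKuv : K.gen u v := hKmono _ _ (by rw [hknow₂]; exact hK₂uv lead)
  have hKrep : ∀ x, K.gen x (rep (K₂ (g.loc x)).gen x) := fun x =>
    Know.gen_of_rel (Or.inr (Or.inr ⟨g.loc x, Or.inr (Or.inl
      ⟨a x, (hM₂ _ _ _).2 ⟨rfl, x, rfl, rfl⟩⟩)⟩))
  -- An old class lies on a single server, which reports the same representative for all its
  -- elements.
  have hKold : ∀ x y, E x y → K.gen x y := by
    intro x y hxy
    have h1 := hKrep x
    rw [rep_eq (Know.gen_equivalence _) (hK₂old x y hxy), hl x y hxy] at h1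
    exact K.gen_equivalence.trans h1 (K.gen_equivalence.symm (hKrep y))
  have hKgen : K.gen = join E u v := by
    have e := K.gen_equivalence
    funext x y
    rw [eq_iff_iff]
    refine ⟨fun h => Know.gen_sound hJ hKs h, ?_⟩
    rintro (h | ⟨h, h'⟩ | ⟨h, h'⟩)
    · exact hKold x y h
    · exact e.trans (hKold _ _ h) (e.trans hKuv (hKold _ _ h'))
    · exact e.trans (hKold _ _ h) (e.trans (e.symm hKuv) (hKold _ _ h'))
  have hKcol : K.col = a := by
    funext x
    refine Know.learn_col ?_ (Or.inr ⟨a x, g.loc x, _, Or.inr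
      ((hM₂ _ _ _).2 ⟨rfl, x, rfl, rfl⟩)⟩)
    rintro c ⟨i, r, hp | hp⟩
    · obtain ⟨-, x', -, h⟩ := (hM₂ _ _ _).1 hp; cases h
    · obtain ⟨-, x', -, h⟩ := (hM₂ _ _ _).1 hp
      simp only [Msg.report.injEq] at h
      rw [← h.2.2, h.1]
  have hKloc : K.loc = g.loc := by
    funext x
    refine Know.learn_loc ?_ (Or.inr ⟨g.loc x, _, a x, (hM₂ _ _ _).2 ⟨rfl, x, rfl, rfl⟩⟩)
    rintro i ⟨r, c, hp⟩
    obtain ⟨-, x', h1, h⟩ := (hM₂ _ _ _).1 hp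
    simp only [Msg.report.injEq] at h
    rw [← h1, h.1]
  obtain ⟨F₀, hF₀⟩ := hne
  obtain ⟨hb, hc⟩ := hT F₀ hF₀
  set p := restart a (join E u v) g.loc with hp
  have hp' : IsRestart a (join E u v) g.loc p := restart_spec hb hc hloc a g.loc
  obtain ⟨⟨τ, hτ⟩, hclosest, hhalf⟩ := hp'
  have hout₂ : g₂.out ε lead lead = ⟨{ K with loc := p.2, base := p.1 },
      commands g₂.loc p.2 (rep (join E u v)) K.col, fun _ => none⟩ := by
    have h1 : ¬ ∃ p : Tally n × Request n ℓ, (g₂.know lead).req = some p.2 ∧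
        ∃ i, (i, Msg.num p.1) ∈ g₂.msgs lead := by
      rintro ⟨p, -, i, hp⟩
      obtain ⟨-, x', -, h⟩ := (hM₂ _ _ _).1 hp; cases h
    have h2 : ¬ ∃ i u v, (i, Msg.alarm u v) ∈ g₂.msgs lead := by
      rintro ⟨i, x, y, hp⟩
      obtain ⟨-, x', -, h⟩ := (hM₂ _ _ _).1 hp; cases h
    have h3 : ¬ ∃ p : Fin n × Fin n, ∃ i, (i, Msg.op p.1 p.2) ∈ g₂.msgs lead := by
      rintro ⟨q, i, hp⟩
      obtain ⟨-, x', -, h⟩ := (hM₂ _ _ _).1 hp; cases h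
    have h4 : ∃ i x r c, (i, Msg.report x r c) ∈ g₂.msgs lead :=
      ⟨g.loc u, u, _, a u, (hM₂ _ _ _).2 ⟨rfl, u, rfl, rfl⟩⟩
    rw [Net.out, hm₂.req]
    simp only [act]
    rw [dif_neg h1, if_neg h2, dif_neg h3, if_pos h4, onReports, ← hK, hKgen, hKloc, hKcol, ← hp,
      hloc₂]
  obtain ⟨hA, hloc₃, hmov₃, hcomm₃, hkl, hko⟩ := hm₂.announced hMo hout₂ hKs hKmono
  have hp2v : Valid ε p.2 := hclosest.balanced.valid hε hd
  refine ⟨hv, by rwa [← hg₁, hloc₁], by rwa [← hg₁, ← hg₂, hloc₂], hA.leads hE ?_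
    hclosest.collocated ?_ ?_ ?_ ?_ ?_ ?_ ?_ hp2v k⟩
  · rw [hloc₃, hloc₂]; exact hl
  · intro j
    by_cases hj : j = lead
    · rw [hj, hkl]
      refine Or.inl ?_
      rw [hknow₂]
      exact hK₂late lead
    · rw [hko j hj, hknow₂]
      exact hK₂late j
  · intro x y hxy
    rw [hkl]
    have : K.gen x y := by rw [hKgen]; exact hxy
    exact this
  · rw [hkl]
  · rw [hkl]
    exact ⟨τ, hτ⟩
  · intro F hF
    refine ⟨hfar F hF, ?_⟩
    rw [hkl, hmov₃, hmov₂, hloc₃, hloc₂]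
    have h1 := hcost.le hE (fun x y h => (hT F hF).2 x y (Or.inl h))
    have h2 : (dist g.loc p.2 : ℝ) ≤ n := by exact_mod_cast dist_le _ _
    -- The late account opens with `S = s = 0`; the early cost and the at most `n` moves of the
    -- restart are absorbed in the constant `K` of `LateCost`.
    refine ⟨0, 0, p.2, hclosest.balanced, by simp [dist_self], le_rfl, ?_, ?_, ?_⟩
    · refine Finset.sum_nonneg fun C _ => mul_nonneg (by positivity) ?_
      exact div_nonneg (Real.log_natCast_nonneg _) (Real.log_nonneg (by norm_num))
    · simp only
      rw [hτ] at hclosest ⊢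
      exact_mod_cast hclosest.dist_le_of_perm (hT F hF).1 (hT F hF).2
    · push_cast
      simp only [sub_self, zero_div, mul_zero, add_zero, sub_zero]
      linarith
  -- The alarm (`ℓ`), the reports (`n`) and the classes (at most `n`) sum to at most `3 * n`, hence
  -- six times the moves of the restart; the commands add 2 and the three units still open at most
  -- 3, in total 11.
  · have h1 : ℓ ≤ n := Nat.le_of_dvd hn hd
    have h2 := card_classes_le (join E u v)
    rw [hloc₂] at hcomm₃
    rw [hmov₃, hmov₂, hloc₃, hloc₂]
    omega
  · rw [hloc₃, hloc₂]; exact hv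

end Early

end DistUF


namespace DistUF

/-! ### Remote unions in the early phase, and the treatment of an arbitrary operation -/

section Remote

open scoped Classical

variable {n ℓ : ℕ} {ε : ℝ} {lead : Fin ℓ} {g : Net n ℓ} {E : Fin n → Fin n → Prop} {u v : Fin n}
  {a new : Fin n → Fin ℓ} {T : Set (Fin n → Fin ℓ)}

lemma Know.learn_num (K : Know n ℓ) (i : Fin ℓ) (t : Tally n) :
    K.learn none {(i, Msg.num t)} = K := by
  cases K
  simp [Know.learn, TellsRel, TellsCol, TellsLoc]

lemma Net.tally_out {i j : Fin ℓ} {t : Tally n} {r : Request n ℓ} (hq : g.req j = none)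
    (hr : (g.know j).req = some r) (hM : g.msgs j = {(i, Msg.num t)}) :
    g.out ε lead j = onTally ε j (g.know j) (g.stored j) r t := by
  have h : ∃ p : Tally n × Request n ℓ, (g.know j).req = some p.2 ∧
      ∃ i, (i, Msg.num p.1) ∈ g.msgs j := ⟨(t, r), hr, i, by rw [hM]; rfl⟩
  have h' : h.choose = (t, r) := by
    obtain ⟨h1, k, h2⟩ := h.choose_spec
    have key : ∀ s : Tally n, (k, Msg.num s) ∈ g.msgs j → s = t := by
      intro s hs
      rw [hM] at hs
      simpa using congrArg Prod.snd hs
    have key' : ∀ s, (g.know j).req = some s → s = r := by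
      intro s hs
      rw [hr] at hs
      exact (Option.some.inj hs).symm
    exact Prod.ext (key _ h2) (key' _ h1)
  rw [Net.out, hq]
  simp only [act]
  rw [dif_pos h, h', hM, Know.learn_num]

/-- At least one orientation always satisfies `MoveRule`. Both servers evaluate the same predicate
on the same two tallies and so agree on who moves. -/
lemma not_firstMoves {s t : Tally n} (h : ¬ FirstMoves s t) :
    MoveRule t.size s.size (t.own + s.other) (t.other + s.own) := by
  unfold FirstMoves MoveRule at h
  unfold MoveRule
  omega

/-- The part of the merged class on the server of `u`. -/
lemma Net.Mid.part_left (hm : g.Mid E g.loc u v) (hE : Equivalence E)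
    (hl : ∀ x y, E x y → g.loc x = g.loc y) (hloc : g.loc u ≠ g.loc v) {r : Request n ℓ}
    (hr : r.u = u) : (g.know (g.loc u)).part (g.stored (g.loc u)) r = cls E u := by
  ext x
  simp only [Know.part, Finset.mem_filter, Net.mem_stored, mem_cls, hr]
  constructor
  · rintro ⟨h1, h2⟩
    exact (filter_join_left hl hloc
      (Know.gen_sound (join_equivalence hE u v) (hm.sound _) h2)).1 h1
  · exact fun h => ⟨(hl _ _ h).symm, hm.complete u x h⟩

/-- The part of the merged class on the server of `v`. -/
lemma Net.Mid.part_right (hm : g.Mid E g.loc u v) (hE : Equivalence E)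
    (hl : ∀ x y, E x y → g.loc x = g.loc y) (hloc : g.loc u ≠ g.loc v) {r : Request n ℓ}
    (hr : r.u = u) : (g.know (g.loc v)).part (g.stored (g.loc v)) r = cls E v := by
  ext x
  simp only [Know.part, Finset.mem_filter, Net.mem_stored, mem_cls, hr]
  constructor
  · rintro ⟨h1, h2⟩
    exact (filter_join_right hE hl hloc
      (Know.gen_sound (join_equivalence hE u v) (hm.sound _) h2)).1 h1
  · exact fun h => ⟨(hl _ _ h).symm,
      (Know.gen_equivalence _).trans (hm.union _ (Or.inr rfl)) (hm.complete v x h)⟩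

lemma count_congr {a b : Fin n → Fin ℓ} {C : Finset (Fin n)} (h : ∀ x ∈ C, a x = b x) :
    count a C = count b C := by
  funext c
  unfold count
  congr 1
  refine Finset.filter_congr fun x hx => ?_
  rw [h x hx]

lemma tally_congr {a b : Fin n → Fin ℓ} {C : Finset (Fin n)} (h : ∀ x ∈ C, a x = b x)
    (S : Finset (Fin n)) (i k : Fin ℓ) : tally a S C i k = tally b S C i k := by
  simp only [tally, count_congr h]

lemma Net.EarlyPhase.of_remote (h : g.EarlyPhase a E) (hg : g.Quiet) (hE : Equivalence E)
    (hk : g.Knows E) (hv : Valid ε g.loc) (ha : PerfectlyBalanced a) (hd : ℓ ∣ n) (hε : 0 < ε)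
    (hT : ∀ F ∈ T, PerfectlyBalanced F ∧ ∀ x y, join E u v x y → F x = F y) (hne : T.Nonempty)
    (hloc : g.loc u ≠ g.loc v) (k : ℕ) :
    Net.Leads ε lead (Net.Inv ε lead a T (join E u v)) (k + 4) (g.first ε lead u v) := by
  have hJ := join_equivalence hE u v
  have hl := hk.collocated
  have huv : ¬ E u v := fun h => hloc (hl u v h)
  have hjuv : join E u v v u := Or.inr (Or.inr ⟨hE.refl _, hE.refl _⟩)
  set r := g.request u v with hr
  set g₁ := g.first ε lead u v with hg₁
  have hloc₁ : g₁.loc = g.loc := Net.first_loc hg u v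
  have hm : g₁.Mid E g₁.loc u v := by rw [hloc₁]; exact Net.first_mid hg hE hk u v
  have hl₁ : ∀ x y, E x y → g₁.loc x = g₁.loc y := by rw [hloc₁]; exact hl
  have hne₁ : g₁.loc u ≠ g₁.loc v := by rwa [hloc₁]
  have hK : ∀ j, j = g.loc u ∨ j = g.loc v →
      (g.know j).learn (some r) ∅ = g₁.know j := by
    intro j hj
    have : (g.deliver (u, v)).req j = some r := if_pos hj
    rw [hg₁, Net.first_know hg, this]
  have hst : ∀ j, g.stored j = g₁.stored j := by
    intro j; ext x; simp [hloc₁]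
  set t : Fin ℓ → Tally n := fun j => (g₁.know j).tally (g₁.stored j) r j with ht
  have hsne : r.serverU ≠ r.serverV := hloc
  have hpu : r.partner (g.loc u) = g.loc v := if_pos rfl
  have hpv : r.partner (g.loc v) = g.loc u := if_neg (Ne.symm hloc)
  have hM : ∀ j i m, (i, m) ∈ g₁.msgs j ↔
      (i = g.loc u ∨ i = g.loc v) ∧ j = r.partner i ∧ m = Msg.num (t i) := by
    intro j i m
    rw [hg₁, Net.mem_first_msgs hg]
    refine and_congr_right fun hi => ?_
    simp only at hi ⊢
    rw [← hr, hK i hi, onRequest, if_neg (h.late i), if_pos hsne, hst]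
    simp [ht]
  have hMu : g₁.msgs (g₁.loc u) = {(g.loc v, Msg.num (t (g.loc v)))} := by
    ext ⟨i, m⟩
    rw [hM, hloc₁]
    simp only [Set.mem_singleton_iff, Prod.mk.injEq]
    constructor
    · rintro ⟨rfl | rfl, h1, h2⟩
      · exact absurd (h1.trans hpu) hloc
      · exact ⟨rfl, h2⟩
    · rintro ⟨rfl, h2⟩
      exact ⟨Or.inr rfl, hpv.symm, h2⟩
  have hMv : g₁.msgs (g₁.loc v) = {(g.loc u, Msg.num (t (g.loc u)))} := by
    ext ⟨i, m⟩
    rw [hM, hloc₁]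
    simp only [Set.mem_singleton_iff, Prod.mk.injEq]
    constructor
    · rintro ⟨rfl | rfl, h1, h2⟩
      · exact ⟨rfl, h2⟩
      · exact absurd (h1.trans hpv) (Ne.symm hloc)
    · rintro ⟨rfl, h2⟩
      exact ⟨Or.inl rfl, hpu.symm, h2⟩
  have hidle : ∀ j, j ≠ g₁.loc u → j ≠ g₁.loc v → g₁.out ε lead j =
      ⟨g₁.know j, ∅, fun _ => none⟩ := by
    intro j hj hj'
    rw [hloc₁] at hj hj'
    have : g₁.msgs j = ∅ := by
      ext ⟨i, m⟩
      rw [hM]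
      simp only [Set.mem_empty_iff_false, iff_false, not_and]
      rintro (rfl | rfl) h1
      · exact absurd (h1.trans hpu) hj'
      · exact absurd (h1.trans hpv) hj
    rw [Net.out, this, hm.req, act_idle]
  have hru : r.u = u := rfl
  have hsU : r.serverU = g₁.loc u := by rw [hloc₁]; rfl
  have hcol₁ : ∀ x, (g₁.know (g₁.loc x)).col x = a x := by
    intro x
    rw [hloc₁, hg₁, Net.first_col hg]
    exact h.col x
  have hpartu := hm.part_left hE hl₁ hne₁ hru
  have hpartv := hm.part_right hE hl₁ hne₁ hru
  have htu : t (g.loc u) = tally a (g₁.stored (g₁.loc u)) (cls E u) (g₁.loc u) (g₁.loc v) := by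
    simp only [ht, Know.tally, hpu]
    rw [← hloc₁, hpartu]
    refine tally_congr (fun x hx => ?_) _ _ _
    rw [hl₁ _ _ (mem_cls.1 hx)]
    exact hcol₁ x
  have htv : t (g.loc v) = tally a (g₁.stored (g₁.loc v)) (cls E v) (g₁.loc v) (g₁.loc u) := by
    simp only [ht, Know.tally, hpv]
    rw [← hloc₁, hpartv]
    refine tally_congr (fun x hx => ?_) _ _ _
    rw [hl₁ _ _ (mem_cls.1 hx)]
    exact hcol₁ x
  have houtu : g₁.out ε lead (g₁.loc u) = onTally ε (g₁.loc u) (g₁.know (g₁.loc u))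
      (g₁.stored (g₁.loc u)) r (t (g.loc v)) :=
    Net.tally_out (hm.req _) (by rw [hloc₁]; exact Net.first_req hg (Or.inl rfl)) hMu
  have houtv : g₁.out ε lead (g₁.loc v) = onTally ε (g₁.loc v) (g₁.know (g₁.loc v))
      (g₁.stored (g₁.loc v)) r (t (g.loc u)) :=
    Net.tally_out (hm.req _) (by rw [hloc₁]; exact Net.first_req hg (Or.inr rfl)) hMv
  have htu' : (g₁.know (g₁.loc u)).tally (g₁.stored (g₁.loc u)) r (g₁.loc u) = t (g.loc u) := by
    rw [hloc₁]
  have htv' : (g₁.know (g₁.loc v)).tally (g₁.stored (g₁.loc v)) r (g₁.loc v) = t (g.loc v) := by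
    rw [hloc₁]
  rw [← hloc₁] at hpu hpv
  simp only [onTally, hsU, if_true, htu', hpu, hpartu, true_iff] at houtu
  simp only [onTally, hsU, if_false, htv', hpv, hpartv, hne₁.symm, false_iff] at houtv
  rw [hloc₁] at htu' htv'
  have hlate : ∀ j, ¬ (g₁.know j).late := fun j hj => h.late j ((Net.first_late hg u v j).1 hj)
  have hanch : Anchored a g₁.loc E := by rw [hloc₁]; exact h.anchored
  have hcost : EarlyCost a g₁.loc E g₁.moves := by
    rw [hloc₁, Net.first_moves hg]; exact h.cost
  have hv₁ : Valid ε g₁.loc := by rwa [hloc₁]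
  have hcomm : g₁.comm ≤ 4 * g₁.moves + 3 := by
    have h1 := h.comm
    have h2 : ∑ j, (if j = g.loc u ∨ j = g.loc v then
        onRequest lead j (g.know j) ((g.know j).learn (some (g.request u v)) ∅) (g.stored j)
          (g.request u v) else ∅).card ≤ 2 := by
      calc _ ≤ ∑ j, ((if j = g.loc u then 1 else 0) + (if j = g.loc v then 1 else 0)) := by
            refine Finset.sum_le_sum fun j _ => ?_
            rw [onRequest, if_neg (h.late j), ← hr, if_pos hsne]
            by_cases hj : j = g.loc u
            · simp [hj]
            · by_cases hj' : j = g.loc v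
              · simp [hj']
              · simp [hj, hj']
        _ = 2 := by simp [Finset.sum_add_distrib]
    rw [hg₁, Net.first_comm hg, Net.first_moves hg, if_neg hloc]
    omega
  have hloadu : (g₁.stored (g₁.loc u)).card = load g₁.loc (g₁.loc u) := rfl
  have hloadv : (g₁.stored (g₁.loc v)).card = load g₁.loc (g₁.loc v) := rfl
  have hfits : Fits ℓ ε (t (g.loc u)) (t (g.loc v)) ↔
      if FirstMoves (t (g.loc u)) (t (g.loc v)) then
        Valid ε (moveTo (join E u v) g₁.loc u (g₁.loc v))
      else Valid ε (moveTo (join E v u) g₁.loc v (g₁.loc u)) := by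
    rw [valid_moveTo_iff hl₁ hne₁ hv₁, valid_moveTo_iff hl₁ hne₁.symm hv₁, ← hloadu, ← hloadv,
      Fits]
    conv_lhs => rw [htu, htv]
    conv_rhs => rw [htu, htv]
    rfl
  have hcases : (FirstMoves (t (g.loc u)) (t (g.loc v)) →
      MoveRule (cls E u).card (cls E v).card
      (count a (cls E u) (g₁.loc u) + count a (cls E v) (g₁.loc u))
      (count a (cls E u) (g₁.loc v) + count a (cls E v) (g₁.loc v))) ∧
      (¬ FirstMoves (t (g.loc u)) (t (g.loc v)) →
      MoveRule (cls E v).card (cls E u).card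
      (count a (cls E v) (g₁.loc v) + count a (cls E u) (g₁.loc v))
      (count a (cls E v) (g₁.loc u) + count a (cls E u) (g₁.loc u))) := by
    rw [htu, htv]
    exact ⟨fun h => h, fun h => not_firstMoves h⟩
  by_cases hF : Fits ℓ ε (t (g.loc u)) (t (g.loc v))
  · rw [if_pos hF] at houtu houtv
    rw [hfits] at hF
    by_cases hfm : FirstMoves (t (g.loc u)) (t (g.loc v))
    · rw [if_pos hfm] at hF houtu
      rw [if_neg (not_not.2 hfm)] at houtv
      refine hm.leads_of_move hE hl₁ (w := u) (z := v) rfl (hJ.refl u) hne₁ houtu ?_ hlate hcol₁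
        hanch hcost hcomm hv₁ huv hF (hcases.1 hfm) (k + 2)
      intro j hj
      by_cases hjv : j = g₁.loc v
      · rw [hjv]; exact houtv
      · exact hidle j hj hjv
    · rw [if_neg hfm] at hF houtu
      rw [if_pos hfm] at houtv
      refine hm.leads_of_move hE hl₁ (w := v) (z := u) (join_comm E v u) hjuv hne₁.symm houtv ?_
        hlate hcol₁ hanch hcost hcomm hv₁ (fun h => huv (hE.symm h)) hF (hcases.2 hfm) (k + 2)
      intro j hj
      by_cases hju : j = g₁.loc u
      · rw [hju]; exact houtu
      · exact hidle j hju hj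
  · rw [if_neg hF] at houtu houtv
    refine hm.leads_of_alarm hE hl₁ hne₁ houtu ?_ hcol₁ hcost hcomm hv₁ hd hε hT hne ?_ k
    · intro j hj
      by_cases hjv : j = g₁.loc v
      · rw [hjv]; exact houtv
      · exact hidle j hj hjv
    -- The rejected move would have kept the classes anchored. So the overfull assignment is within
    -- `3 * total minor ≤ 3 * dist a F` of `a`, yet further than `ε n / ℓ` from it.
    · intro F hFT
      have h1 := total_minor_le (a := a) hJ (hT F hFT).2
      rw [hfits] at hF
      by_cases hfm : FirstMoves (t (g.loc u)) (t (g.loc v))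
      · rw [if_pos hfm] at hF
        have h2 := ha.lt_dist hd hF
        have h3 := (hanch.moveTo hE huv hl₁ (hcases.1 hfm)).dist_le hJ
          (moveTo_collocated hE hl₁ _)
        linarith
      · rw [if_neg hfm] at hF
        have h2 := ha.lt_dist hd hF
        have h3 := (hanch.moveTo hE (fun h => huv (hE.symm h)) hl₁ (hcases.2 hfm)).dist_le
          (join_equivalence hE v u) (moveTo_collocated hE hl₁ _)
        rw [join_comm E v u] at h3
        rw [join_comm E v u] at h2
        linarith

/-- One operation. -/
lemma Net.Inv.leads_deliver (h : g.Inv ε lead a T E) (hg : g.Quiet) (hE : Equivalence E)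
    (hv : Valid ε g.loc) (ha : PerfectlyBalanced a) (hd : ℓ ∣ n) (hε : 0 < ε)
    (hT : ∀ F ∈ T, PerfectlyBalanced F ∧ ∀ x y, join E u v x y → F x = F y) (hne : T.Nonempty) :
    Net.Leads ε lead (Net.Inv ε lead a T (join E u v)) 5 (g.deliver (u, v)) := by
  refine ⟨hv, ?_⟩
  rcases h.phase with hp | hp
  · by_cases hloc : g.loc u = g.loc v
    · exact hp.of_local hg hE h.knows hv hloc 4
    · exact hp.of_remote hg hE h.knows hv ha hd hε hT hne hloc 0
  · by_cases huv : E u v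
    · exact hp.of_rel hg hE h.knows hv huv 4
    · exact hp.of_not_rel hg hE h.knows hv hd hε hT hne huv 2

end Remote

end DistUF


namespace DistUF

/-! ### Final assignments -/

section Final

open scoped Classical

variable {n ℓ : ℕ} {σ : List (Fin n × Fin n)}

lemma Complete.card_cls (h : Complete ℓ σ) (x : Fin n) : (cls (SameSet σ) x).card = n / ℓ := by
  rw [← h x, ← Set.ncard_coe_finset]
  congr 1
  ext y
  simp

/-- When all sets have size `n / ℓ`, they can be distributed to the servers. -/
lemma Complete.exists_balanced (h : Complete ℓ σ) (hn : 0 < n) (hd : ℓ ∣ n) :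
    ∃ F : Fin n → Fin ℓ, PerfectlyBalanced F ∧ ∀ x y, SameSet σ x y → F x = F y := by
  have hE := sameSet_equivalence σ
  have hmem : ∀ x, cls (SameSet σ) x ∈ classes (SameSet σ) := fun x =>
    Finset.mem_image_of_mem _ (Finset.mem_univ _)
  have hcard : (classes (SameSet σ)).card = ℓ := by
    have h1 := sum_classes hE (fun _ => 1)
    have h2 : ∑ C ∈ classes (SameSet σ), ∑ x ∈ C, (1 : ℝ) =
        ∑ C ∈ classes (SameSet σ), ((n / ℓ : ℕ) : ℝ) := by
      refine Finset.sum_congr rfl fun C hC => ?_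
      obtain ⟨x, -, rfl⟩ := Finset.mem_image.1 hC
      rw [Finset.sum_const, h.card_cls, nsmul_eq_mul, mul_one]
    rw [h2] at h1
    simp only [Finset.sum_const, nsmul_eq_mul, mul_one, Finset.card_univ, Fintype.card_fin] at h1
    have h3 : (classes (SameSet σ)).card * (n / ℓ) = n := by exact_mod_cast h1
    have h4 : ℓ * (n / ℓ) = n := Nat.mul_div_cancel' hd
    have h5 : 0 < n / ℓ := Nat.div_pos (Nat.le_of_dvd hn hd) (Nat.pos_of_dvd_of_pos hd hn)
    exact Nat.eq_of_mul_eq_mul_right h5 (h3.trans h4.symm)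
  let e := Finset.equivFinOfCardEq hcard
  refine ⟨fun x => e ⟨cls (SameSet σ) x, hmem x⟩, fun j => ?_, fun x y hxy => ?_⟩
  · obtain ⟨⟨C, hC⟩, rfl⟩ := e.surjective j
    obtain ⟨y, -, rfl⟩ := Finset.mem_image.1 hC
    rw [← h.card_cls y, load]
    congr 1
    ext x
    simp only [EmbeddingLike.apply_eq_iff_eq, Subtype.mk.injEq, Finset.mem_filter,
      Finset.mem_univ, true_and, mem_cls, cls_eq_iff hE]
    exact ⟨hE.symm, hE.symm⟩
  · simp only [EmbeddingLike.apply_eq_iff_eq, Subtype.mk.injEq, cls_eq_iff hE]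
    exact hxy

/-- In the end, a valid assignment is perfectly balanced. -/
lemma Complete.perfectlyBalanced (h : Complete ℓ σ) (hn : 0 < n) (hd : ℓ ∣ n) {ε : ℝ}
    (hε : ε < 1) {F : Fin n → Fin ℓ} (hv : Valid ε F)
    (hF : ∀ x y, SameSet σ x y → F x = F y) : PerfectlyBalanced F := by
  have hE := sameSet_equivalence σ
  have hN : 0 < n / ℓ := Nat.div_pos (Nat.le_of_dvd hn hd) (Nat.pos_of_dvd_of_pos hd hn)
  have hle : ∀ j, load F j ≤ n / ℓ := by
    intro j
    by_contra hj
    rw [not_le] at hj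
    obtain ⟨x, hx⟩ : (Finset.univ.filter (fun x => F x = j)).Nonempty :=
      Finset.card_pos.1 (lt_of_le_of_lt (Nat.zero_le _) hj)
    -- A server with more than `n / ℓ` elements meets a second set and contains both entirely, but
    -- `2 * (n / ℓ)` exceeds its capacity.
    obtain ⟨y, hy, hxy⟩ := Finset.exists_mem_notMem_of_card_lt_card
      (s := cls (SameSet σ) x) (t := Finset.univ.filter (fun x => F x = j))
      (by rw [h.card_cls]; exact hj)
    simp only [Finset.mem_filter, Finset.mem_univ, true_and, mem_cls] at hx hy hxy
    have h1 : (cls (SameSet σ) x ∪ cls (SameSet σ) y).card ≤ load F j := by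
      refine Finset.card_le_card fun z hz => ?_
      simp only [Finset.mem_union, mem_cls, Finset.mem_filter, Finset.mem_univ, true_and] at hz ⊢
      rcases hz with hz | hz
      · rw [← hF x z hz, hx]
      · rw [← hF y z hz, hy]
    rw [Finset.card_union_of_disjoint (disjoint_cls hE hxy), h.card_cls, h.card_cls] at h1
    have h2 := hv j
    rw [← Nat.cast_div_charZero hd] at h2
    have h3 : (((n / ℓ + n / ℓ : ℕ)) : ℝ) ≤ load F j := by exact_mod_cast h1
    push_cast at h3
    have h4 : (0 : ℝ) < (n / ℓ : ℕ) := by exact_mod_cast hN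
    nlinarith
  have hsum : ∑ j, load F j = ∑ _j : Fin ℓ, n / ℓ := by
    rw [sum_load, Finset.sum_const, Finset.card_univ, Fintype.card_fin, smul_eq_mul,
      Nat.mul_div_cancel' hd]
  intro j
  exact (Finset.sum_eq_sum_iff_of_le (fun j _ => hle j)).1 hsum j (Finset.mem_univ j)

lemma dist_le_offlineMoves (s : ℕ → Fin n → Fin ℓ) (r : ℕ) :
    dist (s 0) (s r) ≤ offlineMoves s r := by
  induction r with
  | zero => simp [offlineMoves, dist_self]
  | succ r ih =>
    rw [offlineMoves, Finset.sum_range_succ]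
    exact (dist_triangle _ (s r) _).trans (Nat.add_le_add_right ih _)

end Final

/-! ### The encoding of messages -/

section Encoding

variable {n ℓ : ℕ}

/-- A message as a tuple of numbers. -/
def Msg.code (h : ℓ ≤ n) : Msg n ℓ →
    Fin 6 × Fin (n + 1) × Fin (n + 1) × Fin (n + 1) × Fin (n + 1)
  | .num t => (0, t.size, t.own, t.other, t.load)
  | .info x r c => (1, x.castSucc, r.castSucc, (c.castLE h).castSucc, 0)
  | .report x r c => (2, x.castSucc, r.castSucc, (c.castLE h).castSucc, 0)
  | .alarm u v => (3, u.castSucc, v.castSucc, 0, 0)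
  | .op u v => (4, u.castSucc, v.castSucc, 0, 0)
  | .cmd x k => (5, x.castSucc, (k.castLE h).castSucc, 0, 0)

lemma Msg.code_injective (h : ℓ ≤ n) : Function.Injective (Msg.code h) := by
  rintro (⟨⟨⟩⟩ | _ | _ | _ | _ | _) (⟨⟨⟩⟩ | _ | _ | _ | _ | _) <;> simp [Msg.code]

lemma exists_encoding (hn : 2 ≤ n) (h : ℓ ≤ n) :
    ∃ (enc : Msg n ℓ → BitVec (11 * Nat.clog 2 n)) (dec : BitVec (11 * Nat.clog 2 n) → Msg n ℓ),
      ∀ m, dec (enc m) = m := by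
  have h1 : 1 ≤ Nat.clog 2 n := Nat.clog_pos (by norm_num) hn
  have h2 : n + 1 ≤ 2 ^ (Nat.clog 2 n + 1) := by
    have := Nat.le_pow_clog (b := 2) (by norm_num) n
    have h3 : 1 ≤ 2 ^ Nat.clog 2 n := Nat.one_le_two_pow
    rw [pow_succ]
    omega
  -- Three bits for the kind and four numbers below `n + 1` need `3 + 4 * (clog + 1)` bits, at most
  -- `11 * clog` since `clog ≥ 1`.
  have hcard : Fintype.card (Fin 6 × Fin (n + 1) × Fin (n + 1) × Fin (n + 1) × Fin (n + 1)) ≤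
      Fintype.card (Fin (2 ^ (11 * Nat.clog 2 n))) := by
    simp only [Fintype.card_prod, Fintype.card_fin]
    calc 6 * ((n + 1) * ((n + 1) * ((n + 1) * (n + 1))))
        = 6 * (n + 1) ^ 4 := by ring
      _ ≤ 2 ^ 3 * (2 ^ (Nat.clog 2 n + 1)) ^ 4 :=
          Nat.mul_le_mul (by norm_num) (Nat.pow_le_pow_left h2 4)
      _ = 2 ^ (3 + (Nat.clog 2 n + 1) * 4) := by rw [← pow_mul, ← pow_add]
      _ ≤ 2 ^ (11 * Nat.clog 2 n) := Nat.pow_le_pow_right (by norm_num) (by omega)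
  obtain ⟨e⟩ := Function.Embedding.nonempty_of_card_le hcard
  let enc : Msg n ℓ → BitVec (11 * Nat.clog 2 n) := fun m => BitVec.ofFin (e (m.code h))
  have hinj : Function.Injective enc := fun m m' hm =>
    Msg.code_injective h (e.injective (BitVec.ofFin.inj hm))
  have : Nonempty (Msg n ℓ) := ⟨.op ⟨0, by omega⟩ ⟨0, by omega⟩⟩
  exact ⟨enc, Function.invFun enc, Function.leftInverse_invFun hinj⟩

end Encoding

/-! ### The runs of the protocol -/

section Run

open scoped Classical

variable {n ℓ w : ℕ} {ε : ℝ} {lead : Fin ℓ} {enc : Msg n ℓ → BitVec w} {dec : BitVec w → Msg n ℓ}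
  {a : Fin n → Fin ℓ} {σ : List (Fin n × Fin n)}

lemma sameSet_nil {x y : Fin n} : SameSet [] x y ↔ x = y := by
  constructor
  · intro h
    exact eq_equivalence.eqvGen_iff.1 (Relation.EqvGen.mono (fun _ _ h => by simp at h) _ _ h)
  · rintro rfl
    exact (sameSet_equivalence _).refl x

/-- The initial configuration of the network. -/
def Net.initial (a : Fin n → Fin ℓ) : Net n ℓ where
  know := fun j => ⟨fun _ _ => False, fun _ => j, False, fun _ => j, fun _ => j, none⟩
  loc := a
  req := fun _ => none
  msgs := fun _ => ∅
  moves := 0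
  comm := 0

lemma Net.initial_represents (a : Fin n → Fin ℓ) :
    Represents ((protocol ε lead enc dec).initial a) (Net.initial a) where
  know _ := rfl
  stored _ := Finset.union_empty _
  loc := rfl
  req _ := rfl
  msgs j := by simp [Algorithm.initial, Net.initial]
  moves := rfl
  comm := rfl

lemma Net.initial_inv (a : Fin n → Fin ℓ) (T : Set (Fin n → Fin ℓ)) :
    (Net.initial a).Inv ε lead a T (SameSet []) where
  knows :=
    { sound := fun _ _ _ h => h.elim
      complete := by
        intro x y h
        rw [sameSet_nil.1 h]
        exact (Know.gen_equivalence _).refl y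
      collocated := fun x y h => by rw [sameSet_nil.1 h] }
  phase := Or.inl
    { late := fun _ h => h
      col := fun _ => rfl
      anchored := anchored_of_subset_fiber fun x y h => by rw [sameSet_nil.1 h]
      cost := earlyCost_zero _ _
      comm := Nat.zero_le _ }

/-- The final assignments that are possible after the operations `σ`. -/
def targets (ℓ : ℕ) (σ : List (Fin n × Fin n)) : Set (Fin n → Fin ℓ) :=
  {F | PerfectlyBalanced F ∧ ∀ x y, SameSet σ x y → F x = F y}

lemma run_take_succ (A : Algorithm n ℓ w) (a : Fin n → Fin ℓ) {i : ℕ} (hi : i < σ.length) :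
    A.run a (σ.take (i + 1)) = A.serve (A.run a (σ.take i)) σ[i] := by
  rw [List.take_succ_eq_append_getElem hi, Algorithm.run, List.foldl_append]
  rfl

/-- The invariant holds between the operations. -/
lemma exists_inv (hdec : ∀ m, dec (enc m) = m) (ha : PerfectlyBalanced a) (hd : ℓ ∣ n)
    (hε : 0 < ε) (hne : (targets ℓ σ).Nonempty) {i : ℕ} (hi : i ≤ σ.length) :
    (∃ g : Net n ℓ, Represents ((protocol ε lead enc dec).run a (σ.take i)) g ∧ g.Quiet ∧
      g.Inv ε lead a (targets ℓ σ) (SameSet (σ.take i)) ∧ Valid ε g.loc) ∧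
    (∀ j, (((protocol ε lead enc dec).run a (σ.take i)).inbox j).IsEmpty) ∧
    (∀ hi : i < σ.length, ∀ r ≤ 6, Valid ε ((protocol ε lead enc dec).round^[r]
      ((protocol ε lead enc dec).deliver ((protocol ε lead enc dec).run a (σ.take i))
        σ[i])).loc) := by
  set A := protocol ε lead enc dec with hA
  have step : ∀ i (hi : i < σ.length) (g : Net n ℓ), Represents (A.run a (σ.take i)) g → g.Quiet →
      g.Inv ε lead a (targets ℓ σ) (SameSet (σ.take i)) → Valid ε g.loc →
      (∀ r ≤ 5, Valid ε (A.round^[r] (A.deliver (A.run a (σ.take i)) σ[i])).loc) ∧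
      ∃ g', Represents (A.round^[5] (A.deliver (A.run a (σ.take i)) σ[i])) g' ∧ g'.Quiet ∧
        g'.Inv ε lead a (targets ℓ σ) (SameSet (σ.take (i + 1))) ∧ Valid ε g'.loc := by
    intro i hi g hR hq hinv hv
    have hjoin : SameSet (σ.take (i + 1)) = join (SameSet (σ.take i)) σ[i].1 σ[i].2 := by
      rw [List.take_succ_eq_append_getElem hi, ← sameSet_append_singleton]
    have hT : ∀ F ∈ targets ℓ σ, PerfectlyBalanced F ∧
        ∀ x y, join (SameSet (σ.take i)) σ[i].1 σ[i].2 x y → F x = F y := by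
      intro F hF
      refine ⟨hF.1, fun x y hxy => hF.2 x y ?_⟩
      rw [← hjoin] at hxy
      -- Later operations only coarsen the sets, so a target for all of `σ` collocates the sets of
      -- every prefix.
      have := hxy.append (σ.drop (i + 1))
      rwa [List.take_append_drop] at this
    have h := hinv.leads_deliver (u := σ[i].1) (v := σ[i].2) hq (sameSet_equivalence _) hv ha hd hε
      hT hne
    rw [← hjoin] at h
    exact h.spec hdec (hR.deliver σ[i])
  have hexists : ∀ i ≤ σ.length, (∃ g : Net n ℓ, Represents (A.run a (σ.take i)) g ∧ g.Quiet ∧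
      g.Inv ε lead a (targets ℓ σ) (SameSet (σ.take i)) ∧ Valid ε g.loc) ∧
      ∀ j, ((A.run a (σ.take i)).inbox j).IsEmpty := by
    intro i
    induction i with
    | zero =>
      intro _
      refine ⟨⟨Net.initial a, Net.initial_represents a, ⟨fun _ => rfl, fun _ => rfl⟩, ?_,
        ha.valid hε hd⟩, fun j => ⟨rfl, rfl, rfl⟩⟩
      exact Net.initial_inv a _
    | succ i ih =>
      intro hi
      obtain ⟨⟨g, hR, hq, hinv, hv⟩, -⟩ := ih (by omega)
      obtain ⟨-, g', hR', hq', hinv', hv'⟩ := step i hi g hR hq hinv hv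
      rw [run_take_succ A a hi]
      have hround : A.serve (A.run a (σ.take i)) σ[i] =
          A.round (A.round^[5] (A.deliver (A.run a (σ.take i)) σ[i])) :=
        Function.iterate_succ_apply' A.round 5 _
      rw [hround]
      have hR'' := hR'.round hdec
      rw [hq'.next] at hR''
      exact ⟨⟨g', hR'', hq', hinv', hv'⟩, hR'.quiet hq'⟩
  refine ⟨(hexists i hi).1, (hexists i hi).2, fun hi' r hr => ?_⟩
  obtain ⟨⟨g, hR, hq, hinv, hv⟩, -⟩ := hexists i hi
  obtain ⟨h5, g', hR', hq', -, hv'⟩ := step i hi' g hR hq hinv hv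
  rcases Nat.lt_or_ge r 6 with h | h
  · exact h5 r (by omega)
  · obtain rfl : r = 6 := by omega
    have hR'' := hR'.round hdec
    rw [hq'.next] at hR''
    have e : A.round^[6] (A.deliver (A.run a (σ.take i)) σ[i]) =
        A.round (A.round^[5] (A.deliver (A.run a (σ.take i)) σ[i])) :=
      Function.iterate_succ_apply' A.round 5 _
    rw [e, hR''.loc]
    exact hv'

lemma protocol_solves (hdec : ∀ m, dec (enc m) = m) (ha : PerfectlyBalanced a) (hd : ℓ ∣ n)
    (hε : 0 < ε) (hne : (targets ℓ σ).Nonempty) :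
    (protocol ε lead enc dec).Solves ε a σ where
  valid i hi r hr := (exists_inv hdec ha hd hε hne hi.le).2.2 hi r hr
  collocated i hi := by
    obtain ⟨⟨g, hR, -, hinv, -⟩, -⟩ := exists_inv (lead := lead) hdec ha hd hε hne hi
    rw [hR.loc]
    exact hinv.knows.collocated
  quiet i hi := (exists_inv hdec ha hd hε hne hi).2.1
  find i hi x y := by
    obtain ⟨⟨g, hR, -, hinv, -⟩, -⟩ := exists_inv (lead := lead) hdec ha hd hε hne hi
    simp only [protocol, Finset.mem_filter, Finset.mem_univ, true_and]
    have h1 := hR.know (g.loc x)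
    have h2 := hR.loc
    simp only [protocol] at h1 h2
    rw [h2, h1]
    exact ⟨fun h => Know.gen_sound (sameSet_equivalence _) (hinv.knows.sound _) h,
      hinv.knows.complete x y⟩

lemma Net.Inv.comm_le {g : Net n ℓ} {T : Set (Fin n → Fin ℓ)} {E : Fin n → Fin n → Prop}
    (h : g.Inv ε lead a T E) : g.comm ≤ 11 * g.moves := by
  rcases h.phase with h | h
  · have := h.comm
    omega
  · have := h.comm
    omega

/-- In units of `ℓ / ε * L * O`, where `L = logb 2 n` and `O = dist a F`, the 38 splits into 27 for
the early phase, 3 for the restart, 6 for `2 * S` and 2 for the rebalancings. The units 3 and 6 use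
`n ≤ 3 * (ℓ / ε) * O`. -/
lemma Net.Inv.moves_le {g : Net n ℓ} {T : Set (Fin n → Fin ℓ)} {E : Fin n → Fin n → Prop}
    (hE : Equivalence E) (h : g.Inv ε lead a T E) (hn : 2 ≤ n) (hε : 0 < ε) (hε' : ε < 1)
    {F : Fin n → Fin ℓ} (hF : F ∈ T) (hF' : ∀ x y, E x y → F x = F y) :
    (g.moves : ℝ) ≤ 38 * (ℓ * Real.logb 2 n / ε) * dist a F := by
  have hℓ : (1 : ℝ) ≤ ℓ := by exact_mod_cast lead.pos
  have hn' : (2 : ℝ) ≤ n := by exact_mod_cast hn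
  set L := Real.logb 2 n with hL
  set O : ℝ := ((DistUF.dist a F : ℕ) : ℝ)
  have hO0 : 0 ≤ O := by positivity
  have hL1 : 1 ≤ L := by
    rw [hL, Real.le_logb_iff_rpow_le (by norm_num) (by linarith)]
    simpa using hn'
  have hlog : Real.log n ≤ L := by
    rw [hL, Real.logb, le_div_iff₀ (Real.log_pos (by norm_num))]
    have h1 := Real.log_two_lt_d9
    have h2 : 0 ≤ Real.log n := Real.log_natCast_nonneg n
    nlinarith
  have hr : 1 ≤ ℓ / ε := by
    rw [le_div_iff₀ hε]; linarith
  have h27 : (3 + 24 * Real.log n) * O ≤ 27 * L * O :=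
    mul_le_mul_of_nonneg_right (by linarith) hO0
  have hLO : L * O ≤ ℓ / ε * (L * O) := le_mul_of_one_le_left (by positivity) hr
  have hgoal : 38 * (ℓ * L / ε) * O = 38 * (ℓ / ε * (L * O)) := by ring
  rw [hgoal]
  rcases h.phase with h | h
  · have := h.cost.le hE hF'
    have h0 : 0 ≤ L * O := by positivity
    linarith
  · obtain ⟨h1, S, s, P, h2, h3, h4, h5, h6, h7⟩ := h.cost F hF
    have h8 := total_card_log_le hE
    have hs : 0 ≤ s := le_trans (by positivity) h3
    have hδ : 0 < ε * ((n : ℝ) / ℓ) := by positivity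
    have hSn : S ≤ n * L := h5.trans h8
    have h9 : (n : ℝ) ≤ 3 * (ℓ / ε) * O := by
      have : (n : ℝ) = ε * (n / ℓ) * (ℓ / ε) := by field_simp
      rw [this]
      have := mul_le_mul_of_nonneg_right h1.le (by linarith : 0 ≤ ℓ / ε)
      linarith
    have h10 : (S - s) / (ε * (n / ℓ)) ≤ ℓ / ε * L := by
      rw [div_le_iff₀ hδ]
      have : ℓ / ε * L * (ε * (n / ℓ)) = n * L := by field_simp
      rw [this]
      linarith
    have h11 : 2 * O * ((S - s) / (ε * (n / ℓ))) ≤ 2 * O * (ℓ / ε * L) :=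
      mul_le_mul_of_nonneg_left h10 (by linarith)
    have h12 : (n : ℝ) * L ≤ 3 * (ℓ / ε) * O * L := mul_le_mul_of_nonneg_right h9 (by linarith)
    have h13 : (n : ℝ) ≤ n * L := le_mul_of_one_le_right (by linarith) hL1
    have h14 : 3 * (ℓ / ε) * O * L = 3 * (ℓ / ε * (L * O)) := by ring
    have h15 : 2 * O * (ℓ / ε * L) = 2 * (ℓ / ε * (L * O)) := by ring
    linarith

end Run

/-! ### At most one element -/

section Trivial

variable {n ℓ : ℕ} (w : ℕ)

/-- The algorithm that does nothing. -/
def idleAlgorithm (n ℓ w : ℕ) : Algorithm n ℓ w where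
  State := Unit
  start := fun _ _ => ()
  react := fun _ _ _ _ => ⟨(), [], fun _ => none⟩
  find := fun _ _ => Finset.univ
  rounds := 1

lemma assignment_eq (hn : n ≤ 1) (hd : ℓ ∣ n) (a b : Fin n → Fin ℓ) : a = b := by
  funext x
  have : ℓ ≤ n := Nat.le_of_dvd x.pos hd
  exact Fin.ext (by omega)

lemma idleAlgorithm_round (c : Config (idleAlgorithm n ℓ w).State n ℓ w) :
    ((idleAlgorithm n ℓ w).round c).comm = c.comm ∧
      ∀ j, (((idleAlgorithm n ℓ w).round c).inbox j).IsEmpty := by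
  have h : ∀ j, (idleAlgorithm n ℓ w).reaction c j = ⟨(), [], fun _ => none⟩ := by
    intro j
    rw [Algorithm.reaction]
    split_ifs <;> rfl
  have hl : (idleAlgorithm n ℓ w).newLoc c = c.loc := by
    funext x
    rw [Algorithm.newLoc, h]
    rfl
  refine ⟨by simp [Algorithm.round, h], fun j => ⟨rfl, ?_, ?_⟩⟩
  · simp [Algorithm.round, h]
  · simp only [Algorithm.round, hl, Finset.filter_eq_empty_iff]
    simp

lemma idleAlgorithm_run (hn : n ≤ 1) (hd : ℓ ∣ n) (a : Fin n → Fin ℓ)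
    (σ : List (Fin n × Fin n)) :
    ((idleAlgorithm n ℓ w).run a σ).moves = 0 ∧ ((idleAlgorithm n ℓ w).run a σ).comm = 0 ∧
      ∀ j, (((idleAlgorithm n ℓ w).run a σ).inbox j).IsEmpty := by
  induction σ using List.reverseRecOn with
  | nil => exact ⟨rfl, rfl, fun _ => ⟨rfl, rfl, rfl⟩⟩
  | append_singleton σ q ih =>
    have hrun : (idleAlgorithm n ℓ w).run a (σ ++ [q]) = (idleAlgorithm n ℓ w).round
        ((idleAlgorithm n ℓ w).deliver ((idleAlgorithm n ℓ w).run a σ) q) := by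
      rw [Algorithm.run, List.foldl_append]
      rfl
    rw [hrun]
    obtain ⟨h1, h2⟩ := idleAlgorithm_round w
      ((idleAlgorithm n ℓ w).deliver ((idleAlgorithm n ℓ w).run a σ) q)
    refine ⟨?_, ?_, h2⟩
    · rw [Algorithm.round]
      simp only
      rw [assignment_eq hn hd ((idleAlgorithm n ℓ w).newLoc _) (Config.loc _), dist_self]
      exact ih.1
    · have hq : q.1 = q.2 := Fin.ext (by have := q.1.2; have := q.2.2; omega)
      rw [h1]
      simp only [Algorithm.deliver, hq, if_true, add_zero]
      exact ih.2.1

lemma idleAlgorithm_solves (hn : n ≤ 1) (hd : ℓ ∣ n) {ε : ℝ} (hε : 0 < ε) {a : Fin n → Fin ℓ}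
    (ha : PerfectlyBalanced a) (σ : List (Fin n × Fin n)) :
    (idleAlgorithm n ℓ w).Solves ε a σ where
  valid i hi r hr := by
    rw [assignment_eq hn hd (Config.loc _) a]
    exact ha.valid hε hd
  collocated i hi x y h := by
    have : x = y := Fin.ext (by omega)
    rw [this]
  quiet i hi := (idleAlgorithm_run w hn hd a _).2.2
  find i hi x y := by
    have : x = y := Fin.ext (by omega)
    rw [this]
    exact ⟨fun _ => (sameSet_equivalence _).refl y, fun _ => Finset.mem_univ _⟩

end Trivial

end DistUF

theorem mainTheorem6 :
    ∃ (b : ℕ) (C : ℝ) (D : ℝ → ℝ),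
      ∀ (n ℓ : ℕ) (ε : ℝ), 0 < ℓ → ℓ ∣ n → 0 < ε → ε < 1 / 2 →
        ∃ A : DistUF.Algorithm n ℓ (b * Nat.clog 2 n),
          ∀ (a₀ : Fin n → Fin ℓ) (σ : List (Fin n × Fin n)),
            DistUF.PerfectlyBalanced a₀ → DistUF.Complete ℓ σ →
              A.Solves ε a₀ σ ∧
              (∀ s : ℕ → Fin n → Fin ℓ, DistUF.IsOffline ε a₀ σ s →
                ((A.run a₀ σ).moves : ℝ) ≤
                  C * ((ℓ : ℝ) * Real.logb 2 n * Real.logb 2 ℓ / ε) *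
                    (DistUF.offlineMoves s σ.length : ℝ)) ∧
              (∀ c : ℝ, (ℓ : ℝ) ≤ c * Real.sqrt (ε * n) →
                ((A.run a₀ σ).comm : ℝ) ≤ D c * ((A.run a₀ σ).moves : ℝ)) := by
  refine ⟨11, 38, fun _ => 11, fun n ℓ ε hℓ hd hε hε' => ?_⟩
  -- For `n ≤ 1` messages have no bits, but nothing has to be sent or moved.
  rcases Nat.lt_or_ge n 2 with hn | hn
  · refine ⟨DistUF.idleAlgorithm n ℓ _, fun a σ ha _ => ?_⟩
    have hn1 : n ≤ 1 := by omega
    obtain ⟨h1, h2, -⟩ := DistUF.idleAlgorithm_run (11 * Nat.clog 2 n) hn1 hd a σ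
    refine ⟨DistUF.idleAlgorithm_solves _ hn1 hd hε ha σ, fun s _ => ?_, fun c _ => ?_⟩
    · rw [h1]
      have h3 : 0 ≤ Real.logb 2 n := by
        rcases Nat.le_one_iff_eq_zero_or_eq_one.1 hn1 with rfl | rfl <;> simp
      have h4 : 0 ≤ Real.logb 2 ℓ :=
        Real.logb_nonneg (by norm_num) (by exact_mod_cast hℓ)
      push_cast
      positivity
    · rw [h1, h2]; simp
  · obtain ⟨enc, dec, hdec⟩ := DistUF.exists_encoding hn (Nat.le_of_dvd (by omega) hd)
    refine ⟨DistUF.protocol ε ⟨0, hℓ⟩ enc dec, fun a σ ha hσ => ?_⟩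
    have hne : (DistUF.targets ℓ σ).Nonempty := hσ.exists_balanced (by omega) hd
    obtain ⟨⟨g, hR, -, hinv, -⟩, -⟩ :=
      DistUF.exists_inv (lead := ⟨0, hℓ⟩) (σ := σ) hdec ha hd hε hne le_rfl
    rw [List.take_length] at hR hinv
    refine ⟨DistUF.protocol_solves hdec ha hd hε hne, fun s hs => ?_, fun c _ => ?_⟩
    · have hcoll := hs.collocated σ.length le_rfl
      rw [List.take_length] at hcoll
      have hbal := hσ.perfectlyBalanced (by omega) hd (by linarith) (hs.valid _ le_rfl) hcoll
      have hmoves := hinv.moves_le (DistUF.sameSet_equivalence _) hn hε (by linarith)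
        (F := s σ.length) ⟨hbal, hcoll⟩ hcoll
      have hoff : (DistUF.dist a (s σ.length) : ℝ) ≤ DistUF.offlineMoves s σ.length := by
        have := DistUF.dist_le_offlineMoves s σ.length
        rw [hs.zero] at this
        exact_mod_cast this
      have hL : 0 ≤ Real.logb 2 n :=
        Real.logb_nonneg (by norm_num) (by exact_mod_cast (by omega : 1 ≤ n))
      rw [hR.moves]
      -- For `ℓ = 1` the factor `logb 2 ℓ` vanishes, so the moves must be shown to be zero: there is
      -- only one assignment.
      rcases Nat.lt_or_ge ℓ 2 with hℓ2 | hℓ2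
      · have h0 : a = s σ.length := by
          funext x
          exact Fin.ext (by omega)
        rw [← h0, DistUF.dist_self] at hmoves
        have h1 : 0 ≤ Real.logb 2 ℓ := Real.logb_nonneg (by norm_num) (by exact_mod_cast hℓ)
        have h2 : (g.moves : ℝ) ≤ 0 := by simpa using hmoves
        exact h2.trans (by positivity)
      · have h1 : 1 ≤ Real.logb 2 ℓ := by
          rw [Real.le_logb_iff_rpow_le (by norm_num) (by exact_mod_cast hℓ)]
          simpa using (by exact_mod_cast hℓ2 : (2 : ℝ) ≤ ℓ)
        calc (g.moves : ℝ) ≤ 38 * (ℓ * Real.logb 2 n / ε) * DistUF.dist a (s σ.length) := hmoves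
          _ ≤ 38 * (ℓ * Real.logb 2 n / ε) * DistUF.offlineMoves s σ.length :=
              mul_le_mul_of_nonneg_left hoff (by positivity)
          _ ≤ 38 * (ℓ * Real.logb 2 n / ε) * DistUF.offlineMoves s σ.length * Real.logb 2 ℓ :=
              le_mul_of_one_le_right (by positivity) h1
          _ = _ := by ring
    · rw [hR.comm, hR.moves]
      have h := hinv.comm_le
      show (g.comm : ℝ) ≤ 11 * (g.moves : ℝ)
      exact_mod_cast h
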